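/- **Setting.** Let $X$ be a non-compact connected Riemann surface, $o\in X$, and let $h$ be a smooth Hermitian metric on $X$, written locally as $h\,dz\otimes d\bar z$, with Gauss curvature $K=-\frac1h\frac{\partial^2\log h}{\partial z\,\partial\bar z}$. Let $\mathscr S$ be a holomorphic $1$-form on $X$ without zeros whose integral along every smooth closed curve vanishes, and suppose that the holomorphic function $\hat x=\int_o^x\mathscr S$ vanishes only at $x=o$. For $r>0$ let $D(r)=\{x:|\hat x|<r\}$, and let $R\in(0,\infty]$ be the supremum of all $r>0$ for which $\{x:|\hat x|=r\}\neq\emptyset$. Suppose that $\mathscr S$ is an exhaustion form: whenever $0<r_1<r_2<\cdots\to\infty$, the discs $D(r_n)$ cover $X$ and either $\overline{D(r_n)}$ is compact and contained in $D(r_{n+1})$ for all $n$, or there is a $k\ge 1$ such that this holds for all $n<k$ while $D(r_n)=X$ for all $n\geq k$. Write locally $\mathscr S=\varphi\,dz$ and $\|\mathscr S_x\|_h=|\varphi|/\sqrt h$, and put $$\|\mathscr S\|_{r,\sup}=\sup_{D(r)}\|\mathscr S_x\|_h,\qquad \|\mathscr S\|_{r,\inf}=\inf_{D(r)}\|\mathscr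 S_x\|_h .$$ Fix $0<r_0<R$. For a meromorphic function $f:X\to\overline{\mathbb C}$ and $a\in\overline{\mathbb C}$ let $$T_f(r)=\int_{r_0}^r\frac{dt}{t}\int_{D(t)}f^*\omega_{FS},\qquad \overline N_f(r,a)=\int_{r_0}^r\frac{\overline n_f(t,a)}{t}\,dt,$$ where $\omega_{FS}=\frac{\sqrt{-1}}{2\pi}\partial\bar\partial\log(1+|\zeta|^2)$ and $\overline n_f(t,a)$ is the number of points of $D(t)$ at which $f=a$, counted without multiplicity. **Theorem.** Let $\gamma\ge 0$ be a function on $(0,R)$ that is integrable on $(0,s)$ for every $s<R$ and satisfies $\int_0^R\gamma(r)\,dr=\infty$. Let $f$ be a nonconstant meromorphic function on $X$ and let $a_1,\dots,a_q\in\overline{\mathbb C}$ be distinct. Suppose that $-C\le K\le 0$ on $X$ for a constant $C\ge 0$. Then there is a constant $A>0$ such that for every $\delta>0$ there is a measurable set $E_\delta\subset(0,R)$ with $\int_{E_\delta}\gamma(r)\,dr<\infty$ and $$(q-2)\,T_f(r)\le\sum_{j=1}^q\overline N_f(r,a_j)+A\Big(\log T_f(r)+C\,r^2\,\|\mathscr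 S\|_{r,\inf}^{-1}+\log\|\mathscr S\|_{r,\sup}+\log^+\gamma(r)+\delta\log r\Big)$$ for all $r\in(0,R)\setminus E_\delta$, where $\log^+ s=\max(0,\log s)$ (and $\log^+0=0$). In particular $A$ does not depend on $r$ or $\delta$. -/

import Mathlib

open Set MeasureTheory Filter
open scoped Manifold Topology ENNReal ContDiff

noncomputable section

namespace HoloNevanlinna

/-- A holomorphic one-form on a Riemann surface, written as `coeff e · dz` in every chart `e` of the
atlas (`z` being the coordinate of `e`). The values of `coeff` away from the atlas, or off the
target of a chart, carry no meaning. -/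
structure HolomorphicForm (X : Type*) [TopologicalSpace X] [ChartedSpace ℂ X] where
  /-- the coefficient of the form in a chart, as a function of the coordinate -/
  coeff : OpenPartialHomeomorph X ℂ → ℂ → ℂ
  holomorphic : ∀ e ∈ atlas ℂ X, DifferentiableOn ℂ (coeff e) e.target
  compatible : ∀ e ∈ atlas ℂ X, ∀ e' ∈ atlas ℂ X, ∀ x ∈ e.source ∩ e'.source,
    coeff e (e x) = coeff e' (e' x) * deriv (fun z => e' (e.symm z)) (e x)

/-- A smooth Hermitian metric on a Riemann surface, written as `density e · dz ⊗ dz̄` with a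
positive function `density e` in every chart `e` of the atlas. -/
structure HermitianMetric (X : Type*) [TopologicalSpace X] [ChartedSpace ℂ X] where
  /-- the local density of the metric in a chart, as a function of the coordinate -/
  density : OpenPartialHomeomorph X ℂ → ℂ → ℝ
  pos : ∀ e ∈ atlas ℂ X, ∀ z ∈ e.target, 0 < density e z
  smooth : ∀ e ∈ atlas ℂ X, ContDiffOn ℝ (⊤ : ℕ∞) (density e) e.target
  compatible : ∀ e ∈ atlas ℂ X, ∀ e' ∈ atlas ℂ X, ∀ x ∈ e.source ∩ e'.source,
    density e (e x) = density e' (e' x) * ‖deriv (fun z => e' (e.symm z)) (e x)‖ ^ 2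

variable {X : Type*} [TopologicalSpace X] [ChartedSpace ℂ X]

/-- The Gauss curvature `K = -(1/h) ∂²(log h)/∂z∂z̄ = -(1/(4h)) (∂²/∂x² + ∂²/∂y²) log h`
of the metric `h dz ⊗ dz̄` (whose Riemannian metric is `2h|dz|²`). -/
def HermitianMetric.gaussCurvature (h : HermitianMetric X) (x : X) : ℝ :=
  -(Laplacian.laplacian (fun z : ℂ => Real.log (h.density (chartAt ℂ x) z))
      (chartAt ℂ x x)) / (4 * h.density (chartAt ℂ x) (chartAt ℂ x x))

namespace HolomorphicForm

/-- The pointwise norm `‖φ dz‖ = |φ| / √h` of the form with respect to the metric `h dz ⊗ dz̄`. -/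
def pointNorm (S : HolomorphicForm X) (h : HermitianMetric X) (x : X) : ℝ :=
  ‖S.coeff (chartAt ℂ x) (chartAt ℂ x x)‖ / √(h.density (chartAt ℂ x) (chartAt ℂ x x))

/-- The form has no zeros. -/
def NowhereVanishing (S : HolomorphicForm X) : Prop :=
  ∀ e ∈ atlas ℂ X, ∀ z ∈ e.target, S.coeff e z ≠ 0

/-- The integral of the form along the curve `c` restricted to the parameter interval `[0, 1]`. -/
def lineIntegral (S : HolomorphicForm X) (c : ℝ → X) : ℂ :=
  ∫ t in (0 : ℝ)..1, S.coeff (chartAt ℂ (c t)) (chartAt ℂ (c t) (c t)) *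
    deriv (fun s => chartAt ℂ (c t) (c s)) t

end HolomorphicForm

/-- `c` is a smooth curve which leads from `p` at time `0` to `x` at time `1`. -/
def IsSmoothCurve (c : ℝ → X) (p x : X) : Prop :=
  ContMDiff 𝓘(ℝ, ℝ) 𝓘(ℝ, ℂ) (⊤ : ℕ∞) c ∧ c 0 = p ∧ c 1 = x

namespace HolomorphicForm

/-- The integral of the form along every smooth closed curve is zero. -/
def ZeroPeriods (S : HolomorphicForm X) : Prop :=
  ∀ (p : X) (c : ℝ → X), IsSmoothCurve c p p → S.lineIntegral c = 0

open Classical in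
/-- The function `x̂ = ∫_o^x S`: the integral of the form along some smooth curve from `o` to `x`.
For a form with zero periods it does not depend on the curve. -/
def hat (S : HolomorphicForm X) (o x : X) : ℂ :=
  if hc : ∃ c : ℝ → X, IsSmoothCurve c o x then S.lineIntegral hc.choose else 0

/-- The disc `{x : |x̂| < r}`. -/
def disc (S : HolomorphicForm X) (o : X) (r : ℝ) : Set X := {x | ‖S.hat o x‖ < r}

/-- The circle `{x : |x̂| = r}`. -/
def circle (S : HolomorphicForm X) (o : X) (r : ℝ) : Set X := {x | ‖S.hat o x‖ = r}

/-- `S` makes `X` an `S`-Riemann surface: it has no zeros and no periods, and `x̂ = 0` only at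
`o`. -/
structure IsAdmissible (S : HolomorphicForm X) (o : X) : Prop where
  nowhereVanishing : S.NowhereVanishing
  zeroPeriods : S.ZeroPeriods
  hat_eq_zero_iff : ∀ x, S.hat o x = 0 ↔ x = o

/-- `S` is an exhaustion form: for `0 < r 0 < r 1 < ⋯ → ∞` the discs of radii `r n` cover `X`, and
either each of them is relatively compact in the next one (parabolic case), or this holds up to an
index from which on they are all equal to `X` (hyperbolic case). -/
def IsExhaustion (S : HolomorphicForm X) (o : X) : Prop :=
  ∀ r : ℕ → ℝ, StrictMono r → (∀ n, 0 < r n) → Tendsto r atTop atTop →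
    (⋃ n, S.disc o (r n)) = univ ∧
    ((∀ n, IsCompact (closure (S.disc o (r n))) ∧
        closure (S.disc o (r n)) ⊆ S.disc o (r (n + 1))) ∨
      ∃ k, (∀ n < k, IsCompact (closure (S.disc o (r n))) ∧
          closure (S.disc o (r n)) ⊆ S.disc o (r (n + 1))) ∧
        ∀ n, k ≤ n → S.disc o (r n) = univ)

/-- The radius of `X` with respect to `o`: the supremum, in `[0, ∞]`, of the `r > 0` for which the
circle of radius `r` is not empty. -/
def radius (S : HolomorphicForm X) (o : X) : EReal :=
  sSup {ρ : EReal | ∃ r : ℝ, 0 < r ∧ (S.circle o r).Nonempty ∧ ρ = (r : EReal)}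

/-- The supremum of the pointwise norm of `S` over the disc of radius `r`. -/
def normSup (S : HolomorphicForm X) (h : HermitianMetric X) (o : X) (r : ℝ) : ℝ :=
  sSup (S.pointNorm h '' S.disc o r)

/-- The infimum of the pointwise norm of `S` over the disc of radius `r`. -/
def normInf (S : HolomorphicForm X) (h : HermitianMetric X) (o : X) (r : ℝ) : ℝ :=
  sInf (S.pointNorm h '' S.disc o r)

end HolomorphicForm

/-- The affine coordinate `ζ` of the Riemann sphere (set to `0` at `∞`). -/
def affineCoord (p : OnePoint ℂ) : ℂ := p.elim 0 (fun w => w)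

/-- The coordinate `1/ζ` of the Riemann sphere near `∞` (set to `0` at `0`). -/
def affineCoordInv (p : OnePoint ℂ) : ℂ := p.elim 0 (fun w => w⁻¹)

/-- `f` is a meromorphic function, as a holomorphic map to the Riemann sphere: it is continuous,
`f` is holomorphic where `f ≠ ∞`, and `1/f` is holomorphic where `f ≠ 0`. -/
def IsMeromorphic (f : X → OnePoint ℂ) : Prop :=
  Continuous f ∧ ∀ e ∈ atlas ℂ X,
    DifferentiableOn ℂ (fun z => affineCoord (f (e.symm z)))
      (e.target ∩ {z | f (e.symm z) ≠ OnePoint.infty}) ∧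
    DifferentiableOn ℂ (fun z => affineCoordInv (f (e.symm z)))
      (e.target ∩ {z | f (e.symm z) ≠ ((0 : ℂ) : OnePoint ℂ)})

open Classical in
/-- The density, with respect to Lebesgue measure `dx dy` in the chart `e`, of the pull-back by `f`
of the Fubini-Study form `ω = dd^c log(1 + |ζ|²) = (i/2π) dζ ∧ dζ̄ / (1 + |ζ|²)²`; the formula in
the coordinate `1/ζ` is the same and is used at the poles of `f`. -/
def pullbackFS (f : X → OnePoint ℂ) (e : OpenPartialHomeomorph X ℂ) (z : ℂ) : ℝ :=
  if f (e.symm z) = OnePoint.infty then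
    ‖deriv (fun w => affineCoordInv (f (e.symm w))) z‖ ^ 2 /
      (Real.pi * (1 + ‖affineCoordInv (f (e.symm z))‖ ^ 2) ^ 2)
  else
    ‖deriv (fun w => affineCoord (f (e.symm w))) z‖ ^ 2 /
      (Real.pi * (1 + ‖affineCoord (f (e.symm z))‖ ^ 2) ^ 2)

/-- The measure on `X` which a family `u` of local densities (of a nonnegative `(1,1)`-form) defines:
the supremum, over the charts `e` of the atlas, of the measures on the chart domains given by
`u e dx dy`. As these agree on overlaps, it restricts to each of them on the domain of the chart. -/
def measureOfDensity [MeasurableSpace X]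
    (u : OpenPartialHomeomorph X ℂ → ℂ → ℝ) : Measure X :=
  ⨆ e ∈ atlas ℂ X, Measure.map e.symm
    ((volume.restrict e.target).withDensity (fun z => ENNReal.ofReal (u e z)))

namespace HolomorphicForm

/-- The characteristic function `T_f(r) = ∫_{r₀}^r (dt/t) ∫_{disc t} f^* ω`. -/
def characteristic [MeasurableSpace X] (S : HolomorphicForm X) (o : X) (r₀ : ℝ)
    (f : X → OnePoint ℂ) (r : ℝ) : ℝ :=
  ∫ t in r₀..r, (measureOfDensity (pullbackFS f) (S.disc o t)).toReal / t

/-- The simple counting function `N̄_f(r, a) = ∫_{r₀}^r n̄(t, a) dt/t`, where `n̄(t, a)` is the number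
of points of the disc of radius `t` at which `f` takes the value `a`, without multiplicities. -/
def simpleCounting (S : HolomorphicForm X) (o : X) (r₀ : ℝ)
    (f : X → OnePoint ℂ) (a : OnePoint ℂ) (r : ℝ) : ℝ :=
  ∫ t in r₀..r, ({x | x ∈ S.disc o t ∧ f x = a}.ncard : ℝ) / t

end HolomorphicForm

end HoloNevanlinna

end

/-! The differential of `x̂` is `S`, which has no zeros, so `x̂` is a local biholomorphism. The
exhaustion condition makes it proper over every closed disc of radius less than `R`, and the fibre
over `0` is a single point, so its degree is one (`existsUnique_hat_eq`). Hence `x̂` identifies `X`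
with the disc `|w| < R` (`exists_isGlobalChart`), `D(r)` with a concentric disc, and `T` and `N̄`
with the classical functions of `F = f ∘ x̂⁻¹` (`characteristic_eq`, `simpleCounting_eq`). What
remains is the second main theorem on a disc, with an exceptional set measured by `γ`.

On each smaller disc `F = q/p` with `p`, `q` holomorphic and without common zeros. Let `N = |p|² +
|q|²`, `u = (log N)/2`, let `W` be the Wronskian, `L_j` the linear form in `p`, `q` given by a unit
covector vanishing at `a_j`, `v_j = |L_j|²/N` the squared chordal distance and `σ = |W|²/N²` the
squared spherical derivative. By Green's formula `T` is the increment of the circle means of `u`.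
Off the zeros, `log(σ / ∏ v_j) / 2 = log |W / ∏ L_j| + (m - 2) u` (`logSingular_eq`). The quotient
`W / ∏ L_j` has only simple poles, located where `F` takes a value `a_j`. Jensen's inequality
therefore bounds `(m - 2) T` by `∑ N̄`, plus the circle mean of `log(σ / ∏ v_j) / 2`, plus a
constant (`circleAverage_logSingular_ge`).

That mean has to be small. At each point at most one `v_j` is near zero, so `log(σ / ∏ v_j) / 2` is
at most `log(∑ σ / (v_j (2 - log v_j)²)) / 2 + log ∑ (2 - log v_j)` plus a constant
(`logSingular_le`). Concavity of the logarithm moves the means inside. The mean of `2 - log v_j` is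
at most a constant plus `2 T` by the first main theorem (`circleAverage_logProximity_le`). The
densities `σ / (v_j (2 - log v_j)²)` have the potential `-log(2 - log v_j)` up to a multiple of `σ`,
so their integrals over discs, integrated again against `dt/t`, are bounded linearly in `T`
(`lintegral_logWeight_le`). Two applications of `borel_growth` pass from this double integral to the
mean over a single circle, outside a set of finite `γ`-measure.

The outcome is an error `c (1 + log⁺ T + log⁺ γ + δ log⁺ r)` with `c` independent of `δ`. In
`exists_error_bound` the additive constants disappear into `log T` if `R = ∞`, because `T` grows at
least like `log r`, and into `log⁺ γ` if `R < ∞`, because on a bounded interval the set where `γ ≤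
M` has finite `γ`-measure. Of the two metric terms only a common lower bound is needed. -/

noncomputable section

namespace HoloNevanlinna

/-! ### Wirtinger derivatives -/

/-- `f` is real differentiable at `z` with `∂f = a`, `∂̄f = b`. -/
def HasWirtingerAt (f : ℂ → ℂ) (a b z : ℂ) : Prop :=
  HasFDerivAt f (a • (1 : ℂ →L[ℝ] ℂ) + b • (Complex.conjCLE : ℂ →L[ℝ] ℂ)) z

namespace HasWirtingerAt

variable {f g : ℂ → ℂ} {a b c d z : ℂ}

theorem of_hasDerivAt (h : HasDerivAt f a z) : HasWirtingerAt f a 0 z := by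
  have := h.hasFDerivAt.restrictScalars ℝ
  refine this.congr_fderiv ?_
  ext x; simp [mul_comm]

theorem const (c : ℂ) : HasWirtingerAt (fun _ => c) 0 0 z := of_hasDerivAt (hasDerivAt_const z c)

theorem congr (h : HasWirtingerAt f a b z) (ha : a = c) (hb : b = d) : HasWirtingerAt f c d z := by
  subst ha hb; exact h

theorem add (hf : HasWirtingerAt f a b z) (hg : HasWirtingerAt g c d z) :
    HasWirtingerAt (fun w => f w + g w) (a + c) (b + d) z := by
  refine (HasFDerivAt.add hf hg).congr_fderiv ?_
  ext x; simp; ring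

theorem mul (hf : HasWirtingerAt f a b z) (hg : HasWirtingerAt g c d z) :
    HasWirtingerAt (fun w => f w * g w) (a * g z + f z * c) (b * g z + f z * d) z := by
  refine (HasFDerivAt.mul hf hg).congr_fderiv ?_
  refine ContinuousLinearMap.ext fun x => ?_
  simp only [add_apply, smul_apply, smul_eq_mul,
    one_apply_eq_self]
  ring

theorem conj (hf : HasWirtingerAt f a b z) :
    HasWirtingerAt (fun w => (starRingEnd ℂ) (f w)) ((starRingEnd ℂ) b) ((starRingEnd ℂ) a) z := by
  have := (Complex.conjCLE : ℂ →L[ℝ] ℂ).hasFDerivAt.comp z hf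
  refine this.congr_fderiv ?_
  refine ContinuousLinearMap.ext fun x => ?_
  simp
  ring

theorem inv (hf : HasWirtingerAt f a b z) (h0 : f z ≠ 0) :
    HasWirtingerAt (fun w => (f w)⁻¹) (-a / f z ^ 2) (-b / f z ^ 2) z := by
  have h1 := ((hasDerivAt_inv h0).hasFDerivAt.restrictScalars ℝ).comp z hf
  refine h1.congr_fderiv ?_
  refine ContinuousLinearMap.ext fun x => ?_
  simp
  field_simp

theorem div (hf : HasWirtingerAt f a b z) (hg : HasWirtingerAt g c d z) (h0 : g z ≠ 0) :
    HasWirtingerAt (fun w => f w / g w) ((a * g z - f z * c) / g z ^ 2)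
      ((b * g z - f z * d) / g z ^ 2) z := by
  simp only [div_eq_mul_inv]
  refine (hf.mul (hg.inv h0)).congr ?_ ?_ <;> field_simp <;> ring

/-- A real function of a real valued function. -/
theorem ofReal_comp {v : ℂ → ℝ} {φ : ℝ → ℝ} {φ' : ℝ} (hv : HasWirtingerAt (fun w => (v w : ℂ)) a b z)
    (hφ : HasDerivAt φ φ' (v z)) :
    HasWirtingerAt (fun w => (φ (v w) : ℂ)) (φ' * a) (φ' * b) z := by
  have h1 : HasFDerivAt v (Complex.reCLM.comp
      (a • (1 : ℂ →L[ℝ] ℂ) + b • (Complex.conjCLE : ℂ →L[ℝ] ℂ))) z :=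
    Complex.reCLM.hasFDerivAt.comp z hv
  -- Since `v` is real valued, the imaginary part of its differential vanishes. This is what turns
  -- the real part produced by the chain rule back into the full complex expression.
  have him : Complex.imCLM.comp (a • (1 : ℂ →L[ℝ] ℂ) + b • (Complex.conjCLE : ℂ →L[ℝ] ℂ)) = 0 := by
    have h2 : HasFDerivAt (fun w => Complex.imCLM ((v w : ℂ))) _ z :=
      Complex.imCLM.hasFDerivAt.comp z hv
    have h3 : HasFDerivAt (fun w : ℂ => Complex.imCLM ((v w : ℂ))) (0 : ℂ →L[ℝ] ℝ) z := by
      simpa using hasFDerivAt_const (0 : ℝ) z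
    exact h2.unique h3
  have h2 := hφ.hasFDerivAt.comp z h1
  have h3 := Complex.ofRealCLM.hasFDerivAt.comp z h2
  refine h3.congr_fderiv ?_
  refine ContinuousLinearMap.ext fun x => ?_
  have him' := DFunLike.congr_fun him x
  simp at him' ⊢
  apply Complex.ext
  · simp
    ring
  · simp
    linear_combination (-φ') * him'

theorem continuousAt (hf : HasWirtingerAt f a b z) : ContinuousAt f z :=
  HasFDerivAt.continuousAt hf

/-- The derivative along a curve. -/
theorem comp_hasDerivAt {γ : ℝ → ℂ} {γ' : ℂ} {t : ℝ} (hf : HasWirtingerAt f a b (γ t))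
    (hγ : HasDerivAt γ γ' t) :
    HasDerivAt (fun s => f (γ s)) (a * γ' + b * (starRingEnd ℂ) γ') t := by
  simpa using! HasFDerivAt.comp_hasDerivAt t hf hγ

end HasWirtingerAt


/-! ### Green's formula on discs -/

open Real (circleAverage)

theorem circleMap_hasDerivAt_radius (θ t : ℝ) :
    HasDerivAt (fun ρ : ℝ => circleMap 0 ρ θ) (Complex.exp (θ * Complex.I)) t := by
  have := (Complex.ofRealCLM.hasDerivAt (x := t)).mul_const (Complex.exp (θ * Complex.I))
  simpa [circleMap] using! this

theorem continuous_circleMap_uncurry :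
    Continuous (fun p : ℝ × ℝ => circleMap 0 p.1 p.2) := by
  unfold circleMap; fun_prop

/-- Differentiation of circle averages with respect to the radius, in integrated form. -/
theorem circleAverage_sub_eq_integral {u : ℂ → ℝ} {g : ℝ → ℝ → ℝ} {s r₁ r : ℝ}
    (hr₁ : 0 ≤ r₁) (hr : r₁ ≤ r) (hs : r < s) (hu : ContinuousOn u (Metric.ball 0 s))
    (hg : ContinuousOn (fun p : ℝ × ℝ => g p.1 p.2) (Icc r₁ r ×ˢ univ))
    (hd : ∀ ρ ∈ Icc r₁ r, ∀ θ, HasDerivAt (fun t => u (circleMap 0 t θ)) (g ρ θ) ρ) :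
    circleAverage u 0 r - circleAverage u 0 r₁ =
      ∫ ρ in r₁..r, (2 * Real.pi)⁻¹ * ∫ θ in (0 : ℝ)..2 * Real.pi, g ρ θ := by
  have hc : ∀ t, 0 ≤ t → t < s → Continuous fun θ => u (circleMap 0 t θ) := by
    intro t h0 ht
    refine hu.comp_continuous (continuous_circleMap 0 t) fun θ => ?_
    simpa [abs_of_nonneg h0] using ht
  have hgθ : ∀ θ, ContinuousOn (fun ρ => g ρ θ) (Icc r₁ r) := fun θ =>
    hg.comp (f := fun ρ => (ρ, θ)) (by fun_prop) fun ρ hρ => ⟨hρ, mem_univ _⟩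
  -- The fundamental theorem of calculus is applied along each ray; Fubini then exchanges radius and
  -- angle.
  have hFTC : ∀ θ, u (circleMap 0 r θ) - u (circleMap 0 r₁ θ) = ∫ ρ in r₁..r, g ρ θ := by
    intro θ
    rw [intervalIntegral.integral_eq_sub_of_hasDerivAt (f := fun t => u (circleMap 0 t θ))]
    · intro x hx
      rw [uIcc_of_le hr] at hx
      exact hd x hx θ
    · apply ContinuousOn.intervalIntegrable
      rw [uIcc_of_le hr]
      exact hgθ θ
  rw [Real.circleAverage_def, Real.circleAverage_def, ← smul_sub,
    ← intervalIntegral.integral_sub ((hc r (hr₁.trans hr) hs).intervalIntegrable _ _)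
      ((hc r₁ hr₁ (hr.trans_lt hs)).intervalIntegrable _ _)]
  simp_rw [hFTC]
  rw [intervalIntegral.integral_const_mul, smul_eq_mul,
    intervalIntegral_intervalIntegral_swap (F := fun θ ρ => g ρ θ)]
  rw [uIoc_of_le Real.two_pi_pos.le, uIoc_of_le hr]
  have hK : IsCompact ((Icc 0 (2 * Real.pi)) ×ˢ (Icc r₁ r)) := isCompact_Icc.prod isCompact_Icc
  have h1 : ContinuousOn (Function.uncurry fun θ ρ => g ρ θ) ((Icc 0 (2 * Real.pi)) ×ˢ (Icc r₁ r)) :=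
    hg.comp (f := fun p : ℝ × ℝ => (p.2, p.1)) (by fun_prop) fun p hp => ⟨hp.2, mem_univ _⟩
  exact (h1.integrableOn_compact hK).mono_set (prod_mono Ioc_subset_Icc_self Ioc_subset_Icc_self)

variable {u : ℂ → ℝ} {D A B : ℂ → ℂ} {s : ℝ}

/-- For a real function `∂̄u` is the conjugate of `∂u`, so the two Wirtinger terms add up to twice a
real part. -/
theorem hasDerivAt_radial (hu : ∀ z ∈ Metric.ball (0 : ℂ) s,
      HasWirtingerAt (fun w => (u w : ℂ)) (D z) ((starRingEnd ℂ) (D z)) z)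
    {γ : ℝ → ℂ} {γ' : ℂ} {t : ℝ} (ht : γ t ∈ Metric.ball (0 : ℂ) s) (hγ : HasDerivAt γ γ' t) :
    HasDerivAt (fun x => u (γ x)) (2 * (D (γ t) * γ').re) t := by
  have h1 := (hu _ ht).comp_hasDerivAt hγ
  have h2 := Complex.reCLM.hasFDerivAt.comp_hasDerivAt t h1
  refine (h2.congr_deriv ?_)
  simp
  ring

/-- The radial derivative `ρ ∂u/∂ρ` of a function with `∂u = D`. -/
def radialDeriv (D : ℂ → ℂ) (z : ℂ) : ℝ := 2 * (D z * z).re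

/-- First half of Green's formula: differentiation under the mean turns the increment of the circle
averages into an integral of the flux. -/
theorem green_radial (hD : ContinuousOn D (Metric.ball 0 s))
    (hu : ∀ z ∈ Metric.ball (0 : ℂ) s,
      HasWirtingerAt (fun w => (u w : ℂ)) (D z) ((starRingEnd ℂ) (D z)) z)
    {r₁ r : ℝ} (hr₁ : 0 < r₁) (hr : r₁ ≤ r) (hs : r < s) :
    circleAverage u 0 r - circleAverage u 0 r₁ =
      ∫ ρ in r₁..r, circleAverage (radialDeriv D) 0 ρ / ρ := by
  have hmem : ∀ ρ ∈ Icc r₁ r, ∀ θ, circleMap 0 ρ θ ∈ Metric.ball (0 : ℂ) s := by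
    intro ρ hρ θ
    have : 0 ≤ ρ := hr₁.le.trans hρ.1
    simpa [abs_of_nonneg this] using hρ.2.trans_lt hs
  have hcu : ContinuousOn u (Metric.ball 0 s) := fun z hz =>
    (Complex.continuous_re.continuousAt.comp (hu z hz).continuousAt).continuousWithinAt
  rw [circleAverage_sub_eq_integral (g := fun ρ θ => 2 * (D (circleMap 0 ρ θ) *
    Complex.exp (θ * Complex.I)).re) hr₁.le hr hs hcu]
  · apply intervalIntegral.integral_congr
    intro ρ hρ
    rw [uIcc_of_le hr] at hρ
    have hρ0 : (ρ : ℝ) ≠ 0 := (hr₁.trans_le hρ.1).ne'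
    simp only [Real.circleAverage_def, smul_eq_mul, mul_div_assoc, ← intervalIntegral.integral_div]
    congr 1
    apply intervalIntegral.integral_congr
    intro θ _
    have : circleMap 0 ρ θ = ρ * Complex.exp (θ * Complex.I) := by simp [circleMap]
    simp only [radialDeriv]
    rw [eq_div_iff hρ0]
    conv_rhs => rw [show D (circleMap 0 ρ θ) * circleMap 0 ρ θ =
      (ρ : ℂ) * (D (circleMap 0 ρ θ) * Complex.exp (θ * Complex.I)) by rw [this]; ring]
    rw [Complex.re_ofReal_mul]; ring
  · have h1 : ContinuousOn (fun p : ℝ × ℝ => D (circleMap 0 p.1 p.2)) (Icc r₁ r ×ˢ univ) :=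
      hD.comp continuous_circleMap_uncurry.continuousOn fun p hp => hmem p.1 hp.1 p.2
    have h2 : ContinuousOn (fun p : ℝ × ℝ => D (circleMap 0 p.1 p.2) *
        Complex.exp (p.2 * Complex.I)) (Icc r₁ r ×ˢ univ) := h1.mul (by fun_prop)
    exact continuousOn_const.mul (Complex.continuous_re.comp_continuousOn h2)
  · intro ρ hρ θ
    exact hasDerivAt_radial hu (hmem ρ hρ θ) (circleMap_hasDerivAt_radius θ ρ)

/-- Second half of Green's formula, the divergence theorem: if `D = ∂u` then `4 * (B z).re` is the
Laplacian of `u`. In polar form, the derivative of the flux density in the radius differs from `ρ`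
times this Laplacian by an angular derivative, and the latter integrates to zero over a period. -/
theorem green_area (hD : ∀ z ∈ Metric.ball (0 : ℂ) s, HasWirtingerAt D (A z) (B z) z)
    (hA : ContinuousOn A (Metric.ball 0 s)) (hB : ContinuousOn B (Metric.ball 0 s))
    {t : ℝ} (ht : 0 ≤ t) (hs : t < s) :
    circleAverage (radialDeriv D) 0 t =
      ∫ ρ in (0 : ℝ)..t, ρ * circleAverage (fun z => 4 * (B z).re) 0 ρ := by
  have hmem : ∀ ρ ∈ Icc 0 t, ∀ θ, circleMap 0 ρ θ ∈ Metric.ball (0 : ℂ) s := by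
    intro ρ hρ θ
    simpa [abs_of_nonneg hρ.1] using hρ.2.trans_lt hs
  have hDc : ContinuousOn D (Metric.ball 0 s) := fun z hz =>
    (hD z hz).continuousAt.continuousWithinAt
  have h0 : circleAverage (radialDeriv D) 0 0 = 0 := by simp [radialDeriv]
  have hE : ContinuousOn (fun p : ℝ × ℝ => Complex.exp (p.2 * Complex.I)) (Icc 0 t ×ˢ univ) := by
    fun_prop
  have hEc : ContinuousOn (fun p : ℝ × ℝ => (starRingEnd ℂ) (Complex.exp (p.2 * Complex.I)))
    (Icc 0 t ×ˢ univ) := Complex.continuous_conj.comp_continuousOn hE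
  have hM : ContinuousOn (fun p : ℝ × ℝ => circleMap 0 p.1 p.2) (Icc 0 t ×ˢ univ) :=
    continuous_circleMap_uncurry.continuousOn
  have hcomp : ∀ {G : ℂ → ℂ}, ContinuousOn G (Metric.ball 0 s) →
      ContinuousOn (fun p : ℝ × ℝ => G (circleMap 0 p.1 p.2)) (Icc 0 t ×ˢ univ) := fun hG =>
    hG.comp hM fun p hp => hmem p.1 hp.1 p.2
  have key := circleAverage_sub_eq_integral (u := radialDeriv D) (s := s) (g := fun ρ θ => 2 * (
      (A (circleMap 0 ρ θ) * Complex.exp (θ * Complex.I) +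
        B (circleMap 0 ρ θ) * (starRingEnd ℂ) (Complex.exp (θ * Complex.I))) * circleMap 0 ρ θ +
      D (circleMap 0 ρ θ) * Complex.exp (θ * Complex.I)).re) le_rfl ht hs ?_ ?_ ?_
  · rw [h0, sub_zero] at key
    rw [key]
    apply intervalIntegral.integral_congr
    intro ρ hρ
    rw [uIcc_of_le ht] at hρ
    simp only [Real.circleAverage_def, smul_eq_mul]
    rw [mul_left_comm, ← intervalIntegral.integral_const_mul (ρ)]
    congr 1
    -- The identity `hg` divides by `ρ`, so the centre is separate; there the integrand is a
    -- combination of `cos` and `sin` of mean zero.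
    rcases hρ.1.eq_or_lt with h | hρ0
    · subst h
      have hcs : ∀ θ : ℝ, (2 * (D 0 * Complex.exp (θ * Complex.I)).re) =
          (2 * (D 0).re) * Real.cos θ - (2 * (D 0).im) * Real.sin θ := by
        intro θ
        rw [Complex.exp_mul_I, Complex.mul_re, Complex.add_re, Complex.add_im]
        simp [Complex.cos_ofReal_re, Complex.sin_ofReal_re]
        ring
      simp only [circleMap_zero_radius, Function.const_apply, mul_zero, zero_add, hcs, zero_mul,
        intervalIntegral.integral_zero]
      rw [intervalIntegral.integral_sub (Continuous.intervalIntegrable (by fun_prop) _ _)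
        (Continuous.intervalIntegrable (by fun_prop) _ _)]
      simp
    have hg : ∀ θ, 2 * ((A (circleMap 0 ρ θ) * Complex.exp (θ * Complex.I) +
        B (circleMap 0 ρ θ) * (starRingEnd ℂ) (Complex.exp (θ * Complex.I))) * circleMap 0 ρ θ +
        D (circleMap 0 ρ θ) * Complex.exp (θ * Complex.I)).re =
        ρ * (4 * (B (circleMap 0 ρ θ)).re) - ρ⁻¹ * (2 * ((A (circleMap 0 ρ θ) *
          (circleMap 0 ρ θ * Complex.I) + B (circleMap 0 ρ θ) *
          (starRingEnd ℂ) (circleMap 0 ρ θ * Complex.I)) * (circleMap 0 ρ θ * Complex.I) +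
          D (circleMap 0 ρ θ) * (circleMap 0 ρ θ * Complex.I * Complex.I)).re) := by
      intro θ
      have h1 : circleMap 0 ρ θ = ρ * Complex.exp (θ * Complex.I) := by simp [circleMap]
      have h2 : Complex.exp (θ * Complex.I) * (starRingEnd ℂ) (Complex.exp (θ * Complex.I)) = 1 := by
        rw [Complex.mul_conj, Complex.normSq_eq_norm_sq, Complex.norm_exp_ofReal_mul_I]; simp
      generalize hz : circleMap 0 ρ θ = z at *
      generalize Complex.exp (θ * Complex.I) = e at *
      have h3 : (A z * e + B z * (starRingEnd ℂ) e) * z + D z * e =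
          ((ρ : ℝ) : ℂ) * (2 * B z) - ((ρ⁻¹ : ℝ) : ℂ) * ((A z * (z * Complex.I) + B z *
          (starRingEnd ℂ) (z * Complex.I)) * (z * Complex.I) + D z * (z * Complex.I * Complex.I)) := by
        rw [h1]
        have hρ1 : ((ρ : ℂ)⁻¹) * ρ = 1 := inv_mul_cancel₀ (by exact_mod_cast hρ0.ne')
        simp only [map_mul, Complex.conj_ofReal, Complex.conj_I, Complex.ofReal_inv]
        set e' := (starRingEnd ℂ) e
        linear_combination (Complex.I ^ 2 * (A (ρ * e) * ρ * e ^ 2 - B (ρ * e) * ρ * e * e' +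
          D (ρ * e) * e)) * hρ1 + (A (ρ * e) * ρ * e ^ 2 - B (ρ * e) * ρ * e * e' +
          D (ρ * e) * e) * Complex.I_sq + 2 * B (ρ * e) * ρ * h2
      rw [h3, Complex.sub_re, Complex.re_ofReal_mul, Complex.re_ofReal_mul]
      simp
      ring
    have hmap : ∀ {G : ℂ → ℂ}, ContinuousOn G (Metric.ball 0 s) →
        Continuous (fun θ => G (circleMap 0 ρ θ)) := fun hG =>
      hG.comp_continuous (continuous_circleMap 0 ρ) fun θ => hmem ρ hρ θ
    have hA' := hmap hA
    have hB' := hmap hB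
    have hD' := hmap hDc
    have hcm : Continuous (circleMap 0 ρ) := continuous_circleMap 0 ρ
    -- The integrand is the derivative in `θ` of the tangential component of `D`, a periodic
    -- function.
    have hper : ∫ θ in (0 : ℝ)..2 * Real.pi, (2 * ((A (circleMap 0 ρ θ) *
          (circleMap 0 ρ θ * Complex.I) + B (circleMap 0 ρ θ) *
          (starRingEnd ℂ) (circleMap 0 ρ θ * Complex.I)) * (circleMap 0 ρ θ * Complex.I) +
          D (circleMap 0 ρ θ) * (circleMap 0 ρ θ * Complex.I * Complex.I)).re) = 0 := by
      rw [intervalIntegral.integral_eq_sub_of_hasDerivAt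
        (f := fun θ => 2 * (D (circleMap 0 ρ θ) * (circleMap 0 ρ θ * Complex.I)).re)]
      · have : circleMap 0 ρ (2 * Real.pi) = circleMap 0 ρ 0 := by simp [circleMap]
        simp [this]
      · intro θ _
        have h1 := (hD _ (hmem ρ hρ θ)).comp_hasDerivAt (hasDerivAt_circleMap 0 ρ θ)
        have h2 := h1.mul ((hasDerivAt_circleMap 0 ρ θ).mul_const Complex.I)
        exact (Complex.reCLM.hasFDerivAt.comp_hasDerivAt θ h2).const_mul 2
      · apply Continuous.intervalIntegrable
        have := Complex.continuous_conj.comp (hcm.mul (continuous_const (y := Complex.I)))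
        refine continuous_const.mul (Complex.continuous_re.comp ?_)
        refine Continuous.add (Continuous.mul (Continuous.add ?_ ?_) ?_) ?_
        · exact hA'.mul (hcm.mul continuous_const)
        · exact hB'.mul this
        · exact hcm.mul continuous_const
        · exact hD'.mul ((hcm.mul continuous_const).mul continuous_const)
    simp_rw [hg]
    rw [intervalIntegral.integral_sub, intervalIntegral.integral_const_mul (ρ⁻¹), hper]
    · simp
    · apply Continuous.intervalIntegrable
      exact continuous_const.mul (continuous_const.mul (Complex.continuous_re.comp hB'))
    · apply Continuous.intervalIntegrable
      have := Complex.continuous_conj.comp (hcm.mul (continuous_const (y := Complex.I)))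
      refine continuous_const.mul (continuous_const.mul (Complex.continuous_re.comp ?_))
      refine Continuous.add (Continuous.mul (Continuous.add ?_ ?_) ?_) ?_
      · exact hA'.mul (hcm.mul continuous_const)
      · exact hB'.mul this
      · exact hcm.mul continuous_const
      · exact hD'.mul ((hcm.mul continuous_const).mul continuous_const)
  · exact continuousOn_const.mul (Complex.continuous_re.comp_continuousOn (hDc.mul continuousOn_id))
  · exact continuousOn_const.mul (Complex.continuous_re.comp_continuousOn
      (((((hcomp hA).mul hE).add ((hcomp hB).mul hEc)).mul hM).add ((hcomp hDc).mul hE)))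
  · intro ρ hρ θ
    have h1 := HasWirtingerAt.comp_hasDerivAt (γ := fun t => circleMap 0 t θ)
      (hD _ (hmem ρ hρ θ)) (circleMap_hasDerivAt_radius θ ρ)
    have h2 := h1.mul (circleMap_hasDerivAt_radius θ ρ)
    exact (Complex.reCLM.hasFDerivAt.comp_hasDerivAt ρ h2).const_mul 2

end HoloNevanlinna

namespace HoloNevanlinna

/-! ### Polar coordinates -/

theorem polarCoord_symm_eq_circleMap (p : ℝ × ℝ) :
    Complex.polarCoord.symm p = circleMap 0 p.1 p.2 := by
  rw [Complex.polarCoord_symm_apply, circleMap, Complex.exp_mul_I]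
  simp

theorem lintegral_ball_eq_lintegral_circleMap {K : ℂ → ℝ≥0∞} (hK : Measurable K) (t : ℝ) :
    ∫⁻ z in Metric.ball 0 t, K z =
      ∫⁻ ρ in Ioo 0 t, ENNReal.ofReal ρ * ∫⁻ θ in Ioo (-Real.pi) Real.pi, K (circleMap 0 ρ θ) := by
  have hm : Measurable fun p : ℝ × ℝ => circleMap 0 p.1 p.2 :=
    continuous_circleMap_uncurry.measurable
  rw [← lintegral_indicator Metric.isOpen_ball.measurableSet, ← Complex.lintegral_comp_polarCoord_symm,
    polarCoord_target, Measure.volume_eq_prod, ← Measure.prod_restrict,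
    lintegral_prod _ (by
      simp_rw [polarCoord_symm_eq_circleMap]
      exact ((ENNReal.measurable_ofReal.comp measurable_fst).smul
        ((hK.indicator Metric.isOpen_ball.measurableSet).comp hm)).aemeasurable),
    ← lintegral_indicator measurableSet_Ioi, ← lintegral_indicator measurableSet_Ioo]
  refine lintegral_congr fun ρ => ?_
  by_cases hρ : 0 < ρ
  · rw [indicator_of_mem (by exact hρ)]
    by_cases ht : ρ < t
    · rw [indicator_of_mem (show ρ ∈ Ioo 0 t from ⟨hρ, ht⟩),
        ← lintegral_const_mul (ENNReal.ofReal ρ) (f := fun θ => K (circleMap 0 ρ θ))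
        (hK.comp (continuous_circleMap 0 ρ).measurable)]
      refine lintegral_congr fun θ => ?_
      rw [polarCoord_symm_eq_circleMap, indicator_of_mem (by simpa [abs_of_pos hρ] using ht)]
      rfl
    · rw [indicator_of_notMem (fun h => ht h.2)]
      simp_rw [polarCoord_symm_eq_circleMap]
      have : ∀ θ, circleMap 0 ρ θ ∉ Metric.ball (0 : ℂ) t := by
        intro θ; simpa [abs_of_pos hρ] using ht
      simp [indicator_of_notMem (this _)]
  · rw [indicator_of_notMem (by exact hρ), indicator_of_notMem (fun h => hρ h.1)]

/-- For functions which are continuous on a circle, the angular integral is the circle average. -/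
theorem lintegral_circleMap_eq_circleAverage {K : ℂ → ℝ} {ρ : ℝ}
    (hK : Continuous fun θ => K (circleMap 0 ρ θ)) (h0 : ∀ θ, 0 ≤ K (circleMap 0 ρ θ)) :
    ∫⁻ θ in Ioo (-Real.pi) Real.pi, ENNReal.ofReal (K (circleMap 0 ρ θ)) =
      ENNReal.ofReal (2 * Real.pi * Real.circleAverage K 0 ρ) := by
  have hint : IntegrableOn (fun θ => K (circleMap 0 ρ θ)) (Ioo (-Real.pi) Real.pi) :=
    (hK.integrableOn_Icc).mono_set Ioo_subset_Icc_self
  rw [← ofReal_integral_eq_lintegral_ofReal hint (ae_of_all _ h0)]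
  congr 1
  have hper : Function.Periodic (fun θ => K (circleMap 0 ρ θ)) (2 * Real.pi) := fun θ => by
    simp only [periodic_circleMap 0 ρ θ]
  have h1 := hper.intervalIntegral_add_eq (-Real.pi) 0
  rw [show -Real.pi + 2 * Real.pi = Real.pi by ring, zero_add] at h1
  rw [← integral_Ioc_eq_integral_Ioo, ← intervalIntegral.integral_of_le (by linarith [Real.pi_pos]),
    h1, Real.circleAverage_def, smul_eq_mul, ← mul_assoc,
    mul_inv_cancel₀ Real.two_pi_pos.ne', one_mul]

/-- The area integral of a nonnegative function which is continuous on a larger disc. -/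
theorem lintegral_ball_eq_integral_circleAverage {K : ℂ → ℝ} {s t : ℝ} (ht : 0 ≤ t) (hts : t < s)
    (hK : ContinuousOn K (Metric.ball 0 s)) (h0 : ∀ z ∈ Metric.ball (0 : ℂ) s, 0 ≤ K z) :
    ∫⁻ z in Metric.ball 0 t, ENNReal.ofReal (K z) =
      ENNReal.ofReal (2 * Real.pi * ∫ ρ in (0 : ℝ)..t, ρ * Real.circleAverage K 0 ρ) := by
  classical
  set K' : ℂ → ℝ := (Metric.ball 0 s).piecewise K 0 with hK'
  have hmeas : Measurable K' :=
    ContinuousOn.measurable_piecewise hK continuousOn_const Metric.isOpen_ball.measurableSet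
  have hmem : ∀ ρ ∈ Ico 0 s, ∀ θ, circleMap 0 ρ θ ∈ Metric.ball (0 : ℂ) s := by
    intro ρ hρ θ
    simpa [abs_of_nonneg hρ.1] using hρ.2
  have hcirc : ∀ ρ ∈ Ico 0 s, Continuous fun θ => K (circleMap 0 ρ θ) := fun ρ hρ =>
    hK.comp_continuous (continuous_circleMap 0 ρ) (hmem ρ hρ)
  have hEq : EqOn K' K (Metric.ball 0 s) := fun z hz => by simp [hK', hz]
  have h1 : ∫⁻ z in Metric.ball 0 t, ENNReal.ofReal (K z) =
      ∫⁻ z in Metric.ball 0 t, ENNReal.ofReal (K' z) := by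
    refine setLIntegral_congr_fun Metric.isOpen_ball.measurableSet fun z hz => ?_
    simp only [hEq (Metric.ball_subset_ball hts.le hz)]
  have hcont : ContinuousOn (fun ρ => ρ * Real.circleAverage K 0 ρ) (Icc 0 t) := by
    refine continuousOn_id.mul (Real.ContinuousOn.circleAverage (hK.mono fun z hz => ?_)
      fun ρ hρ => hρ.1)
    simpa using hz.2.trans_lt hts
  rw [h1, lintegral_ball_eq_lintegral_circleMap hmeas.ennreal_ofReal,
    ← intervalIntegral.integral_const_mul,
    intervalIntegral.integral_of_le ht, integral_Ioc_eq_integral_Ioo,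
    ofReal_integral_eq_lintegral_ofReal]
  · refine setLIntegral_congr_fun measurableSet_Ioo fun ρ hρ => ?_
    have hρ' : ρ ∈ Ico 0 s := ⟨hρ.1.le, hρ.2.trans hts⟩
    have : ∀ θ, K' (circleMap 0 ρ θ) = K (circleMap 0 ρ θ) := fun θ => hEq (hmem ρ hρ' θ)
    simp only [this]
    rw [lintegral_circleMap_eq_circleAverage (hcirc ρ hρ') (fun θ => h0 _ (hmem ρ hρ' θ)),
      ← ENNReal.ofReal_mul hρ.1.le]
    congr 1; ring
  · exact ((continuousOn_const.mul hcont).integrableOn_Icc).mono_set Ioo_subset_Icc_self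
  · refine (ae_restrict_iff' measurableSet_Ioo).2 (ae_of_all _ fun ρ hρ => ?_)
    have hρ' : ρ ∈ Ico 0 s := ⟨hρ.1.le, hρ.2.trans hts⟩
    have : 0 ≤ Real.circleAverage K 0 ρ := Real.circleAverage_nonneg_of_nonneg fun z hz => h0 z (by
      rw [mem_sphere_zero_iff_norm, abs_of_pos hρ.1] at hz
      simpa [hz] using hρ'.2)
    have := hρ.1.le
    have := Real.pi_pos
    simp only [Pi.zero_apply]
    positivity

/-! ### Borel's growth lemma -/

/-- The primitive is monotone, so its sublevel set is an interval starting at `a`. Up to its right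
end point it is exhausted by the intervals `(a, p)` with `p` rational and still in the sublevel, and
each of these has integral at most `c`. No continuity or finiteness of the primitive is needed. -/
theorem setLIntegral_primitive_le {D : ℝ → ℝ≥0∞} (a : ℝ) (c : ℝ≥0∞) :
    ∫⁻ r in {r | a < r ∧ ∫⁻ ρ in Ioo a r, D ρ ≤ c}, D r ≤ c := by
  set V : ℝ → ℝ≥0∞ := fun r => ∫⁻ ρ in Ioo a r, D ρ
  have hV : Monotone V := fun x y h => lintegral_mono_set (Ioo_subset_Ioo_right h)
  let ι := {p : ℚ // V p ≤ c}
  let S : ι → Set ℝ := fun p => Ioo a (p.1 : ℝ)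
  have hdir : Directed (· ⊆ ·) S := by
    intro p p'
    rcases le_total p.1 p'.1 with h | h
    · exact ⟨p', Ioo_subset_Ioo_right (by exact_mod_cast h), subset_rfl⟩
    · exact ⟨p, subset_rfl, Ioo_subset_Ioo_right (by exact_mod_cast h)⟩
  -- Between two left-over points there would be a rational, which would cover the smaller one.
  have hsub : ({r | a < r ∧ V r ≤ c} \ ⋃ p, S p).Subsingleton := by
    have key : ∀ x y, x ∈ ({r | a < r ∧ V r ≤ c} \ ⋃ p, S p) → y ∈ {r | a < r ∧ V r ≤ c} →
        ¬ x < y := by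
      intro x y hx hy hxy
      obtain ⟨p, hp1, hp2⟩ := exists_rat_btwn hxy
      exact hx.2 (mem_iUnion.2 ⟨⟨p, (hV hp2.le).trans hy.2⟩, hx.1.1, hp1⟩)
    intro x hx y hy
    exact le_antisymm (not_lt.1 (key y x hy hx.1)) (not_lt.1 (key x y hx hy.1))
  have hle : ∫⁻ r in {r | a < r ∧ V r ≤ c}, D r ≤ ∫⁻ r in ⋃ p, S p, D r := by
    refine lintegral_mono' (Measure.restrict_mono_ae ?_) le_rfl
    have h0 : volume ({r | a < r ∧ V r ≤ c} \ ⋃ p, S p) = 0 := hsub.measure_zero _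
    exact ae_le_set.2 h0
  refine hle.trans ?_
  rw [setLIntegral_iUnion_of_directed D hdir]
  exact iSup_le fun p => p.2

/-- **Borel's growth lemma**, for a primitive `V` of a function `D`. -/
theorem borel_growth {D : ℝ → ℝ≥0∞} (hD : Measurable D) (a : ℝ) {δ : ℝ} (hδ : 0 < δ)
    {g : ℝ → ℝ} (hg : Measurable g) :
    ∃ E : Set ℝ, MeasurableSet E ∧ ∫⁻ r in E, ENNReal.ofReal (g r) < ⊤ ∧
      ∀ r, a < r → r ∉ E → ∫⁻ ρ in Ioo a r, D ρ < ⊤ →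
        D r ≤ ENNReal.ofReal (max (g r) 1) * (1 + ∫⁻ ρ in Ioo a r, D ρ) ^ (1 + δ) := by
  set V : ℝ → ℝ≥0∞ := fun r => ∫⁻ ρ in Ioo a r, D ρ with hVdef
  have hV : Monotone V := fun x y h => lintegral_mono_set (Ioo_subset_Ioo_right h)
  have hVm : Measurable V := hV.measurable
  set P : ℝ → ℝ≥0∞ := fun r => (1 + V r) ^ (1 + δ)
  have hPm : Measurable P := (measurable_const.add hVm).pow_const _
  set E : Set ℝ := {r | a < r ∧ V r < ⊤ ∧ ENNReal.ofReal (max (g r) 1) * P r < D r} with hE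
  have hEm : MeasurableSet E := by
    refine measurableSet_Ioi.inter ((measurableSet_lt hVm measurable_const).inter
      (measurableSet_lt ?_ hD))
    exact (ENNReal.measurable_ofReal.comp (hg.max measurable_const)).mul hPm
  refine ⟨E, hEm, ?_, fun r har hr hfin => ?_⟩
  swap
  · by_contra hcon
    exact hr ⟨har, hfin, not_le.1 hcon⟩
  -- Dyadic decomposition of the failure set by the size of `1 + V`. On the `n`-th piece `g` is at
  -- most `2 ^ (-n (1 + δ)) * D`, while `D` has integral at most `2 ^ (n + 1)` there. The
  -- contributions are dominated by a geometric series of ratio `2 ^ (-δ)`.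
  let S : ℕ → Set ℝ := fun n => {r | a < r ∧ V r ≤ 2 ^ (n + 1)} ∩ {r | 2 ^ n ≤ 1 + V r} ∩ E
  have hSm : ∀ n, MeasurableSet (S n) := fun n =>
    ((measurableSet_Ioi.inter (measurableSet_le hVm measurable_const)).inter
      (measurableSet_le measurable_const (measurable_const.add hVm))).inter hEm
  have hcover : E ⊆ ⋃ n, S n := by
    intro r hr
    have hlt : 1 + V r < ⊤ := by simpa using hr.2.1
    obtain ⟨n, hn1, hn2⟩ := exists_nat_pow_near (x := (1 + V r).toReal) (y := 2)
      (by
        rw [← ENNReal.toReal_one]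
        exact ENNReal.toReal_mono hlt.ne (by simp)) (by norm_num)
    refine mem_iUnion.2 ⟨n, ⟨⟨hr.1, ?_⟩, ?_⟩, hr⟩
    · have h1 : 1 + V r ≤ 2 ^ (n + 1) := by
        rw [← ENNReal.ofReal_toReal hlt.ne]
        refine (ENNReal.ofReal_le_ofReal hn2.le).trans ?_
        rw [ENNReal.ofReal_pow (by norm_num)]; simp
      exact le_add_self.trans h1
    · change (2 : ℝ≥0∞) ^ n ≤ 1 + V r
      rw [← ENNReal.ofReal_toReal hlt.ne]
      refine le_trans ?_ (ENNReal.ofReal_le_ofReal hn1)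
      rw [ENNReal.ofReal_pow (by norm_num)]; simp
  have hpiece : ∀ n, ∫⁻ r in S n, ENNReal.ofReal (g r) ≤ 2 * ((2 : ℝ≥0∞) ^ (-δ)) ^ n := by
    intro n
    have hpt : ∀ r ∈ S n, ENNReal.ofReal (g r) ≤ ((2 : ℝ≥0∞) ^ n) ^ (-(1 + δ)) * D r := by
      intro r hr
      have h1 : ENNReal.ofReal (g r) * ((2 : ℝ≥0∞) ^ n) ^ (1 + δ) ≤ D r := by
        refine le_trans ?_ hr.2.2.2.le
        gcongr
        · exact le_max_left _ _
        · exact ENNReal.rpow_le_rpow hr.1.2 (by linarith)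
      have h2 : ((2 : ℝ≥0∞) ^ n) ^ (1 + δ) ≠ 0 := by
        simp [ENNReal.rpow_eq_zero_iff]
      have h3 : ((2 : ℝ≥0∞) ^ n) ^ (1 + δ) ≠ ⊤ := by
        refine ENNReal.rpow_ne_top_of_nonneg (by linarith) (by simp)
      rw [ENNReal.rpow_neg, mul_comm, ← div_eq_mul_inv, ENNReal.le_div_iff_mul_le (Or.inl h2) (Or.inl h3)]
      exact h1
    calc ∫⁻ r in S n, ENNReal.ofReal (g r)
        ≤ ∫⁻ r in S n, ((2 : ℝ≥0∞) ^ n) ^ (-(1 + δ)) * D r := setLIntegral_mono' (hSm n) hpt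
      _ = ((2 : ℝ≥0∞) ^ n) ^ (-(1 + δ)) * ∫⁻ r in S n, D r := lintegral_const_mul _ hD
      _ ≤ ((2 : ℝ≥0∞) ^ n) ^ (-(1 + δ)) * 2 ^ (n + 1) := by
          gcongr
          refine (lintegral_mono_set ?_).trans (setLIntegral_primitive_le a (2 ^ (n + 1)))
          exact fun r hr => hr.1.1
      _ = 2 * ((2 : ℝ≥0∞) ^ (-δ)) ^ n := by
          have e1 : ((2 : ℝ≥0∞) ^ n) ^ (-(1 + δ)) = (2 : ℝ≥0∞) ^ (-(1 + δ) * n) := by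
            rw [← ENNReal.rpow_natCast, ← ENNReal.rpow_mul, mul_comm]
          have e2 : ((2 : ℝ≥0∞) ^ (-δ)) ^ n = (2 : ℝ≥0∞) ^ (-δ * n) := by
            rw [← ENNReal.rpow_natCast, ← ENNReal.rpow_mul]
          rw [e1, e2, pow_succ, ← ENNReal.rpow_natCast 2 n, ← mul_assoc,
            ← ENNReal.rpow_add _ _ (by norm_num) (by norm_num), mul_comm]
          congr 2; ring
  calc ∫⁻ r in E, ENNReal.ofReal (g r) ≤ ∫⁻ r in ⋃ n, S n, ENNReal.ofReal (g r) :=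
        lintegral_mono_set hcover
    _ ≤ ∑' n, ∫⁻ r in S n, ENNReal.ofReal (g r) := lintegral_iUnion_le _ _
    _ ≤ ∑' n, 2 * ((2 : ℝ≥0∞) ^ (-δ)) ^ n := ENNReal.tsum_le_tsum hpiece
    _ = 2 * (1 - (2 : ℝ≥0∞) ^ (-δ))⁻¹ := by rw [ENNReal.tsum_mul_left, ENNReal.tsum_geometric]
    _ < ⊤ := by
        refine ENNReal.mul_lt_top (by norm_num) (ENNReal.inv_lt_top.2 (tsub_pos_of_lt ?_))
        exact ENNReal.rpow_lt_one_of_one_lt_of_neg (by norm_num) (by linarith)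

end HoloNevanlinna

namespace HoloNevanlinna

open Real (circleAverage)

/-! ### Pairs of holomorphic functions without common zeros -/

/-- Two holomorphic functions without common zeros on the disc of radius `s`. -/
structure IsHoloPair (s : ℝ) (p q : ℂ → ℂ) : Prop where
  left : DifferentiableOn ℂ p (Metric.ball 0 s)
  right : DifferentiableOn ℂ q (Metric.ball 0 s)
  ne_zero : ∀ z ∈ Metric.ball (0 : ℂ) s, p z ≠ 0 ∨ q z ≠ 0

/-- The squared norm of the pair `(p, q)`. -/
def normSum (p q : ℂ → ℂ) (z : ℂ) : ℝ := ‖p z‖ ^ 2 + ‖q z‖ ^ 2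

/-- The Wronskian. -/
def wronskian (p q : ℂ → ℂ) (z : ℂ) : ℂ := deriv p z * q z - p z * deriv q z

/-- The squared spherical derivative. -/
def sphDensity (p q : ℂ → ℂ) (z : ℂ) : ℝ := ‖wronskian p q z‖ ^ 2 / normSum p q z ^ 2

/-- The squared chordal distance to the zero set of `p`. -/
def chordSq (p q : ℂ → ℂ) (z : ℂ) : ℝ := ‖p z‖ ^ 2 / normSum p q z

theorem norm_sq_ofReal (z : ℂ) : ((‖z‖ ^ 2 : ℝ) : ℂ) = z * (starRingEnd ℂ) z := by
  rw [Complex.mul_conj']; push_cast; rfl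

theorem sphDensity_nonneg (p q : ℂ → ℂ) (z : ℂ) : 0 ≤ sphDensity p q z := by
  unfold sphDensity; positivity

theorem chordSq_nonneg (p q : ℂ → ℂ) (z : ℂ) : 0 ≤ chordSq p q z := by
  unfold chordSq normSum; positivity

theorem chordSq_le_one (p q : ℂ → ℂ) (z : ℂ) : chordSq p q z ≤ 1 := by
  unfold chordSq normSum
  exact div_le_one_of_le₀ (by nlinarith [sq_nonneg ‖q z‖]) (by positivity)

namespace IsHoloPair

variable {s : ℝ} {p q : ℂ → ℂ} {z : ℂ}

theorem normSum_pos (h : IsHoloPair s p q) (hz : z ∈ Metric.ball (0 : ℂ) s) : 0 < normSum p q z := by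
  unfold normSum
  rcases h.ne_zero z hz with h | h
  · have := norm_pos_iff.2 h; positivity
  · have := norm_pos_iff.2 h; positivity

theorem hasDerivAt_left (h : IsHoloPair s p q) (hz : z ∈ Metric.ball (0 : ℂ) s) :
    HasDerivAt p (deriv p z) z :=
  (h.left.differentiableAt (Metric.isOpen_ball.mem_nhds hz)).hasDerivAt

theorem hasDerivAt_right (h : IsHoloPair s p q) (hz : z ∈ Metric.ball (0 : ℂ) s) :
    HasDerivAt q (deriv q z) z :=
  (h.right.differentiableAt (Metric.isOpen_ball.mem_nhds hz)).hasDerivAt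

theorem differentiableOn_wronskian (h : IsHoloPair s p q) :
    DifferentiableOn ℂ (wronskian p q) (Metric.ball 0 s) :=
  ((h.left.deriv Metric.isOpen_ball).mul h.right).sub (h.left.mul (h.right.deriv Metric.isOpen_ball))

theorem hasWirtingerAt_normSum (h : IsHoloPair s p q) (hz : z ∈ Metric.ball (0 : ℂ) s) :
    HasWirtingerAt (fun w => (normSum p q w : ℂ))
      (deriv p z * (starRingEnd ℂ) (p z) + deriv q z * (starRingEnd ℂ) (q z))
      (p z * (starRingEnd ℂ) (deriv p z) + q z * (starRingEnd ℂ) (deriv q z)) z := by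
  have hp := HasWirtingerAt.of_hasDerivAt (h.hasDerivAt_left hz)
  have hq := HasWirtingerAt.of_hasDerivAt (h.hasDerivAt_right hz)
  have := (hp.mul hp.conj).add (hq.mul hq.conj)
  simp only [normSum, Complex.ofReal_add, norm_sq_ofReal]
  exact this.congr (by simp) (by simp)

theorem continuousOn_normSum (h : IsHoloPair s p q) : ContinuousOn (normSum p q) (Metric.ball 0 s) :=
  (h.left.continuousOn.norm.pow 2).add (h.right.continuousOn.norm.pow 2)

theorem continuousOn_sphDensity (h : IsHoloPair s p q) :
    ContinuousOn (sphDensity p q) (Metric.ball 0 s) :=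
  (h.differentiableOn_wronskian.continuousOn.norm.pow 2).div (h.continuousOn_normSum.pow 2)
    fun _ hz => (pow_pos (h.normSum_pos hz) 2).ne'

theorem continuousOn_chordSq (h : IsHoloPair s p q) :
    ContinuousOn (chordSq p q) (Metric.ball 0 s) :=
  (h.left.continuousOn.norm.pow 2).div h.continuousOn_normSum fun _ hz => (h.normSum_pos hz).ne'

theorem continuousOn_ofReal_normSum (h : IsHoloPair s p q) :
    ContinuousOn (fun z => (normSum p q z : ℂ)) (Metric.ball 0 s) :=
  Complex.continuous_ofReal.comp_continuousOn h.continuousOn_normSum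

theorem hasWirtingerAt_log_normSum (h : IsHoloPair s p q) (hz : z ∈ Metric.ball (0 : ℂ) s) :
    HasWirtingerAt (fun w => ((Real.log (normSum p q w) / 2 : ℝ) : ℂ))
      ((deriv p z * (starRingEnd ℂ) (p z) + deriv q z * (starRingEnd ℂ) (q z)) /
        (2 * normSum p q z))
      ((starRingEnd ℂ) ((deriv p z * (starRingEnd ℂ) (p z) + deriv q z * (starRingEnd ℂ) (q z)) /
        (2 * normSum p q z))) z := by
  have hN := (h.normSum_pos hz).ne'
  refine ((h.hasWirtingerAt_normSum hz).ofReal_comp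
    ((Real.hasDerivAt_log hN).div_const 2)).congr ?_ ?_
  · push_cast; field_simp
  · simp only [map_div₀, map_mul, map_add, Complex.conj_ofReal, Complex.conj_conj, map_ofNat]
    push_cast; field_simp

/-- Green's formula for `log ‖(p, q)‖`. -/
theorem circleAverage_log_normSum_sub (h : IsHoloPair s p q) {r₁ r : ℝ} (hr₁ : 0 < r₁)
    (hr : r₁ ≤ r) (hs : r < s) :
    circleAverage (fun z => Real.log (normSum p q z) / 2) 0 r -
      circleAverage (fun z => Real.log (normSum p q z) / 2) 0 r₁ =
      ∫ t in r₁..r, (∫ ρ in (0 : ℝ)..t, ρ * circleAverage (fun z => 2 * sphDensity p q z) 0 ρ) / t := by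
  set D : ℂ → ℂ := fun z => (deriv p z * (starRingEnd ℂ) (p z) + deriv q z * (starRingEnd ℂ) (q z)) /
        (2 * normSum p q z) with hD
  set E : ℂ → ℂ := fun z => deriv p z * (starRingEnd ℂ) (p z) + deriv q z * (starRingEnd ℂ) (q z)
  set A : ℂ → ℂ := fun z => ((deriv (deriv p) z * (starRingEnd ℂ) (p z) +
    deriv (deriv q) z * (starRingEnd ℂ) (q z)) * (2 * normSum p q z) - E z * (2 * E z)) /
    (2 * normSum p q z) ^ 2
  -- This is `∂∂̄` of `(log N)/2`. It equals `|W|² / (2 N²)` by Lagrange's identity `(|p|² +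
  -- |q|²)(|p'|² + |q'|²) - |p' p̄ + q' q̄|² = |W|²`.
  set B : ℂ → ℂ := fun z => ((sphDensity p q z / 2 : ℝ) : ℂ)
  have hp' := h.left.deriv Metric.isOpen_ball
  have hq' := h.right.deriv Metric.isOpen_ball
  have hp'' := hp'.deriv Metric.isOpen_ball
  have hq'' := hq'.deriv Metric.isOpen_ball
  have hN0 : ∀ z ∈ Metric.ball (0 : ℂ) s, (2 * normSum p q z : ℂ) ≠ 0 := fun z hz =>
    mul_ne_zero two_ne_zero (by exact_mod_cast (h.normSum_pos hz).ne')
  have hDW : ∀ z ∈ Metric.ball (0 : ℂ) s, HasWirtingerAt D (A z) (B z) z := by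
    intro z hz
    have hp := HasWirtingerAt.of_hasDerivAt (h.hasDerivAt_left hz)
    have hq := HasWirtingerAt.of_hasDerivAt (h.hasDerivAt_right hz)
    have hdp := HasWirtingerAt.of_hasDerivAt
      (hp'.differentiableAt (Metric.isOpen_ball.mem_nhds hz)).hasDerivAt
    have hdq := HasWirtingerAt.of_hasDerivAt
      (hq'.differentiableAt (Metric.isOpen_ball.mem_nhds hz)).hasDerivAt
    have hN := (HasWirtingerAt.const (z := z) 2).mul (h.hasWirtingerAt_normSum hz)
    refine (((hdp.mul hp.conj).add (hdq.mul hq.conj)).div hN (hN0 z hz)).congr ?_ ?_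
    · simp [A, E]
    · have hNc : (normSum p q z : ℂ) = p z * (starRingEnd ℂ) (p z) + q z * (starRingEnd ℂ) (q z) := by
        simp only [normSum, Complex.ofReal_add, norm_sq_ofReal]
      have hWc : ((‖wronskian p q z‖ ^ 2 : ℝ) : ℂ) = _ := norm_sq_ofReal _
      have hN1 : (normSum p q z : ℂ) ≠ 0 := by exact_mod_cast (h.normSum_pos hz).ne'
      simp only [B, sphDensity]
      rw [Complex.ofReal_div, Complex.ofReal_div, hWc, Complex.ofReal_pow]
      rw [wronskian, div_div, div_eq_div_iff (pow_ne_zero _ (hN0 z hz))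
        (mul_ne_zero (pow_ne_zero _ hN1) (by norm_num)), hNc]
      simp only [map_sub, map_mul, Complex.ofReal_ofNat]
      ring
  have hconj : ∀ {f : ℂ → ℂ}, DifferentiableOn ℂ f (Metric.ball 0 s) →
      ContinuousOn (fun z => (starRingEnd ℂ) (f z)) (Metric.ball 0 s) := fun hf =>
    Complex.continuous_conj.comp_continuousOn hf.continuousOn
  have hcE : ContinuousOn E (Metric.ball 0 s) :=
    (hp'.continuousOn.mul (hconj h.left)).add (hq'.continuousOn.mul (hconj h.right))
  have hc2 : ContinuousOn (fun z => (2 * normSum p q z : ℂ)) (Metric.ball 0 s) :=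
    continuousOn_const.mul h.continuousOn_ofReal_normSum
  have hcA : ContinuousOn A (Metric.ball 0 s) := by
    refine ContinuousOn.div ?_ (hc2.pow 2) fun z hz => pow_ne_zero _ (hN0 z hz)
    exact (((hp''.continuousOn.mul (hconj h.left)).add (hq''.continuousOn.mul (hconj h.right))).mul
      hc2).sub (hcE.mul (continuousOn_const.mul hcE))
  have hcB : ContinuousOn B (Metric.ball 0 s) :=
    Complex.continuous_ofReal.comp_continuousOn (h.continuousOn_sphDensity.div_const 2)
  have hcD : ContinuousOn D (Metric.ball 0 s) := hcE.div hc2 hN0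
  rw [green_radial hcD (fun z hz => h.hasWirtingerAt_log_normSum hz) hr₁ hr hs]
  refine intervalIntegral.integral_congr fun t ht => ?_
  rw [uIcc_of_le hr] at ht
  rw [green_area hDW hcA hcB (hr₁.le.trans ht.1) (ht.2.trans_lt hs)]
  simp only [B, Complex.ofReal_re]
  congr 4
  ext ρ
  congr 2
  ext z
  ring

theorem chordSq_ofReal (p q : ℂ → ℂ) (z : ℂ) :
    (chordSq p q z : ℂ) = p z * (starRingEnd ℂ) (p z) / (normSum p q z : ℂ) := by
  rw [chordSq, Complex.ofReal_div, norm_sq_ofReal]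

theorem hasWirtingerAt_chordSq (h : IsHoloPair s p q) (hz : z ∈ Metric.ball (0 : ℂ) s) :
    HasWirtingerAt (fun w => (chordSq p q w : ℂ))
      ((starRingEnd ℂ) (p z) * (starRingEnd ℂ) (q z) * wronskian p q z / (normSum p q z : ℂ) ^ 2)
      ((starRingEnd ℂ) ((starRingEnd ℂ) (p z) * (starRingEnd ℂ) (q z) * wronskian p q z /
        (normSum p q z : ℂ) ^ 2)) z := by
  have hN1 : (normSum p q z : ℂ) ≠ 0 := by exact_mod_cast (h.normSum_pos hz).ne'
  have hNc : (normSum p q z : ℂ) = p z * (starRingEnd ℂ) (p z) + q z * (starRingEnd ℂ) (q z) := by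
    simp only [normSum, Complex.ofReal_add, norm_sq_ofReal]
  have hp := HasWirtingerAt.of_hasDerivAt (h.hasDerivAt_left hz)
  simp only [chordSq_ofReal]
  refine ((hp.mul hp.conj).div (h.hasWirtingerAt_normSum hz) hN1).congr ?_ ?_
  · congr 1
    rw [hNc, wronskian]; simp only [map_zero]; ring
  · simp only [map_div₀, map_mul, map_pow, Complex.conj_conj, Complex.conj_ofReal]
    congr 1
    rw [hNc, wronskian]; simp only [map_sub, map_mul]; ring

/-- Green's formula for functions of the chordal distance. -/
theorem circleAverage_comp_chordSq_sub (h : IsHoloPair s p q) {φ φ' φ'' : ℝ → ℝ}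
    (hφ : ∀ x ∈ Icc (0 : ℝ) 1, HasDerivAt φ (φ' x) x)
    (hφ' : ∀ x ∈ Icc (0 : ℝ) 1, HasDerivAt φ' (φ'' x) x)
    (hφ'' : ContinuousOn φ'' (Icc (0 : ℝ) 1)) {r₁ r : ℝ} (hr₁ : 0 < r₁)
    (hr : r₁ ≤ r) (hs : r < s) :
    circleAverage (fun z => φ (chordSq p q z)) 0 r -
      circleAverage (fun z => φ (chordSq p q z)) 0 r₁ =
      ∫ t in r₁..r, (∫ ρ in (0 : ℝ)..t, ρ * circleAverage (fun z => 4 * (sphDensity p q z *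
        (φ'' (chordSq p q z) * (chordSq p q z * (1 - chordSq p q z)) +
          φ' (chordSq p q z) * (1 - 2 * chordSq p q z)))) 0 ρ) / t := by
  have hmem : ∀ z, chordSq p q z ∈ Icc (0 : ℝ) 1 := fun z => ⟨chordSq_nonneg p q z, chordSq_le_one p q z⟩
  set V : ℂ → ℂ := fun z => (starRingEnd ℂ) (p z) * (starRingEnd ℂ) (q z) * wronskian p q z /
    (normSum p q z : ℂ) ^ 2 with hV
  set E : ℂ → ℂ := fun z => deriv p z * (starRingEnd ℂ) (p z) + deriv q z * (starRingEnd ℂ) (q z)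
  set AV : ℂ → ℂ := fun z => (starRingEnd ℂ) (p z) * (starRingEnd ℂ) (q z) *
    (deriv (wronskian p q) z * normSum p q z - 2 * wronskian p q z * E z) / (normSum p q z : ℂ) ^ 3
  set D : ℂ → ℂ := fun z => (φ' (chordSq p q z) : ℂ) * V z
  set A : ℂ → ℂ := fun z => φ'' (chordSq p q z) * V z * V z + φ' (chordSq p q z) * AV z
  -- Chain rule for `∂∂̄ φ(v)`: the squared chordal distance `v` satisfies `|∂v|² = σ v (1 - v)` and
  -- `∂∂̄v = σ (1 - 2v)`.
  set B : ℂ → ℂ := fun z => ((sphDensity p q z *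
        (φ'' (chordSq p q z) * (chordSq p q z * (1 - chordSq p q z)) +
          φ' (chordSq p q z) * (1 - 2 * chordSq p q z)) : ℝ) : ℂ)
  have hp' := h.left.deriv Metric.isOpen_ball
  have hq' := h.right.deriv Metric.isOpen_ball
  have hW := h.differentiableOn_wronskian
  have hW' := hW.deriv Metric.isOpen_ball
  have hN1 : ∀ z ∈ Metric.ball (0 : ℂ) s, (normSum p q z : ℂ) ≠ 0 := fun z hz => by
    exact_mod_cast (h.normSum_pos hz).ne'
  have hDW : ∀ z ∈ Metric.ball (0 : ℂ) s, HasWirtingerAt D (A z) (B z) z := by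
    intro z hz
    have hp := HasWirtingerAt.of_hasDerivAt (h.hasDerivAt_left hz)
    have hq := HasWirtingerAt.of_hasDerivAt (h.hasDerivAt_right hz)
    have hw := HasWirtingerAt.of_hasDerivAt
      (hW.differentiableAt (Metric.isOpen_ball.mem_nhds hz)).hasDerivAt
    have hN := h.hasWirtingerAt_normSum hz
    have hNN := hN.mul hN
    have hV1 := ((hp.conj.mul hq.conj).mul hw).div hNN (mul_ne_zero (hN1 z hz) (hN1 z hz))
    have hvW := h.hasWirtingerAt_chordSq hz
    have hφW := hvW.ofReal_comp (hφ' _ (hmem z))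
    have hDD := hφW.mul hV1
    have hfun : D = fun w => (φ' (chordSq p q w) : ℂ) * ((starRingEnd ℂ) (p w) * (starRingEnd ℂ) (q w) *
        wronskian p q w / ((normSum p q w : ℂ) * (normSum p q w : ℂ))) := by
      ext w; simp only [D, V, sq]
    rw [hfun]
    have hNc : (normSum p q z : ℂ) = p z * (starRingEnd ℂ) (p z) + q z * (starRingEnd ℂ) (q z) := by
      simp only [normSum, Complex.ofReal_add, norm_sq_ofReal]
    have hWc : ((‖wronskian p q z‖ ^ 2 : ℝ) : ℂ) = _ := norm_sq_ofReal _
    have hN2 := hN1 z hz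
    refine hDD.congr ?_ ?_
    · simp only [A, V, AV, E, map_zero]
      field_simp
      ring
    · have e1 : (sphDensity p q z : ℂ) = wronskian p q z * (starRingEnd ℂ) (wronskian p q z) /
          (normSum p q z : ℂ) ^ 2 := by
        rw [sphDensity, Complex.ofReal_div, hWc, Complex.ofReal_pow]
      have e2 : (1 - chordSq p q z : ℂ) = q z * (starRingEnd ℂ) (q z) / (normSum p q z : ℂ) := by
        rw [chordSq_ofReal, eq_div_iff hN2, sub_mul, div_mul_cancel₀ _ hN2, hNc]; ring
      have e3 : (1 - 2 * chordSq p q z : ℂ) = (q z * (starRingEnd ℂ) (q z) -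
          p z * (starRingEnd ℂ) (p z)) / (normSum p q z : ℂ) := by
        rw [chordSq_ofReal, eq_div_iff hN2, sub_mul, mul_assoc, div_mul_cancel₀ _ hN2, hNc]; ring
      have e4 : wronskian p q z = deriv p z * q z - p z * deriv q z := rfl
      simp only [B]
      push_cast
      rw [e1, e2, e3, chordSq_ofReal]
      simp only [map_div₀, map_mul, map_pow, Complex.conj_conj, Complex.conj_ofReal]
      have e5 : (starRingEnd ℂ) (wronskian p q z) = (starRingEnd ℂ) (deriv p z) * (starRingEnd ℂ) (q z)
        - (starRingEnd ℂ) (p z) * (starRingEnd ℂ) (deriv q z) := by rw [e4]; simp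
      have e6 : ((starRingEnd ℂ) (deriv p z) * (starRingEnd ℂ) (q z) +
          (starRingEnd ℂ) (p z) * (starRingEnd ℂ) (deriv q z)) * (normSum p q z : ℂ) -
          2 * ((starRingEnd ℂ) (p z) * (starRingEnd ℂ) (q z)) * (p z * (starRingEnd ℂ) (deriv p z) +
            q z * (starRingEnd ℂ) (deriv q z)) = (q z * (starRingEnd ℂ) (q z) -
          p z * (starRingEnd ℂ) (p z)) * (starRingEnd ℂ) (wronskian p q z) := by
        rw [hNc, e5]; ring
      field_simp
      linear_combination (wronskian p q z * (φ' (chordSq p q z) : ℂ) * (normSum p q z : ℂ)) * e6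
  have hconj : ∀ {f : ℂ → ℂ}, ContinuousOn f (Metric.ball 0 s) →
      ContinuousOn (fun z => (starRingEnd ℂ) (f z)) (Metric.ball 0 s) := fun hf =>
    Complex.continuous_conj.comp_continuousOn hf
  have hcv := h.continuousOn_chordSq
  have hcE : ContinuousOn E (Metric.ball 0 s) :=
    (hp'.continuousOn.mul (hconj h.left.continuousOn)).add
      (hq'.continuousOn.mul (hconj h.right.continuousOn))
  have hcN := h.continuousOn_ofReal_normSum
  have hcV : ContinuousOn V (Metric.ball 0 s) :=
    (((hconj h.left.continuousOn).mul (hconj h.right.continuousOn)).mul hW.continuousOn).div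
      (hcN.pow 2) fun z hz => pow_ne_zero _ (hN1 z hz)
  have hcAV : ContinuousOn AV (Metric.ball 0 s) :=
    (((hconj h.left.continuousOn).mul (hconj h.right.continuousOn)).mul
      ((hW'.continuousOn.mul hcN).sub ((continuousOn_const.mul hW.continuousOn).mul hcE))).div
      (hcN.pow 3) fun z hz => pow_ne_zero _ (hN1 z hz)
  have hcφ' : ContinuousOn (fun z => φ' (chordSq p q z)) (Metric.ball 0 s) :=
    ContinuousOn.comp (t := Icc (0 : ℝ) 1) (fun x hx => (hφ' x hx).continuousAt.continuousWithinAt)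
      hcv fun z _ => hmem z
  have hcφ'' : ContinuousOn (fun z => φ'' (chordSq p q z)) (Metric.ball 0 s) :=
    hφ''.comp hcv fun z _ => hmem z
  have hofReal : ∀ {f : ℂ → ℝ}, ContinuousOn f (Metric.ball 0 s) →
      ContinuousOn (fun z => (f z : ℂ)) (Metric.ball 0 s) := fun hf =>
    Complex.continuous_ofReal.comp_continuousOn hf
  have hcA : ContinuousOn A (Metric.ball 0 s) :=
    (((hofReal hcφ'').mul hcV).mul hcV).add ((hofReal hcφ').mul hcAV)
  have hcB : ContinuousOn B (Metric.ball 0 s) :=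
    hofReal (h.continuousOn_sphDensity.mul ((hcφ''.mul (hcv.mul (continuousOn_const.sub hcv))).add
      (hcφ'.mul (continuousOn_const.sub (continuousOn_const.mul hcv)))))
  have hcD : ContinuousOn D (Metric.ball 0 s) := (hofReal hcφ').mul hcV
  rw [green_radial hcD (fun z hz => ((h.hasWirtingerAt_chordSq hz).ofReal_comp
    (hφ _ (hmem z))).congr rfl (by simp only [D, V, map_mul, Complex.conj_ofReal])) hr₁ hr hs]
  refine intervalIntegral.integral_congr fun t ht => ?_
  rw [uIcc_of_le hr] at ht
  rw [green_area hDW hcA hcB (hr₁.le.trans ht.1) (ht.2.trans_lt hs)]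
  simp only [B, Complex.ofReal_re]

/-- The area integral of the spherical density, over a disc of radius `t`. -/
theorem lintegral_sphDensity (h : IsHoloPair s p q) {t : ℝ} (ht : 0 ≤ t) (hts : t < s) :
    (∫⁻ z in Metric.ball 0 t, ENNReal.ofReal (sphDensity p q z / Real.pi)).toReal =
      ∫ ρ in (0 : ℝ)..t, ρ * circleAverage (fun z => 2 * sphDensity p q z) 0 ρ := by
  rw [lintegral_ball_eq_integral_circleAverage ht hts (h.continuousOn_sphDensity.div_const _)
    (fun z _ => div_nonneg (sphDensity_nonneg p q z) Real.pi_pos.le)]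
  have e : 2 * Real.pi * ∫ ρ in (0 : ℝ)..t, ρ * circleAverage (fun z => sphDensity p q z / Real.pi) 0 ρ
      = ∫ ρ in (0 : ℝ)..t, ρ * circleAverage (fun z => 2 * sphDensity p q z) 0 ρ := by
    rw [← intervalIntegral.integral_const_mul]
    refine intervalIntegral.integral_congr fun ρ _ => ?_
    have e1 : (fun z => sphDensity p q z / Real.pi) = fun z => Real.pi⁻¹ • sphDensity p q z := by
      ext z; rw [smul_eq_mul, div_eq_inv_mul]
    have e2 : (fun z => 2 * sphDensity p q z) = fun z => (2 : ℝ) • sphDensity p q z := rfl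
    rw [e1, e2, Real.circleAverage_fun_smul, Real.circleAverage_fun_smul]
    have := Real.pi_pos.ne'
    simp only [smul_eq_mul]
    field_simp
  rw [e, ENNReal.toReal_ofReal]
  refine intervalIntegral.integral_nonneg ht fun ρ hρ => mul_nonneg hρ.1 ?_
  exact Real.circleAverage_nonneg_of_nonneg fun z _ =>
    mul_nonneg zero_le_two (sphDensity_nonneg p q z)

end IsHoloPair

/-! ### A potential of the singular metric -/

/-- The weight `1 / (x (2 - log x)²)`. -/
def logWeight (x : ℝ) : ℝ := 1 / ((2 - Real.log x) ^ 2 * x)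

theorem log_lt_one_of_le_two {x : ℝ} (h0 : 0 < x) (h2 : x ≤ 2) : Real.log x < 1 := by
  have := Real.log_le_log h0 h2
  have := Real.log_two_lt_d9
  linarith

theorem logWeight_nonneg {x : ℝ} (h0 : 0 ≤ x) : 0 ≤ logWeight x := by
  unfold logWeight; positivity

/-- The function `-log(2 - log x)` is chosen because applying `x d/dx` once gives `1 / (2 - log x)`
and twice gives `1 / (2 - log x)²`, which is `x` times the weight. The shift by `η` keeps it smooth
at the zeros of the chordal distance, and the constant `2` keeps the inner logarithm below it for `x
+ η ≤ 2`. -/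
theorem hasDerivAt_loglog {x η : ℝ} (h0 : 0 < x + η) (h2 : x + η ≤ 2) :
    HasDerivAt (fun x => -Real.log (2 - Real.log (x + η))) (((2 - Real.log (x + η)) * (x + η))⁻¹) x := by
  have hL := log_lt_one_of_le_two h0 h2
  have h1 : HasDerivAt (fun x => x + η) 1 x := (hasDerivAt_id x).add_const η
  have h2 := (h1.log h0.ne').const_sub 2
  refine (h2.log (by linarith)).neg.congr_deriv ?_
  have : 2 - Real.log (x + η) ≠ 0 := by linarith
  field_simp

theorem hasDerivAt_loglog' {x η : ℝ} (h0 : 0 < x + η) (h2 : x + η ≤ 2) :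
    HasDerivAt (fun x => ((2 - Real.log (x + η)) * (x + η))⁻¹)
      ((Real.log (x + η) - 1) / ((2 - Real.log (x + η)) * (x + η)) ^ 2) x := by
  have hL := log_lt_one_of_le_two h0 h2
  have h1 : HasDerivAt (fun x => x + η) 1 x := (hasDerivAt_id x).add_const η
  have h3 := (h1.log h0.ne').const_sub 2
  have : 2 - Real.log (x + η) ≠ 0 := by linarith
  refine ((h3.mul h1).inv (mul_ne_zero this h0.ne')).congr_deriv ?_
  simp only [Pi.mul_apply]
  field_simp
  ring

/-- The right side is the factor of `σ` in `∂∂̄` of the shifted potential. Its leading part is the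
weight; the remaining terms are bounded below uniformly in `η`. -/
theorem logWeight_le {v η : ℝ} (hv : v ∈ Icc (0 : ℝ) 1) (hη : 0 < η) (hη1 : η ≤ 1) :
    logWeight (v + η) - 3 ≤ (Real.log (v + η) - 1) / ((2 - Real.log (v + η)) * (v + η)) ^ 2 *
      (v * (1 - v)) + ((2 - Real.log (v + η)) * (v + η))⁻¹ * (1 - 2 * v) := by
  obtain ⟨h0, h1⟩ := hv
  have hy : 0 < v + η := by linarith
  have hL := log_lt_one_of_le_two hy (by linarith)
  unfold logWeight
  set L := 2 - Real.log (v + η) with hLdef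
  have hL1 : 1 < L := by linarith
  have hlog : Real.log (v + η) - 1 = 1 - L := by rw [hLdef]; ring
  rw [hlog]
  have hLy : 0 < L ^ 2 * (v + η) ^ 2 := by positivity
  have e1 : 1 / (L ^ 2 * (v + η)) - 3 = ((v + η) - 3 * (L ^ 2 * (v + η) ^ 2)) / (L ^ 2 * (v + η) ^ 2) := by
    field_simp
  have e2 : (1 - L) / (L * (v + η)) ^ 2 * (v * (1 - v)) + (L * (v + η))⁻¹ * (1 - 2 * v) =
      ((1 - L) * (v * (1 - v)) + L * (v + η) * (1 - 2 * v)) / (L ^ 2 * (v + η) ^ 2) := by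
    field_simp
  rw [e1, e2]
  gcongr
  -- After clearing denominators the two negative terms are `2 L v (v + η)` and `v²`. Each product
  -- is at most `L² (v + η)²`, which accounts for the constant `3 = 2 + 1`.
  have a1 : L * (v * (v + η)) ≤ L ^ 2 * (v + η) ^ 2 := by
    have : L ≤ L ^ 2 := by nlinarith
    have : v * (v + η) ≤ (v + η) ^ 2 := by nlinarith
    gcongr
  have a2 : v ^ 2 ≤ L ^ 2 * (v + η) ^ 2 := by
    have : v ^ 2 ≤ (v + η) ^ 2 := by gcongr; linarith
    have hL2 : 1 ≤ L ^ 2 := by nlinarith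
    exact this.trans (le_mul_of_one_le_left (sq_nonneg _) hL2)
  nlinarith [mul_nonneg (sub_nonneg.2 hL1.le) hη.le, mul_nonneg (by linarith : 0 ≤ L) (sq_nonneg v)]

end HoloNevanlinna

/-! ### Area integrals in polar form and the area bound for the singular weight -/

namespace HoloNevanlinna

open Real (circleAverage)

/-- `1 / 2π` times the area integral over the disc of radius `t`, in polar coordinates. -/
def discIntegral (f : ℂ → ℝ) (t : ℝ) : ℝ := ∫ ρ in (0 : ℝ)..t, ρ * circleAverage f 0 ρ

section discIntegral

variable {f g : ℂ → ℝ} {s t ρ : ℝ}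

theorem continuous_comp_circleMap (hf : ContinuousOn f (Metric.ball 0 s)) (h0 : 0 ≤ ρ) (hs : ρ < s) :
    Continuous fun θ => f (circleMap 0 ρ θ) :=
  hf.comp_continuous (continuous_circleMap 0 ρ) fun θ => by simpa [abs_of_nonneg h0] using hs

theorem circleIntegrable_of_continuousOn_ball (hf : ContinuousOn f (Metric.ball 0 s)) (h0 : 0 ≤ ρ)
    (hs : ρ < s) : CircleIntegrable f 0 ρ :=
  (continuous_comp_circleMap hf h0 hs).intervalIntegrable _ _

theorem continuousOn_mul_circleAverage (hf : ContinuousOn f (Metric.ball 0 s)) :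
    ContinuousOn (fun ρ => ρ * circleAverage f 0 ρ) (Ico 0 s) :=
  continuousOn_id.mul (Real.ContinuousOn.circleAverage (hf.mono fun z hz => by
    simpa using hz.2) fun ρ hρ => hρ.1)

theorem intervalIntegrable_mul_circleAverage (hf : ContinuousOn f (Metric.ball 0 s)) (h0 : 0 ≤ t)
    (hs : t < s) : IntervalIntegrable (fun ρ => ρ * circleAverage f 0 ρ) volume 0 t := by
  apply ContinuousOn.intervalIntegrable
  rw [uIcc_of_le h0]
  exact (continuousOn_mul_circleAverage hf).mono fun ρ hρ => ⟨hρ.1, hρ.2.trans_lt hs⟩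

theorem continuousOn_discIntegral (hf : ContinuousOn f (Metric.ball 0 s)) (hs : t < s) :
    ContinuousOn (discIntegral f) (Icc 0 t) := by
  rcases lt_or_ge t 0 with h | h
  · simp [Icc_eq_empty (not_le.2 h)]
  have := intervalIntegral.continuousOn_primitive_interval' (intervalIntegrable_mul_circleAverage hf
    h hs) (left_mem_uIcc)
  rwa [uIcc_of_le h] at this

theorem discIntegral_mono (hf : ContinuousOn f (Metric.ball 0 s)) (hg : ContinuousOn g (Metric.ball 0 s))
    (hfg : ∀ z ∈ Metric.ball (0 : ℂ) s, f z ≤ g z) (h0 : 0 ≤ t) (hs : t < s) :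
    discIntegral f t ≤ discIntegral g t := by
  refine intervalIntegral.integral_mono_on h0 (intervalIntegrable_mul_circleAverage hf h0 hs)
    (intervalIntegrable_mul_circleAverage hg h0 hs) fun ρ hρ => ?_
  have hρs := hρ.2.trans_lt hs
  refine mul_le_mul_of_nonneg_left ?_ hρ.1
  refine Real.circleAverage_mono (circleIntegrable_of_continuousOn_ball hf hρ.1 hρs)
    (circleIntegrable_of_continuousOn_ball hg hρ.1 hρs) fun z hz => hfg z ?_
  rw [mem_sphere_zero_iff_norm, abs_of_nonneg hρ.1] at hz
  rwa [mem_ball_zero_iff, hz]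

theorem discIntegral_linear (hf : ContinuousOn f (Metric.ball 0 s))
    (hg : ContinuousOn g (Metric.ball 0 s)) (a b : ℝ) (h0 : 0 ≤ t) (hs : t < s) :
    discIntegral (fun z => a * f z + b * g z) t = a * discIntegral f t + b * discIntegral g t := by
  unfold discIntegral
  rw [← intervalIntegral.integral_const_mul, ← intervalIntegral.integral_const_mul,
    ← intervalIntegral.integral_add ((intervalIntegrable_mul_circleAverage hf h0 hs).const_mul a)
      ((intervalIntegrable_mul_circleAverage hg h0 hs).const_mul b)]
  refine intervalIntegral.integral_congr fun ρ hρ => ?_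
  rw [uIcc_of_le h0] at hρ
  have hρs := hρ.2.trans_lt hs
  have e : circleAverage (fun z => a * f z + b * g z) 0 ρ =
      circleAverage (fun z => a * f z) 0 ρ + circleAverage (fun z => b * g z) 0 ρ :=
    Real.circleAverage_fun_add
      (circleIntegrable_of_continuousOn_ball (continuousOn_const.mul hf) hρ.1 hρs)
      (circleIntegrable_of_continuousOn_ball (continuousOn_const.mul hg) hρ.1 hρs)
  have e1 := Real.circleAverage_fun_smul (f := f) (a := a) (c := 0) (R := ρ)
  have e2 := Real.circleAverage_fun_smul (f := g) (a := b) (c := 0) (R := ρ)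
  simp only [smul_eq_mul] at e1 e2
  simp only [e, e1, e2]
  ring

theorem discIntegral_nonneg (hf : ∀ z, 0 ≤ f z) (h0 : 0 ≤ t) : 0 ≤ discIntegral f t :=
  intervalIntegral.integral_nonneg h0 fun _ hρ => mul_nonneg hρ.1
    (Real.circleAverage_nonneg_of_nonneg fun z _ => hf z)

theorem continuousOn_discIntegral_div (hf : ContinuousOn f (Metric.ball 0 s)) {r₁ r : ℝ}
    (hr₁ : 0 < r₁) (hs : r < s) : ContinuousOn (fun t => discIntegral f t / t) (Icc r₁ r) :=
  ((continuousOn_discIntegral hf hs).mono (Icc_subset_Icc_left hr₁.le)).div continuousOn_id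
    fun _ hx => (hr₁.trans_le hx.1).ne'

theorem intervalIntegrable_discIntegral_div (hf : ContinuousOn f (Metric.ball 0 s)) {r₁ r : ℝ}
    (hr₁ : 0 < r₁) (hr : r₁ ≤ r) (hs : r < s) :
    IntervalIntegrable (fun t => discIntegral f t / t) volume r₁ r := by
  apply ContinuousOn.intervalIntegrable
  rw [uIcc_of_le hr]
  exact continuousOn_discIntegral_div hf hr₁ hs

end discIntegral

namespace IsHoloPair

variable {s : ℝ} {p q : ℂ → ℂ}

theorem continuousOn_weight (h : IsHoloPair s p q) {η : ℝ} (hη : 0 < η) (hη1 : η ≤ 1) :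
    ContinuousOn (fun z => sphDensity p q z * logWeight (chordSq p q z + η)) (Metric.ball 0 s) := by
  have hv : ContinuousOn (fun z => chordSq p q z + η) (Metric.ball 0 s) :=
    h.continuousOn_chordSq.add continuousOn_const
  have h0 : ∀ z, 0 < chordSq p q z + η := fun z => by linarith [chordSq_nonneg p q z]
  have hL : ContinuousOn (fun z => 2 - Real.log (chordSq p q z + η)) (Metric.ball 0 s) :=
    continuousOn_const.sub (hv.log fun z _ => (h0 z).ne')
  refine h.continuousOn_sphDensity.mul (continuousOn_const.div ((hL.pow 2).mul hv) fun z _ => ?_)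
  have := log_lt_one_of_le_two (h0 z) (by linarith [chordSq_le_one p q z])
  exact mul_ne_zero (pow_ne_zero _ (by linarith)) (h0 z).ne'

/-- Green's formula for `-log(2 - log(v + η))`, whose Laplacian is at least `4 k - 12 σ` with `k`
the weighted density. The terms in `σ` integrate to a multiple of the characteristic function. The
boundary terms are harmless: the potential is nonpositive on the outer circle, and on the inner one
its negative is at most `2 - log v`. The bound does not involve `η`. -/
theorem lintegral_weight_le (h : IsHoloPair s p q) {r₁ r η : ℝ} (hr₁ : 0 < r₁) (hr : r₁ ≤ r)
    (hs : r < s) (hp : ∀ z ∈ Metric.sphere (0 : ℂ) r₁, p z ≠ 0) (hη : 0 < η) (hη1 : η ≤ 1) :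
    ∫⁻ t in Ioo r₁ r, ENNReal.ofReal (1 / t) * ∫⁻ z in Metric.ball 0 t,
      ENNReal.ofReal (sphDensity p q z * logWeight (chordSq p q z + η)) ≤
    ENNReal.ofReal (Real.pi / 2 * (circleAverage (fun z => 2 - Real.log (chordSq p q z)) 0 r₁ +
      6 * (circleAverage (fun z => Real.log (normSum p q z) / 2) 0 r -
        circleAverage (fun z => Real.log (normSum p q z) / 2) 0 r₁))) := by
  set k : ℂ → ℝ := fun z => sphDensity p q z * logWeight (chordSq p q z + η) with hk
  have hkc : ContinuousOn k (Metric.ball 0 s) := h.continuousOn_weight hη hη1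
  have h0 : ∀ z, 0 < chordSq p q z + η := fun z => by linarith [chordSq_nonneg p q z]
  have hk0 : ∀ z, 0 ≤ k z := fun z => mul_nonneg (sphDensity_nonneg p q z) (logWeight_nonneg (h0 z).le)
  have hmem : ∀ z, chordSq p q z ∈ Icc (0 : ℝ) 1 := fun z => ⟨chordSq_nonneg p q z, chordSq_le_one p q z⟩
  have hL1 : ∀ z, 1 < 2 - Real.log (chordSq p q z + η) := fun z => by
    have := log_lt_one_of_le_two (h0 z) (by linarith [chordSq_le_one p q z])
    linarith
  have hσ2 : ContinuousOn (fun z => 2 * sphDensity p q z) (Metric.ball 0 s) :=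
    continuousOn_const.mul h.continuousOn_sphDensity
  -- the left side as an iterated integral
  have hleft : ∫⁻ t in Ioo r₁ r, ENNReal.ofReal (1 / t) * ∫⁻ z in Metric.ball 0 t, ENNReal.ofReal (k z)
      = ENNReal.ofReal (2 * Real.pi * ∫ t in r₁..r, discIntegral k t / t) := by
    rw [← intervalIntegral.integral_const_mul, intervalIntegral.integral_of_le hr,
      integral_Ioc_eq_integral_Ioo, ofReal_integral_eq_lintegral_ofReal]
    · refine setLIntegral_congr_fun measurableSet_Ioo fun t ht => ?_
      have ht0 : 0 < t := hr₁.trans ht.1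
      rw [lintegral_ball_eq_integral_circleAverage ht0.le (ht.2.trans hs) hkc fun z _ => hk0 z,
        ← ENNReal.ofReal_mul (by positivity)]
      congr 1
      rw [discIntegral]; ring
    · exact ((continuousOn_const.mul (continuousOn_discIntegral_div hkc hr₁ hs)).integrableOn_Icc).mono_set
        Ioo_subset_Icc_self
    · refine (ae_restrict_iff' measurableSet_Ioo).2 (ae_of_all _ fun t ht => ?_)
      have ht0 : 0 < t := hr₁.trans ht.1
      have := discIntegral_nonneg hk0 ht0.le
      have := Real.pi_pos
      simp only [Pi.zero_apply]; positivity
  rw [hleft]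
  refine ENNReal.ofReal_le_ofReal ?_
  -- Green's formula
  have hφ'' : ContinuousOn (fun x => (Real.log (x + η) - 1) / ((2 - Real.log (x + η)) * (x + η)) ^ 2)
      (Icc (0 : ℝ) 1) := by
    have c1 : ContinuousOn (fun x : ℝ => Real.log (x + η)) (Icc 0 1) :=
      ContinuousOn.log (by fun_prop) fun x hx => by have := hx.1; positivity
    refine (c1.sub continuousOn_const).div (((continuousOn_const.sub c1).mul (by fun_prop)).pow 2)
      fun x hx => ?_
    have hx0 : 0 < x + η := by have := hx.1; positivity
    have := log_lt_one_of_le_two hx0 (by linarith [hx.2])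
    exact pow_ne_zero _ (mul_ne_zero (by linarith) hx0.ne')
  have green := h.circleAverage_comp_chordSq_sub (r₁ := r₁) (r := r)
    (φ := fun x => -Real.log (2 - Real.log (x + η)))
    (fun x hx => hasDerivAt_loglog (by linarith [hx.1]) (by linarith [hx.2]))
    (fun x hx => hasDerivAt_loglog' (by linarith [hx.1]) (by linarith [hx.2])) hφ'' hr₁ hr hs
  have greenu := h.circleAverage_log_normSum_sub hr₁ hr hs
  set lap : ℂ → ℝ := fun z => 4 * (sphDensity p q z *
        ((Real.log (chordSq p q z + η) - 1) / ((2 - Real.log (chordSq p q z + η)) *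
          (chordSq p q z + η)) ^ 2 * (chordSq p q z * (1 - chordSq p q z)) +
          ((2 - Real.log (chordSq p q z + η)) * (chordSq p q z + η))⁻¹ * (1 - 2 * chordSq p q z)))
    with hlap
  have hlapc : ContinuousOn lap (Metric.ball 0 s) := by
    have c1 : ContinuousOn (fun z => Real.log (chordSq p q z + η)) (Metric.ball 0 s) :=
      (h.continuousOn_chordSq.add continuousOn_const).log fun z _ => (h0 z).ne'
    have c2 := (continuousOn_const (c := (2 : ℝ))).sub c1
    have c3 := c2.mul (h.continuousOn_chordSq.add (continuousOn_const (c := η)))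
    have c4 : ∀ z ∈ Metric.ball (0 : ℂ) s, (2 - Real.log (chordSq p q z + η)) * (chordSq p q z + η) ≠ 0 :=
      fun z _ => mul_ne_zero (by linarith [hL1 z]) (h0 z).ne'
    exact continuousOn_const.mul (h.continuousOn_sphDensity.mul ((((c1.sub continuousOn_const).div
      (c3.pow 2) fun z hz => pow_ne_zero _ (c4 z hz)).mul (h.continuousOn_chordSq.mul
      (continuousOn_const.sub h.continuousOn_chordSq))).add ((c3.inv₀ c4).mul (continuousOn_const.sub
        (continuousOn_const.mul h.continuousOn_chordSq)))))
  change _ = ∫ t in r₁..r, discIntegral lap t / t at green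
  change _ = ∫ t in r₁..r, discIntegral (fun z => 2 * sphDensity p q z) t / t at greenu
  -- The factor is `6` and not `12` because the characteristic function is the integral of `2 σ`.
  have hcmp : 4 * (∫ t in r₁..r, discIntegral k t / t) -
      6 * (∫ t in r₁..r, discIntegral (fun z => 2 * sphDensity p q z) t / t) ≤
      ∫ t in r₁..r, discIntegral lap t / t := by
    rw [← intervalIntegral.integral_const_mul, ← intervalIntegral.integral_const_mul,
      ← intervalIntegral.integral_sub
        ((intervalIntegrable_discIntegral_div hkc hr₁ hr hs).const_mul 4)
        ((intervalIntegrable_discIntegral_div hσ2 hr₁ hr hs).const_mul 6)]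
    refine intervalIntegral.integral_mono_on hr
      (((intervalIntegrable_discIntegral_div hkc hr₁ hr hs).const_mul 4).sub
        ((intervalIntegrable_discIntegral_div hσ2 hr₁ hr hs).const_mul 6))
      (intervalIntegrable_discIntegral_div hlapc hr₁ hr hs) fun t ht => ?_
    have ht0 : 0 < t := hr₁.trans_le ht.1
    have hts := ht.2.trans_lt hs
    have e := discIntegral_linear hkc hσ2 4 (-6) ht0.le hts
    have e' := discIntegral_mono (t := t) ((continuousOn_const (c := (4 : ℝ))).mul hkc |>.add
      ((continuousOn_const (c := (-6 : ℝ))).mul hσ2)) hlapc (fun z _ => by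
        have := mul_le_mul_of_nonneg_left (logWeight_le (hmem z) hη hη1) (sphDensity_nonneg p q z)
        simp only [hk, hlap, Pi.add_apply, Pi.mul_apply]
        linarith) ht0.le hts
    have e2 : 4 * discIntegral k t - 6 * discIntegral (fun z => 2 * sphDensity p q z) t ≤
        discIntegral lap t := by
      refine le_trans (le_of_eq ?_) e'
      exact (by rw [sub_eq_add_neg, ← neg_mul]; exact e.symm)
    calc 4 * (discIntegral k t / t) - 6 * (discIntegral (fun z => 2 * sphDensity p q z) t / t)
        = (4 * discIntegral k t - 6 * discIntegral (fun z => 2 * sphDensity p q z) t) / t := by ring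
      _ ≤ _ := by gcongr
  -- bounds for the potential
  have hr0 : 0 ≤ r := hr₁.le.trans hr
  have hφc : ContinuousOn (fun z => -Real.log (2 - Real.log (chordSq p q z + η))) (Metric.ball 0 s) := by
    refine (ContinuousOn.log (continuousOn_const.sub ((h.continuousOn_chordSq.add
      continuousOn_const).log fun z _ => (h0 z).ne')) fun z _ => ?_).neg
    exact (by linarith [hL1 z] : 2 - Real.log (chordSq p q z + η) ≠ 0)
  have hup : circleAverage (fun z => -Real.log (2 - Real.log (chordSq p q z + η))) 0 r ≤ 0 :=
    Real.circleAverage_mono_on_of_le_circle (circleIntegrable_of_continuousOn_ball hφc hr0 hs)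
      fun z _ => neg_nonpos.2 (Real.log_nonneg (hL1 z).le)
  have hvc : ContinuousOn (fun z => 2 - Real.log (chordSq p q z)) (Metric.sphere 0 |r₁|) := by
    have hsub : Metric.sphere (0 : ℂ) |r₁| ⊆ Metric.ball 0 s := by
      intro z hz
      rw [mem_sphere_zero_iff_norm, abs_of_pos hr₁] at hz
      rw [mem_ball_zero_iff, hz]; linarith
    refine continuousOn_const.sub ((h.continuousOn_chordSq.mono hsub).log fun z hz => ?_)
    rw [abs_of_pos hr₁] at hz
    have := h.normSum_pos (hsub (by rwa [abs_of_pos hr₁]))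
    exact (div_pos (pow_pos (norm_pos_iff.2 (hp z hz)) 2) this).ne'
  -- From `log y ≤ y - 1` with `y = 2 - log(v + η)`, followed by monotonicity in `η`.
  have hlow : -circleAverage (fun z => -Real.log (2 - Real.log (chordSq p q z + η))) 0 r₁ ≤
      circleAverage (fun z => 2 - Real.log (chordSq p q z)) 0 r₁ := by
    have e := Real.circleAverage_fun_smul (a := (-1 : ℝ)) (c := (0 : ℂ)) (R := r₁)
      (f := fun z => -Real.log (2 - Real.log (chordSq p q z + η)))
    simp only [smul_eq_mul, neg_mul, one_mul, neg_neg] at e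
    rw [← e]
    refine Real.circleAverage_mono ?_ hvc.circleIntegrable' fun z hz => ?_
    · have := (circleIntegrable_of_continuousOn_ball hφc hr₁.le (hr.trans_lt hs)).neg
      convert this using 1
      ext z; simp
    · rw [abs_of_pos hr₁] at hz
      have hN := h.normSum_pos (z := z) (by
        rw [mem_sphere_zero_iff_norm] at hz
        rw [mem_ball_zero_iff, hz]; linarith)
      have hv : 0 < chordSq p q z := div_pos (pow_pos (norm_pos_iff.2 (hp z hz)) 2) hN
      have a1 := Real.log_le_sub_one_of_pos (by linarith [hL1 z] : 0 < 2 - Real.log (chordSq p q z + η))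
      have a2 := Real.log_le_log hv (by linarith : chordSq p q z ≤ chordSq p q z + η)
      linarith
  rw [← green, ← greenu] at hcmp
  have hpi := Real.pi_pos
  nlinarith

/-- The bound for the singular weight. -/
theorem lintegral_logWeight_le (h : IsHoloPair s p q) {r₁ r : ℝ} (hr₁ : 0 < r₁) (hr : r₁ ≤ r)
    (hs : r < s) (hp : ∀ z ∈ Metric.sphere (0 : ℂ) r₁, p z ≠ 0) :
    ∫⁻ t in Ioo r₁ r, ENNReal.ofReal (1 / t) * ∫⁻ z in Metric.ball 0 t,
      ENNReal.ofReal (sphDensity p q z * logWeight (chordSq p q z)) ≤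
    ENNReal.ofReal (Real.pi / 2 * (circleAverage (fun z => 2 - Real.log (chordSq p q z)) 0 r₁ +
      6 * (circleAverage (fun z => Real.log (normSum p q z) / 2) 0 r -
        circleAverage (fun z => Real.log (normSum p q z) / 2) 0 r₁))) := by
  -- The shift is removed by Fatou's lemma, used once for the area integral and once for the
  -- integral in `t`.
  set η : ℕ → ℝ := fun n => 1 / ((n : ℝ) + 1) with hη
  have hη0 : ∀ n, 0 < η n := fun n => by positivity
  have hη1 : ∀ n, η n ≤ 1 := fun n => by
    rw [hη]; simp only; rw [div_le_one (by positivity)]; linarith [(Nat.cast_nonneg n : (0 : ℝ) ≤ n)]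
  have hηt : Tendsto η atTop (𝓝 0) := tendsto_one_div_add_atTop_nhds_zero_nat
  set k : ℕ → ℂ → ℝ≥0∞ := fun n z =>
    ENNReal.ofReal (sphDensity p q z * logWeight (chordSq p q z + η n)) with hk
  have hpt : ∀ z, ENNReal.ofReal (sphDensity p q z * logWeight (chordSq p q z)) ≤
      liminf (fun n => k n z) atTop := by
    intro z
    rcases (chordSq_nonneg p q z).eq_or_lt with h0 | h0
    -- At a zero of the chordal distance the weight is `1 / 0 = 0`, so only an inequality with the
    -- limit inferior can hold there.
    · simp [← h0, logWeight]
    · refine le_of_eq (Tendsto.liminf_eq ?_).symm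
      refine (ENNReal.continuous_ofReal.tendsto _).comp (Tendsto.const_mul _ ?_)
      have hc : ContinuousAt logWeight (chordSq p q z) := by
        have := log_lt_one_of_le_two h0 (by linarith [chordSq_le_one p q z])
        have hl := Real.continuousAt_log h0.ne'
        refine ContinuousAt.div continuousAt_const
          (((continuousAt_const.sub hl).pow 2).mul continuousAt_id) ?_
        exact mul_ne_zero (pow_ne_zero _ (by linarith)) h0.ne'
      refine hc.tendsto.comp ?_
      simpa using hηt.const_add (chordSq p q z)
  have hin : ∀ t ∈ Ioo r₁ r, ∫⁻ z in Metric.ball 0 t,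
      ENNReal.ofReal (sphDensity p q z * logWeight (chordSq p q z)) ≤
      liminf (fun n => ∫⁻ z in Metric.ball 0 t, k n z) atTop := by
    intro t ht
    refine (lintegral_mono hpt).trans (lintegral_liminf_le' fun n => ?_)
    have := ((h.continuousOn_weight (hη0 n) (hη1 n)).mono (Metric.ball_subset_ball
      (ht.2.trans hs).le)).aemeasurable (μ := volume) Metric.isOpen_ball.measurableSet
    exact this.ennreal_ofReal
  have hmono : ∀ n, Monotone fun t : ℝ => ∫⁻ z in Metric.ball (0 : ℂ) t, k n z := fun n a b hab =>
    lintegral_mono_set (Metric.ball_subset_ball hab)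
  calc _ ≤ ∫⁻ t in Ioo r₁ r, liminf (fun n => ENNReal.ofReal (1 / t) *
        ∫⁻ z in Metric.ball 0 t, k n z) atTop := by
        refine setLIntegral_mono' measurableSet_Ioo fun t ht => ?_
        rw [ENNReal.liminf_const_mul_of_ne_zero_of_ne_top]
        · gcongr
          exact hin t ht
        · simpa using hr₁.trans ht.1
        · exact ENNReal.ofReal_ne_top
    _ ≤ liminf (fun n => ∫⁻ t in Ioo r₁ r, ENNReal.ofReal (1 / t) *
        ∫⁻ z in Metric.ball 0 t, k n z) atTop := by
        refine lintegral_liminf_le fun n => ?_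
        exact (ENNReal.measurable_ofReal.comp (measurable_const.div measurable_id)).mul
          (hmono n).measurable
    _ ≤ _ := by
        refine liminf_le_of_le (by isBoundedDefault) fun b hb => ?_
        obtain ⟨n, hn⟩ := hb.exists
        exact hn.trans (h.lintegral_weight_le hr₁ hr hs hp (hη0 n) (hη1 n))

end IsHoloPair

end HoloNevanlinna

namespace HoloNevanlinna

open Real (circleAverage)

/-! ### Jensen's inequality for meromorphic functions with simple poles -/

/-- Both terms have the form `log ρ + log⁺(|u| / ρ) = log max(ρ, |u|)`, constant in `ρ` up to `|u|`
and of derivative `1 / ρ` afterwards. This is the contribution of one point to the counting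
function. -/
theorem radialLog_sub_eq_integral {r₁ r : ℝ} (hr₁ : 0 < r₁) (hr : r₁ ≤ r) (u : ℂ) :
    (Real.log r + Real.posLog (r⁻¹ * ‖u‖)) - (Real.log r₁ + Real.posLog (r₁⁻¹ * ‖u‖)) =
      ∫ t in r₁..r, (if ‖u‖ < t then 1 else 0) / t := by
  have key : ∀ ρ, 0 < ρ → Real.log ρ + Real.posLog (ρ⁻¹ * ‖u‖) = Real.log (max ρ ‖u‖) := by
    intro ρ hρ
    rcases le_total ‖u‖ ρ with h | h
    · rw [max_eq_left h, Real.posLog_eq_zero_iff _ |>.2, add_zero]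
      rw [abs_of_nonneg (by positivity), inv_mul_le_iff₀ hρ]; simpa using h
    · have hu : 0 < ‖u‖ := hρ.trans_le h
      rw [max_eq_right h, Real.posLog_eq_log, Real.log_mul (by positivity) hu.ne', Real.log_inv]
      · ring
      · rw [abs_of_nonneg (by positivity), le_inv_mul_iff₀ hρ]; simpa using h
  have hr0 : 0 < r := hr₁.trans_le hr
  rw [key r hr0, key r₁ hr₁]
  -- The modulus of `u` clamped to `[r₁, r]` is the only break point of the integrand, whatever the
  -- position of `u`.
  set c := max r₁ (min ‖u‖ r) with hc
  have hc1 : r₁ ≤ c := le_max_left _ _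
  have hc2 : c ≤ r := max_le hr (min_le_right _ _)
  have hc0 : 0 < c := hr₁.trans_le hc1
  have i1 : EqOn (fun t : ℝ => (if ‖u‖ < t then (1 : ℝ) else 0) / t) (fun _ => 0) (Ioo r₁ c) := by
    intro t ht
    have : ¬ ‖u‖ < t := by
      rcases lt_max_iff.1 (hc ▸ ht.2) with h | h
      · exact absurd ht.1 (not_lt.2 h.le)
      · exact not_lt.2 (h.trans_le (min_le_left _ _)).le
    simp [this]
  have i2 : EqOn (fun t : ℝ => (if ‖u‖ < t then (1 : ℝ) else 0) / t) (fun t => 1 / t) (Ioo c r) := by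
    intro t ht
    have : ‖u‖ < t := by
      have h1 : min ‖u‖ r < t := (le_max_right _ _).trans_lt ht.1
      rcases min_lt_iff.1 h1 with h | h
      · exact h
      · exact absurd ht.2 (not_lt.2 h.le)
    simp [this]
  have j1 : IntervalIntegrable (fun t : ℝ => (if ‖u‖ < t then (1 : ℝ) else 0) / t) volume r₁ c := by
    rw [intervalIntegrable_iff_integrableOn_Ioo_of_le hc1]
    exact (integrableOn_congr_fun i1 measurableSet_Ioo).2 integrableOn_zero
  have k2 : IntervalIntegrable (fun t : ℝ => 1 / t) volume c r := by
    apply ContinuousOn.intervalIntegrable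
    rw [uIcc_of_le hc2]
    exact continuousOn_const.div continuousOn_id fun x hx => (hc0.trans_le hx.1).ne'
  have j2 : IntervalIntegrable (fun t : ℝ => (if ‖u‖ < t then (1 : ℝ) else 0) / t) volume c r := by
    rw [intervalIntegrable_iff_integrableOn_Ioo_of_le hc2] at k2 ⊢
    exact (integrableOn_congr_fun i2 measurableSet_Ioo).2 k2
  rw [← intervalIntegral.integral_add_adjacent_intervals j1 j2, intervalIntegral.integral_of_le hc1,
    intervalIntegral.integral_of_le hc2, integral_Ioc_eq_integral_Ioo, integral_Ioc_eq_integral_Ioo,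
    setIntegral_congr_fun measurableSet_Ioo i1, setIntegral_congr_fun measurableSet_Ioo i2,
    ← integral_Ioc_eq_integral_Ioo, ← integral_Ioc_eq_integral_Ioo,
    ← intervalIntegral.integral_of_le hc2, integral_one_div_of_pos hc0 hr0,
    Real.log_div hr0.ne' hc0.ne']
  simp only [integral_zero, zero_add]
  rcases le_total ‖u‖ r₁ with h | h
  · have : c = r₁ := by rw [hc, min_eq_left (h.trans hr), max_eq_left h]
    rw [this, max_eq_left h, max_eq_left (h.trans hr)]
  · rcases le_total ‖u‖ r with h' | h'
    · have : c = ‖u‖ := by rw [hc, min_eq_left h', max_eq_right h]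
      rw [this, max_eq_right h, max_eq_left h']
    · have : c = r := by rw [hc, min_eq_right h', max_eq_right hr]
      rw [this, max_eq_right h, max_eq_right h']; ring

/-- Jensen's formula from a factorisation into linear factors and a zero-free `g`. The factorisation
lives on the large disc and serves for every smaller radius, so the term `log ‖g 0‖` cancels when
two radii are compared. -/
theorem circleAverage_log_norm_eq_of_extract {f g : ℂ → ℂ} {r ρ : ℝ} {D : ℂ → ℤ} {Z : Finset ℂ} (hg : AnalyticOnNhd ℂ g (Metric.closedBall 0 r))
    (hg0 : ∀ u ∈ Metric.closedBall (0 : ℂ) r, g u ≠ 0)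
    (hfg : (fun z => Real.log ‖f z‖) =ᶠ[codiscreteWithin (Metric.closedBall 0 r)]
      (fun z => ∑ u ∈ Z, D u * Real.log ‖z - u‖ + Real.log ‖g z‖)) (hρ : 0 < ρ) (hρr : ρ ≤ r) :
    circleAverage (fun z => Real.log ‖f z‖) 0 ρ =
      ∑ u ∈ Z, D u * (Real.log ρ + Real.posLog (ρ⁻¹ * ‖u‖)) + Real.log ‖g 0‖ := by
  have hsub : Metric.closedBall (0 : ℂ) |ρ| ⊆ Metric.closedBall 0 r := by
    rw [abs_of_pos hρ]; exact Metric.closedBall_subset_closedBall hρr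
  have hi : ∀ u ∈ Z, CircleIntegrable (fun z => D u * Real.log ‖z - u‖) 0 ρ := fun u _ => by
    apply IntervalIntegrable.const_mul
    apply (analyticOnNhd_id.sub analyticOnNhd_const).meromorphicOn.circleIntegrable_log_norm
  rw [Real.circleAverage_congr_codiscreteWithin
    (codiscreteWithin_mono (Metric.sphere_subset_closedBall.trans hsub) hfg) hρ.ne',
    Real.circleAverage_fun_add, Real.circleAverage_fun_sum hi,
    AnalyticOnNhd.circleAverage_log_norm_of_ne_zero (hg.mono hsub) fun u hu => hg0 u (hsub hu)]
  · congr 1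
    refine Finset.sum_congr rfl fun u _ => ?_
    have e := Real.circleAverage_fun_smul (a := (D u : ℝ)) (c := (0 : ℂ)) (R := ρ)
      (f := fun z => Real.log ‖z - u‖)
    simp only [smul_eq_mul] at e
    rw [e, circleAverage_log_norm_sub_const_eq_log_radius_add_posLog hρ.ne', zero_sub, norm_neg]
  · exact CircleIntegrable.fun_sum Z hi
  · exact (hg.mono (Metric.sphere_subset_closedBall.trans hsub)).meromorphicOn.circleIntegrable_log_norm

/-- Jensen's inequality for a meromorphic function with at most simple poles, located in `S`. -/
theorem circleAverage_log_norm_ge {f : ℂ → ℂ} {r₁ r : ℝ} (hr₁ : 0 < r₁) (hr : r₁ ≤ r)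
    (hf : MeromorphicOn f (Metric.closedBall 0 r))
    (htop : ∀ u ∈ Metric.closedBall (0 : ℂ) r, meromorphicOrderAt f u ≠ ⊤) (S : Finset ℂ)
    (hS : ∀ u ∈ Metric.closedBall (0 : ℂ) r, u ∈ S → (-1 : ℤ) ≤ meromorphicOrderAt f u)
    (hS' : ∀ u ∈ Metric.closedBall (0 : ℂ) r, u ∉ S → 0 ≤ meromorphicOrderAt f u) :
    circleAverage (fun z => Real.log ‖f z‖) 0 r₁ -
      ∑ u ∈ S, (∫ t in r₁..r, (if ‖u‖ < t then 1 else 0) / t) ≤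
      circleAverage (fun z => Real.log ‖f z‖) 0 r := by
  classical
  set U := Metric.closedBall (0 : ℂ) r
  set D := MeromorphicOn.divisor f U
  have hfin : (D : ℂ → ℤ).support.Finite := D.finiteSupport (isCompact_closedBall 0 r)
  obtain ⟨g, hg, hg0, hfg⟩ := hf.extract_zeros_poles (fun u => htop u u.2) hfin
  have hlog := MeromorphicOn.extract_zeros_poles_log hg0 hfg
  -- One finite set for both sums: it contains the support of the divisor and all permitted poles.
  set Z : Finset ℂ := hfin.toFinset ∪ S
  have hZ : ∀ u, D u ≠ 0 → u ∈ Z := fun u hu => Finset.mem_union_left _ (by simpa using hu)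
  have hlog' : (fun z => Real.log ‖f z‖) =ᶠ[codiscreteWithin U]
      (fun z => ∑ u ∈ Z, D u * Real.log ‖z - u‖ + Real.log ‖g z‖) := by
    refine hlog.trans (Eventually.of_forall fun z => ?_)
    rw [finsum_eq_sum_of_support_subset (s := Z)]
    · simp
      rfl
    · intro u hu
      refine hZ u fun h0 => hu ?_
      ext z; simp [D, U, h0] at *
  have hg0' : ∀ u ∈ U, g u ≠ 0 := fun u hu => hg0 ⟨u, hu⟩
  have e := circleAverage_log_norm_eq_of_extract hg hg0' hlog' (hr₁.trans_le hr) le_rfl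
  have e₁ := circleAverage_log_norm_eq_of_extract hg hg0' hlog' hr₁ hr
  have hnn : ∀ u : ℂ, 0 ≤ ∫ t in r₁..r, (if ‖u‖ < t then (1 : ℝ) else 0) / t := fun u =>
    intervalIntegral.integral_nonneg hr fun t ht => by
      have := hr₁.trans_le ht.1
      positivity
  have hdiff : circleAverage (fun z => Real.log ‖f z‖) 0 r - circleAverage (fun z => Real.log ‖f z‖) 0 r₁
      = ∑ u ∈ Z, D u * ∫ t in r₁..r, (if ‖u‖ < t then (1 : ℝ) else 0) / t := by
    rw [e, e₁, add_sub_add_right_eq_sub, ← Finset.sum_sub_distrib]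
    refine Finset.sum_congr rfl fun u _ => ?_
    rw [← radialLog_sub_eq_integral hr₁ hr]; ring
  have hge : -∑ u ∈ S, (∫ t in r₁..r, (if ‖u‖ < t then (1 : ℝ) else 0) / t) ≤
      ∑ u ∈ Z, D u * ∫ t in r₁..r, (if ‖u‖ < t then (1 : ℝ) else 0) / t := by
    have hSZ : S ⊆ Z := Finset.subset_union_right
    rw [← Finset.sum_neg_distrib]
    have hD : ∀ u, (u ∈ S → -1 ≤ D u) ∧ (u ∉ S → 0 ≤ D u) := by
      intro u
      by_cases hu : u ∈ U
      · have hap : D u = (meromorphicOrderAt f u).untop₀ := MeromorphicOn.divisor_apply hf hu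
        have hcoe := WithTop.coe_untop₀_of_ne_top (htop u hu)
        refine ⟨fun h => ?_, fun h => ?_⟩
        · have := hS u hu h
          rw [← hcoe] at this
          rw [hap]; exact_mod_cast this
        · have := hS' u hu h
          rw [← hcoe] at this
          rw [hap]; exact_mod_cast this
      · have : D u = 0 := Function.locallyFinsuppWithin.apply_eq_zero_of_notMem _ hu
        rw [this]; simp
    refine (Finset.sum_le_sum (g := fun u => (D u : ℝ) * ∫ t in r₁..r, (if ‖u‖ < t then (1 : ℝ) else 0) / t)
      fun u hu => ?_).trans (Finset.sum_le_sum_of_subset_of_nonneg hSZ fun u _ hu => ?_)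
    · have : (-1 : ℝ) ≤ D u := by exact_mod_cast (hD u).1 hu
      nlinarith [hnn u]
    · have : (0 : ℝ) ≤ D u := by exact_mod_cast (hD u).2 hu
      exact mul_nonneg this (hnn u)
  linarith

end HoloNevanlinna

namespace HoloNevanlinna

open Real (circleAverage)

/-! ### Linear forms -/

/-- The linear combination of `p` and `q` with coefficients `c`. -/
def linForm (c : ℂ × ℂ) (p q : ℂ → ℂ) (z : ℂ) : ℂ := c.1 * p z + c.2 * q z

/-- The linear combination which is orthogonal to `linForm c p q`. -/
def coForm (c : ℂ × ℂ) (p q : ℂ → ℂ) (z : ℂ) : ℂ :=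
  -(starRingEnd ℂ) c.2 * p z + (starRingEnd ℂ) c.1 * q z

/-- For a unit covector the passage from `(p, q)` to the two forms is given by a matrix in `SU(2)`.
Hence the norm, the Wronskian and the spherical density do not change, and any target point may be
treated as the zero of the first component. -/
theorem normSum_linForm {c : ℂ × ℂ} (hc : ‖c.1‖ ^ 2 + ‖c.2‖ ^ 2 = 1) (p q : ℂ → ℂ) (z : ℂ) :
    normSum (linForm c p q) (coForm c p q) z = normSum p q z := by
  have hc' : c.1 * (starRingEnd ℂ) c.1 + c.2 * (starRingEnd ℂ) c.2 = 1 := by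
    rw [← norm_sq_ofReal, ← norm_sq_ofReal]; exact_mod_cast hc
  have : (normSum (linForm c p q) (coForm c p q) z : ℂ) = normSum p q z := by
    simp only [normSum, Complex.ofReal_add, norm_sq_ofReal, linForm, coForm, map_add, map_mul, map_neg,
      Complex.conj_conj]
    linear_combination (p z * (starRingEnd ℂ) (p z) + q z * (starRingEnd ℂ) (q z)) * hc'
  exact_mod_cast this

theorem meromorphicOrderAt_pos_of_zero {f : ℂ → ℂ} {z : ℂ} (hf : AnalyticAt ℂ f z) (h0 : f z = 0) :
    0 < meromorphicOrderAt f z := by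
  refine (lt_of_le_of_ne hf.meromorphicOrderAt_nonneg fun h => ?_)
  have := hf.meromorphicOrderAt_eq
  have h1 : analyticOrderAt f z ≠ 0 := hf.analyticOrderAt_ne_zero.2 h0
  rw [← h] at this
  cases h' : analyticOrderAt f z with
  | top => simp [h'] at this
  | coe m =>
    rw [h'] at this h1
    simp only [ENat.map_natCast] at this
    have : (m : ℤ) = 0 := by exact_mod_cast this.symm
    exact h1 (by exact_mod_cast this)

theorem meromorphicOrderAt_eq_zero_of_ne {f : ℂ → ℂ} {z : ℂ} (hf : AnalyticAt ℂ f z) (h0 : f z ≠ 0) :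
    meromorphicOrderAt f z = 0 := by
  rw [hf.meromorphicOrderAt_eq, hf.analyticOrderAt_eq_zero.2 h0]; simp

namespace IsHoloPair

variable {s : ℝ} {p q : ℂ → ℂ} {c c' : ℂ × ℂ} {z : ℂ}

theorem linForm_pair (h : IsHoloPair s p q) (hc : ‖c.1‖ ^ 2 + ‖c.2‖ ^ 2 = 1) :
    IsHoloPair s (linForm c p q) (coForm c p q) where
  left := (h.left.const_mul _).add (h.right.const_mul _)
  right := (h.left.const_mul _).add (h.right.const_mul _)
  ne_zero z hz := by
    by_contra! h0
    have h1 := h.normSum_pos hz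
    rw [← normSum_linForm hc, normSum, h0.1, h0.2] at h1
    simp at h1

theorem wronskian_linForm (h : IsHoloPair s p q) (hc : ‖c.1‖ ^ 2 + ‖c.2‖ ^ 2 = 1)
    (hz : z ∈ Metric.ball (0 : ℂ) s) :
    wronskian (linForm c p q) (coForm c p q) z = wronskian p q z := by
  have hc' : c.1 * (starRingEnd ℂ) c.1 + c.2 * (starRingEnd ℂ) c.2 = 1 := by
    rw [← norm_sq_ofReal, ← norm_sq_ofReal]; exact_mod_cast hc
  have hp := h.hasDerivAt_left hz
  have hq := h.hasDerivAt_right hz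
  have e1 : deriv (linForm c p q) z = c.1 * deriv p z + c.2 * deriv q z :=
    ((hp.const_mul _).add (hq.const_mul _)).deriv
  have e2 : deriv (coForm c p q) z =
      -(starRingEnd ℂ) c.2 * deriv p z + (starRingEnd ℂ) c.1 * deriv q z :=
    ((hp.const_mul _).add (hq.const_mul _)).deriv
  rw [wronskian, e1, e2, wronskian, linForm, coForm]
  linear_combination (deriv p z * q z - p z * deriv q z) * hc'

theorem sphDensity_linForm (h : IsHoloPair s p q) (hc : ‖c.1‖ ^ 2 + ‖c.2‖ ^ 2 = 1)
    (hz : z ∈ Metric.ball (0 : ℂ) s) :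
    sphDensity (linForm c p q) (coForm c p q) z = sphDensity p q z := by
  rw [sphDensity, h.wronskian_linForm hc hz, normSum_linForm hc, sphDensity]

theorem analyticOnNhd_left (h : IsHoloPair s p q) : AnalyticOnNhd ℂ p (Metric.ball 0 s) :=
  h.left.analyticOnNhd Metric.isOpen_ball

theorem analyticOnNhd_right (h : IsHoloPair s p q) : AnalyticOnNhd ℂ q (Metric.ball 0 s) :=
  h.right.analyticOnNhd Metric.isOpen_ball

theorem analyticOnNhd_wronskian (h : IsHoloPair s p q) :
    AnalyticOnNhd ℂ (wronskian p q) (Metric.ball 0 s) :=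
  h.differentiableOn_wronskian.analyticOnNhd Metric.isOpen_ball

/-- Where the Wronskian does not vanish identically, neither it nor `p` vanishes to infinite order. -/
theorem order_wronskian_ne_top (h : IsHoloPair s p q)
    (hW : ∃ z ∈ Metric.ball (0 : ℂ) s, wronskian p q z ≠ 0) (hz : z ∈ Metric.ball (0 : ℂ) s) :
    meromorphicOrderAt (wronskian p q) z ≠ ⊤ := by
  intro htop
  obtain ⟨w, hw, hw0⟩ := hW
  have h1 : ∀ᶠ x in 𝓝[≠] z, wronskian p q x = 0 := meromorphicOrderAt_eq_top_iff.1 htop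
  have h2 := h.analyticOnNhd_wronskian.eqOn_zero_of_preconnected_of_frequently_eq_zero
    (convex_ball 0 s).isPreconnected hz h1.frequently
  exact hw0 (h2 hw)

theorem order_left_ne_top (h : IsHoloPair s p q)
    (hW : ∃ z ∈ Metric.ball (0 : ℂ) s, wronskian p q z ≠ 0) (hz : z ∈ Metric.ball (0 : ℂ) s) :
    meromorphicOrderAt p z ≠ ⊤ := by
  intro htop
  obtain ⟨w, hw, hw0⟩ := hW
  have h1 : ∀ᶠ x in 𝓝[≠] z, p x = 0 := meromorphicOrderAt_eq_top_iff.1 htop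
  have h2 := h.analyticOnNhd_left.eqOn_zero_of_preconnected_of_frequently_eq_zero
    (convex_ball 0 s).isPreconnected hz h1.frequently
  have h3 : p =ᶠ[𝓝 w] fun _ => 0 := h2.eventuallyEq_of_mem (Metric.isOpen_ball.mem_nhds hw)
  apply hw0
  rw [wronskian, h3.deriv_eq, h3.eq_of_nhds]; simp

/-- The quotient of the Wronskian by `p` has at most simple poles. -/
theorem order_wronskian_ge (h : IsHoloPair s p q)
    (hW : ∃ z ∈ Metric.ball (0 : ℂ) s, wronskian p q z ≠ 0) (hz : z ∈ Metric.ball (0 : ℂ) s)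
    (hpz : p z = 0) : meromorphicOrderAt p z + (-1 : ℤ) ≤ meromorphicOrderAt (wronskian p q) z := by
  have hpa := (h.analyticOnNhd_left z hz)
  have hqa := (h.analyticOnNhd_right z hz)
  obtain ⟨n, hn⟩ := WithTop.ne_top_iff_exists.1 (h.order_left_ne_top hW hz)
  have hpos := meromorphicOrderAt_pos_of_zero hpa hpz
  rw [← hn] at hpos ⊢
  have hn0 : (0 : ℤ) < n := by exact_mod_cast hpos
  have hd := meromorphicOrderAt_deriv_eq_sub_one (f := p) (x := z) (n := n)
    (by exact_mod_cast hn0.ne') hn.symm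
  have hdm : MeromorphicAt (deriv p) z := hpa.deriv.meromorphicAt
  have hdq : MeromorphicAt (deriv q) z := hqa.deriv.meromorphicAt
  have o1 : ((n - 1 : ℤ) : WithTop ℤ) ≤ meromorphicOrderAt (deriv p * q) z := by
    rw [meromorphicOrderAt_mul hdm hqa.meromorphicAt, hd]
    exact le_add_of_nonneg_right hqa.meromorphicOrderAt_nonneg
  have o2 : ((n - 1 : ℤ) : WithTop ℤ) ≤ meromorphicOrderAt (-(p * deriv q)) z := by
    rw [← meromorphicOrderAt_neg, meromorphicOrderAt_mul hpa.meromorphicAt hdq, ← hn]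
    refine le_trans ?_ (le_add_of_nonneg_right hqa.deriv.meromorphicOrderAt_nonneg)
    exact_mod_cast (by omega : n - 1 ≤ n)
  have e : wronskian p q = deriv p * q + -(p * deriv q) := by
    ext x; simp [wronskian, sub_eq_add_neg]
  rw [e]
  refine le_trans ?_ (meromorphicOrderAt_add (hdm.mul hqa.meromorphicAt)
    (hpa.meromorphicAt.mul hdq).neg)
  refine le_trans (le_of_eq ?_) (le_min o1 o2)
  exact_mod_cast (by ring : n + (-1) = n - 1)

/-- Independent forms have no common zeros. -/
theorem linForm_ne_zero_of_ne (h : IsHoloPair s p q) (hz : z ∈ Metric.ball (0 : ℂ) s)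
    (hcc' : c.1 * c'.2 - c.2 * c'.1 ≠ 0) (h0 : linForm c p q z = 0) : linForm c' p q z ≠ 0 := by
  intro h1
  have e1 : (c.1 * c'.2 - c.2 * c'.1) * p z = 0 := by
    simp only [linForm] at h0 h1; linear_combination c'.2 * h0 - c.2 * h1
  have e2 : (c.1 * c'.2 - c.2 * c'.1) * q z = 0 := by
    simp only [linForm] at h0 h1; linear_combination c.1 * h1 - c'.1 * h0
  rcases h.ne_zero z hz with h' | h'
  · exact h' ((mul_eq_zero.1 e1).resolve_left hcc')
  · exact h' ((mul_eq_zero.1 e2).resolve_left hcc')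

theorem _root_.HoloNevanlinna.finite_zeros_of_analyticOnNhd {f : ℂ → ℂ}
    (hf : AnalyticOnNhd ℂ f (Metric.ball 0 s))
    (htop : ∀ z ∈ Metric.ball (0 : ℂ) s, meromorphicOrderAt f z ≠ ⊤) {r : ℝ} (hr : r < s) :
    {z | z ∈ Metric.closedBall (0 : ℂ) r ∧ f z = 0}.Finite := by
  have hsub : Metric.closedBall (0 : ℂ) r ⊆ Metric.ball 0 s := Metric.closedBall_subset_ball hr
  have hm : MeromorphicOn f (Metric.closedBall 0 r) := (hf.mono hsub).meromorphicOn
  have hfin := (MeromorphicOn.divisor f (Metric.closedBall (0 : ℂ) r)).finiteSupport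
    (isCompact_closedBall 0 r)
  refine hfin.subset fun z hz => ?_
  rw [Function.mem_support, MeromorphicOn.divisor_apply hm hz.1]
  have h1 := meromorphicOrderAt_pos_of_zero (hf z (hsub hz.1)) hz.2
  intro h0
  rcases (WithTop.untop₀_eq_zero.1 h0) with h3 | h3
  · exact h1.ne' h3
  · exact htop z (hsub hz.1) h3

theorem finite_zeros_left (h : IsHoloPair s p q)
    (hW : ∃ z ∈ Metric.ball (0 : ℂ) s, wronskian p q z ≠ 0) {r : ℝ} (hr : r < s) :
    {z | z ∈ Metric.closedBall (0 : ℂ) r ∧ p z = 0}.Finite :=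
  finite_zeros_of_analyticOnNhd h.analyticOnNhd_left (fun _ hz => h.order_left_ne_top hW hz) hr

theorem _root_.HoloNevanlinna.intervalIntegrable_step_div {r₁ r : ℝ} (hr₁ : 0 < r₁) (hr : r₁ ≤ r)
    (u : ℂ) : IntervalIntegrable (fun t : ℝ => (if ‖u‖ < t then (1 : ℝ) else 0) / t) volume r₁ r := by
  have k2 : IntervalIntegrable (fun t : ℝ => 1 / t) volume r₁ r := by
    apply ContinuousOn.intervalIntegrable
    rw [uIcc_of_le hr]
    exact continuousOn_const.div continuousOn_id fun x hx => (hr₁.trans_le hx.1).ne'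
  rw [intervalIntegrable_iff_integrableOn_Ioc_of_le hr] at k2 ⊢
  refine (k2.indicator (measurableSet_Ioi (a := ‖u‖))).congr (ae_of_all _ fun t => ?_)
  by_cases h : ‖u‖ < t <;> simp [h]

variable {m : ℕ} {a : Fin m → ℂ × ℂ}

/-- The logarithm of the singular density. -/
def logSingular (a : Fin m → ℂ × ℂ) (p q : ℂ → ℂ) (z : ℂ) : ℝ :=
  (Real.log (sphDensity p q z) -
    ∑ j, Real.log (chordSq (linForm (a j) p q) (coForm (a j) p q) z)) / 2

/-- The coefficient `m - 2` of the second main theorem originates here: after halving, each of the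
`m` chordal distances contributes one `(log N)/2`, and the spherical density takes two away. -/
theorem logSingular_eq (h : IsHoloPair s p q) (ha : ∀ j, ‖(a j).1‖ ^ 2 + ‖(a j).2‖ ^ 2 = 1)
    (hz : z ∈ Metric.ball (0 : ℂ) s) (hWz : wronskian p q z ≠ 0) (hLz : ∀ j, linForm (a j) p q z ≠ 0) :
    logSingular a p q z = Real.log ‖wronskian p q z * (∏ j, linForm (a j) p q z)⁻¹‖ +
      ((m : ℝ) - 2) * (Real.log (normSum p q z) / 2) := by
  have hN := (h.normSum_pos hz).ne'
  have e1 : ∀ j, Real.log (chordSq (linForm (a j) p q) (coForm (a j) p q) z) =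
      2 * Real.log ‖linForm (a j) p q z‖ - Real.log (normSum p q z) := by
    intro j
    rw [chordSq, normSum_linForm (ha j),
      Real.log_div (pow_ne_zero _ (norm_ne_zero_iff.2 (hLz j))) hN, Real.log_pow]
    norm_num
  rw [logSingular, sphDensity, Real.log_div (pow_ne_zero _ (norm_ne_zero_iff.2 hWz))
    (pow_ne_zero _ hN), Real.log_pow, Real.log_pow]
  simp only [e1, Finset.sum_sub_distrib, Finset.sum_const, Finset.card_univ, Fintype.card_fin,
    nsmul_eq_mul]
  rw [norm_mul, norm_inv, norm_prod, Real.log_mul (norm_ne_zero_iff.2 hWz)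
    (inv_ne_zero (Finset.prod_ne_zero_iff.2 fun j _ => norm_ne_zero_iff.2 (hLz j))), Real.log_inv,
    Real.log_prod fun j _ => norm_ne_zero_iff.2 (hLz j), ← Finset.mul_sum]
  push_cast
  ring

/-- The main inequality: the mean of the logarithm of the singular density controls the defect. -/
theorem circleAverage_logSingular_ge (h : IsHoloPair s p q)
    (hW : ∃ z ∈ Metric.ball (0 : ℂ) s, wronskian p q z ≠ 0)
    (ha : ∀ j, ‖(a j).1‖ ^ 2 + ‖(a j).2‖ ^ 2 = 1)
    (hind : ∀ i j, i ≠ j → (a i).1 * (a j).2 - (a i).2 * (a j).1 ≠ 0)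
    {r₁ r : ℝ} (hr₁ : 0 < r₁) (hr : r₁ ≤ r) (hs : r < s)
    (hgood : ∀ ρ, ρ = r₁ ∨ ρ = r → ∀ z ∈ Metric.sphere (0 : ℂ) ρ,
      wronskian p q z ≠ 0 ∧ ∀ j, linForm (a j) p q z ≠ 0) :
    circleAverage (logSingular a p q) 0 r₁ + ((m : ℝ) - 2) *
      (circleAverage (fun z => Real.log (normSum p q z) / 2) 0 r -
        circleAverage (fun z => Real.log (normSum p q z) / 2) 0 r₁) -
      ∑ j, (∫ t in r₁..r,
        (({z | z ∈ Metric.ball (0 : ℂ) t ∧ linForm (a j) p q z = 0}.ncard : ℝ) / t)) ≤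
      circleAverage (logSingular a p q) 0 r := by
  classical
  have hsub : Metric.closedBall (0 : ℂ) r ⊆ Metric.ball 0 s := Metric.closedBall_subset_ball hs
  set G : ℂ → ℂ := fun z => wronskian p q z * (∏ j, linForm (a j) p q z)⁻¹ with hG
  have hWj : ∀ j, ∃ z ∈ Metric.ball (0 : ℂ) s,
      wronskian (linForm (a j) p q) (coForm (a j) p q) z ≠ 0 := fun j => by
    obtain ⟨z, hz, hz0⟩ := hW
    exact ⟨z, hz, by rwa [h.wronskian_linForm (ha j) hz]⟩
  have hLa : ∀ j, AnalyticOnNhd ℂ (linForm (a j) p q) (Metric.ball 0 s) := fun j =>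
    (h.linForm_pair (ha j)).analyticOnNhd_left
  have hPa : AnalyticOnNhd ℂ (fun z => ∏ j, linForm (a j) p q z) (Metric.ball 0 s) := fun z hz =>
    Finset.analyticAt_fun_prod _ fun j _ => hLa j z hz
  have hGm : ∀ z ∈ Metric.ball (0 : ℂ) s, MeromorphicAt G z := fun z hz =>
    (h.analyticOnNhd_wronskian z hz).meromorphicAt.mul (hPa z hz).meromorphicAt.inv
  have hord : ∀ z ∈ Metric.ball (0 : ℂ) s, meromorphicOrderAt G z =
      meromorphicOrderAt (wronskian p q) z - ∑ j, meromorphicOrderAt (linForm (a j) p q) z := by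
    intro z hz
    have e : G = wronskian p q / fun z => ∏ j, linForm (a j) p q z := by
      ext z; simp [hG, div_eq_mul_inv]
    rw [e, meromorphicOrderAt_div (h.analyticOnNhd_wronskian z hz).meromorphicAt
      (hPa z hz).meromorphicAt, meromorphicOrderAt_fun_prod fun j _ => (hLa j z hz).meromorphicAt]
  have hLtop : ∀ j, ∀ z ∈ Metric.ball (0 : ℂ) s, meromorphicOrderAt (linForm (a j) p q) z ≠ ⊤ :=
    fun j z hz => (h.linForm_pair (ha j)).order_left_ne_top (hWj j) hz
  have hWtop : ∀ z ∈ Metric.ball (0 : ℂ) s, meromorphicOrderAt (wronskian p q) z ≠ ⊤ :=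
    fun z hz => h.order_wronskian_ne_top hW hz
  have hzero : ∀ j, ∀ z ∈ Metric.ball (0 : ℂ) s, linForm (a j) p q z ≠ 0 →
      meromorphicOrderAt (linForm (a j) p q) z = 0 := fun j z hz h0 =>
    meromorphicOrderAt_eq_zero_of_ne (hLa j z hz) h0
  set Z : Fin m → Finset ℂ := fun j =>
    ((h.linForm_pair (ha j)).finite_zeros_left (hWj j) hs).toFinset with hZ
  have hmemZ : ∀ j z, z ∈ Z j ↔ z ∈ Metric.closedBall (0 : ℂ) r ∧ linForm (a j) p q z = 0 := by
    intro j z; simp [hZ]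
  -- The forms are pairwise independent and `p`, `q` have no common zero, so at most one form
  -- vanishes at any point. The sum over poles therefore splits over the target points.
  have hdisj : ∀ i ∈ Finset.univ, ∀ j ∈ Finset.univ, i ≠ j → Disjoint (Z i) (Z j) := by
    intro i _ j _ hij
    refine Finset.disjoint_left.2 fun z hi hj => ?_
    rw [hmemZ] at hi hj
    exact h.linForm_ne_zero_of_ne (hsub hi.1) (hind i j hij) hi.2 hj.2
  set S : Finset ℂ := Finset.univ.biUnion Z with hS
  have hnot : ∀ z ∈ Metric.closedBall (0 : ℂ) r, z ∉ S → ∀ j, linForm (a j) p q z ≠ 0 := by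
    intro z hz hzS j h0
    exact hzS (Finset.mem_biUnion.2 ⟨j, Finset.mem_univ _, (hmemZ j z).2 ⟨hz, h0⟩⟩)
  have hGtop : ∀ u ∈ Metric.closedBall (0 : ℂ) r, meromorphicOrderAt G u ≠ ⊤ := by
    intro u hu
    choose n hn using fun j => WithTop.ne_top_iff_exists.1 (hLtop j u (hsub hu))
    obtain ⟨k, hk⟩ := WithTop.ne_top_iff_exists.1 (hWtop u (hsub hu))
    rw [hord u (hsub hu), ← hk]
    simp only [← hn]
    have : ((k : WithTop ℤ) - ∑ j, (n j : WithTop ℤ)) = ((k - ∑ j, n j : ℤ) : WithTop ℤ) := by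
      push_cast; rfl
    rw [this]
    exact WithTop.coe_ne_top
  have jensen := circleAverage_log_norm_ge hr₁ hr (fun z hz => hGm z (hsub hz)) hGtop S
    (by
      intro u hu huS
      obtain ⟨j, _, hj⟩ := Finset.mem_biUnion.1 huS
      have hj0 := ((hmemZ j u).1 hj).2
      have hsum : ∑ i, meromorphicOrderAt (linForm (a i) p q) u =
          meromorphicOrderAt (linForm (a j) p q) u :=
        Finset.sum_eq_single j (fun i _ hij => hzero i u (hsub hu)
          (h.linForm_ne_zero_of_ne (hsub hu) (hind j i hij.symm) hj0)) (by simp)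
      -- Computed in the basis adapted to the `j`-th form, the Wronskian vanishes to at least the
      -- order of that form minus one. The pole of the quotient is at most simple, which is why
      -- points are counted without multiplicity.
      have hge := (h.linForm_pair (ha j)).order_wronskian_ge (hWj j) (hsub hu) hj0
      have hcongr : meromorphicOrderAt (wronskian (linForm (a j) p q) (coForm (a j) p q)) u =
          meromorphicOrderAt (wronskian p q) u := by
        refine meromorphicOrderAt_congr ?_
        filter_upwards [nhdsWithin_le_nhds (Metric.isOpen_ball.mem_nhds (hsub hu))] with x hx
        exact h.wronskian_linForm (ha j) hx
      rw [hcongr] at hge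
      rw [hord u (hsub hu), hsum]
      obtain ⟨n, hn⟩ := WithTop.ne_top_iff_exists.1 (hLtop j u (hsub hu))
      obtain ⟨k, hk⟩ := WithTop.ne_top_iff_exists.1 (hWtop u (hsub hu))
      rw [← hn, ← hk] at hge ⊢
      have h2 : n + (-1) ≤ k := by exact_mod_cast hge
      exact_mod_cast (by omega : (-1 : ℤ) ≤ k - n))
    (by
      intro u hu huS
      have h0 := hnot u hu huS
      rw [hord u (hsub hu), Finset.sum_eq_zero fun j _ => hzero j u (hsub hu) (h0 j)]
      simpa using (h.analyticOnNhd_wronskian u (hsub hu)).meromorphicOrderAt_nonneg)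
  have hcount : ∑ u ∈ S, (∫ t in r₁..r, (if ‖u‖ < t then (1 : ℝ) else 0) / t) =
      ∑ j, (∫ t in r₁..r,
        (({z | z ∈ Metric.ball (0 : ℂ) t ∧ linForm (a j) p q z = 0}.ncard : ℝ) / t)) := by
    rw [hS, Finset.sum_biUnion fun i hi j hj hij => hdisj i hi j hj hij]
    refine Finset.sum_congr rfl fun j _ => ?_
    rw [← intervalIntegral.integral_finsetSum fun u _ => intervalIntegrable_step_div hr₁ hr u]
    rw [intervalIntegral.integral_of_le hr, intervalIntegral.integral_of_le hr]
    refine setIntegral_congr_fun measurableSet_Ioc fun t ht => ?_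
    rw [← Finset.sum_div, ← Finset.sum_filter, Finset.sum_const, nsmul_eq_mul, mul_one,
      ← Set.ncard_coe_finset]
    congr 3
    ext z
    simp only [Finset.coe_filter, mem_ofPred_eq, hmemZ, mem_closedBall_zero_iff, mem_ball_zero_iff]
    constructor
    · rintro ⟨⟨_, h1⟩, h2⟩; exact ⟨h2, h1⟩
    · rintro ⟨h1, h2⟩; exact ⟨⟨h1.le.trans ht.2, h2⟩, h1⟩
  have hu : ContinuousOn (fun z => Real.log (normSum p q z) / 2) (Metric.ball 0 s) :=
    (h.continuousOn_normSum.log fun z hz => (h.normSum_pos hz).ne').div_const 2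
  have hsplit : ∀ ρ, ρ = r₁ ∨ ρ = r → circleAverage (logSingular a p q) 0 ρ =
      circleAverage (fun z => Real.log ‖G z‖) 0 ρ +
        ((m : ℝ) - 2) * circleAverage (fun z => Real.log (normSum p q z) / 2) 0 ρ := by
    intro ρ hρ
    have hρ0 : 0 < ρ := by rcases hρ with rfl | rfl <;> linarith
    have hρs : ρ < s := by rcases hρ with rfl | rfl <;> linarith
    have hsp : Metric.sphere (0 : ℂ) |ρ| ⊆ Metric.ball 0 s := by
      intro z hz
      rw [mem_sphere_zero_iff_norm, abs_of_pos hρ0] at hz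
      rwa [mem_ball_zero_iff, hz]
    have e : EqOn (logSingular a p q) (fun z => Real.log ‖G z‖ +
        ((m : ℝ) - 2) * (Real.log (normSum p q z) / 2)) (Metric.sphere 0 |ρ|) := by
      intro z hz
      have := hgood ρ hρ z (by rwa [abs_of_pos hρ0] at hz)
      exact h.logSingular_eq ha (hsp hz) this.1 this.2
    have e2 := Real.circleAverage_fun_smul (a := (m : ℝ) - 2) (c := (0 : ℂ)) (R := ρ)
      (f := fun z => Real.log (normSum p q z) / 2)
    simp only [smul_eq_mul] at e2
    rw [Real.circleAverage_congr_sphere e, Real.circleAverage_fun_add, e2]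
    · exact MeromorphicOn.circleIntegrable_log_norm fun z hz => hGm z (hsp hz)
    · exact circleIntegrable_of_continuousOn_ball (continuousOn_const.mul hu) hρ0.le hρs
  rw [hsplit r₁ (Or.inl rfl), hsplit r (Or.inr rfl), ← hcount]
  linarith

end IsHoloPair

end HoloNevanlinna

namespace HoloNevanlinna

open Real (circleAverage)

/-! ### Estimate of the proximity term -/

theorem circleAverage_const_add_mul {f : ℂ → ℝ} {ρ : ℝ} (hf : CircleIntegrable f 0 ρ) (a b : ℝ) :
    circleAverage (fun z => a + b * f z) 0 ρ = a + b * circleAverage f 0 ρ := by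
  have e := Real.circleAverage_fun_smul (a := b) (c := (0 : ℂ)) (R := ρ) (f := f)
  simp only [smul_eq_mul] at e
  rw [Real.circleAverage_fun_add (f₂ := fun z => b * f z) (circleIntegrable_const a 0 ρ)
    (hf.const_smul (a := b)), Real.circleAverage_const, e]

theorem circleAverage_pos {f : ℂ → ℝ} {ρ : ℝ} (hρ : 0 ≤ ρ) (hf : ContinuousOn f (Metric.sphere 0 ρ))
    (h0 : ∀ z ∈ Metric.sphere (0 : ℂ) ρ, 0 < f z) : 0 < circleAverage f 0 ρ := by
  obtain ⟨w, hw, hmin⟩ := (isCompact_sphere (0 : ℂ) ρ).exists_isMinOn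
    (NormedSpace.sphere_nonempty.2 hρ) hf
  refine (h0 w hw).trans_le ?_
  rw [← Real.circleAverage_const (f w) 0 ρ]
  refine Real.circleAverage_mono (circleIntegrable_const _ _ _) (hf.circleIntegrable hρ) fun z hz => ?_
  rw [abs_of_nonneg hρ] at hz
  exact hmin hz

/-- Concavity of the logarithm. -/
theorem circleAverage_log_le {f : ℂ → ℝ} {ρ : ℝ} (hρ : 0 ≤ ρ)
    (hf : ContinuousOn f (Metric.sphere 0 ρ)) (h0 : ∀ z ∈ Metric.sphere (0 : ℂ) ρ, 0 < f z) :
    circleAverage (fun z => Real.log (f z)) 0 ρ ≤ Real.log (circleAverage f 0 ρ) := by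
  have hA := circleAverage_pos hρ hf h0
  set A := circleAverage f 0 ρ with hAdef
  -- The logarithm lies below its tangent line at the mean `A`.
  have h1 : circleAverage (fun z => Real.log (f z)) 0 ρ ≤
      circleAverage (fun z => (Real.log A - 1) + A⁻¹ * f z) 0 ρ := by
    refine Real.circleAverage_mono ((hf.log fun z hz => (h0 z hz).ne').circleIntegrable hρ)
      ((continuousOn_const.add (continuousOn_const.mul hf)).circleIntegrable hρ) fun z hz => ?_
    rw [abs_of_nonneg hρ] at hz
    have hz0 := h0 z hz
    have h2 := Real.log_le_sub_one_of_pos (div_pos hz0 hA)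
    rw [Real.log_div hz0.ne' hA.ne', div_eq_inv_mul] at h2
    linarith
  rw [circleAverage_const_add_mul (hf.circleIntegrable hρ), ← hAdef, inv_mul_cancel₀ hA.ne'] at h1
  linarith

variable {m : ℕ} {a : Fin m → ℂ × ℂ}

/-- A lower bound for the larger of two chordal distances. The `8` is the `4` of
`normSum_le_of_det`, doubled when the smaller distance is replaced by the larger. The reciprocal of
`1` plus a sum is below every term and never exceeds `1`, even if there are no pairs. -/
theorem exists_separation (hind : ∀ i j, i ≠ j → (a i).1 * (a j).2 - (a i).2 * (a j).1 ≠ 0) :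
    ∃ d : ℝ, 0 < d ∧ d ≤ 1 ∧ ∀ i j, i ≠ j →
      d ≤ ‖(a i).1 * (a j).2 - (a i).2 * (a j).1‖ ^ 2 / 8 := by
  classical
  set g : Fin m × Fin m → ℝ := fun x =>
    8 / ‖(a x.1).1 * (a x.2).2 - (a x.1).2 * (a x.2).1‖ ^ 2 with hg
  have hg0 : ∀ x, 0 ≤ g x := fun x => by positivity
  have hs : 0 ≤ ∑ x, g x := Finset.sum_nonneg fun x _ => hg0 x
  refine ⟨(1 + ∑ x, g x)⁻¹, by positivity, inv_le_one_of_one_le₀ (by linarith), fun i j hij => ?_⟩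
  have h1 : g (i, j) ≤ 1 + ∑ x, g x :=
    (Finset.single_le_sum (fun x _ => hg0 x) (Finset.mem_univ (i, j))).trans (by linarith)
  have hpos : 0 < ‖(a i).1 * (a j).2 - (a i).2 * (a j).1‖ ^ 2 :=
    pow_pos (norm_pos_iff.2 (hind i j hij)) 2
  have h2 : 0 < g (i, j) := div_pos (by norm_num) hpos
  calc (1 + ∑ x, g x)⁻¹ ≤ (g (i, j))⁻¹ := inv_anti₀ h2 h1
    _ = _ := by simp only [hg, inv_div]

/-- Cramer's rule: the determinant times `p`, and times `q`, is a combination of the two forms with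
coefficients of modulus at most one. -/
theorem normSum_le_of_det {c c' : ℂ × ℂ} (hc : ‖c.1‖ ^ 2 + ‖c.2‖ ^ 2 = 1)
    (hc' : ‖c'.1‖ ^ 2 + ‖c'.2‖ ^ 2 = 1) (p q : ℂ → ℂ) (z : ℂ) :
    ‖c.1 * c'.2 - c.2 * c'.1‖ ^ 2 * normSum p q z ≤
      4 * (‖linForm c p q z‖ ^ 2 + ‖linForm c' p q z‖ ^ 2) := by
  have b : ∀ {x y : ℝ}, 0 ≤ x → x ^ 2 + y ^ 2 = 1 → x ≤ 1 := fun hx h => by nlinarith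
  have b1 := b (norm_nonneg _) hc
  have b2 := b (norm_nonneg _) ((add_comm _ _).trans hc)
  have b1' := b (norm_nonneg _) hc'
  have b2' := b (norm_nonneg _) ((add_comm _ _).trans hc')
  set ℓ := linForm c p q z with hℓ
  set ℓ' := linForm c' p q z with hℓ'
  have key : ∀ {x y w : ℂ}, ‖x‖ ≤ 1 → ‖y‖ ≤ 1 → w = x * ℓ - y * ℓ' →
      ‖w‖ ^ 2 ≤ 2 * (‖ℓ‖ ^ 2 + ‖ℓ'‖ ^ 2) := by
    intro x y w hx hy hw
    have h1 : ‖w‖ ≤ ‖ℓ‖ + ‖ℓ'‖ := by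
      rw [hw]
      refine (norm_sub_le _ _).trans (add_le_add ?_ ?_) <;> rw [norm_mul]
      · exact mul_le_of_le_one_left (norm_nonneg _) hx
      · exact mul_le_of_le_one_left (norm_nonneg _) hy
    nlinarith [norm_nonneg w, sq_nonneg (‖ℓ‖ - ‖ℓ'‖), norm_nonneg ℓ, norm_nonneg ℓ']
  have h1 := key (x := c'.2) (y := c.2) (w := (c.1 * c'.2 - c.2 * c'.1) * p z) b2' b2
    (by simp only [hℓ, hℓ', linForm]; ring)
  have h2 := key (x := -c'.1) (y := -c.1) (w := (c.1 * c'.2 - c.2 * c'.1) * q z)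
    (by rwa [norm_neg]) (by rwa [norm_neg]) (by simp only [hℓ, hℓ', linForm]; ring)
  rw [norm_mul, mul_pow] at h1 h2
  unfold normSum
  linarith

/-- The sum of the singular densities. -/
def singularDensity (a : Fin m → ℂ × ℂ) (p q : ℂ → ℂ) (z : ℂ) : ℝ :=
  ∑ j, sphDensity p q z * logWeight (chordSq (linForm (a j) p q) (coForm (a j) p q) z)

/-- The logarithmic weight attached to one of the forms. -/
def logProximity (c : ℂ × ℂ) (p q : ℂ → ℂ) (z : ℂ) : ℝ :=
  2 - Real.log (chordSq (linForm c p q) (coForm c p q) z)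

theorem one_le_logProximity (c : ℂ × ℂ) (p q : ℂ → ℂ) (z : ℂ) : 1 ≤ logProximity c p q z := by
  have := Real.log_nonpos (chordSq_nonneg (linForm c p q) (coForm c p q) z)
    (chordSq_le_one (linForm c p q) (coForm c p q) z)
  unfold logProximity; linarith

namespace IsHoloPair

variable {s : ℝ} {p q : ℂ → ℂ} {z : ℂ}

theorem chordSq_pos (h : IsHoloPair s p q) {c : ℂ × ℂ} (hc : ‖c.1‖ ^ 2 + ‖c.2‖ ^ 2 = 1)
    (hz : z ∈ Metric.ball (0 : ℂ) s) (h0 : linForm c p q z ≠ 0) :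
    0 < chordSq (linForm c p q) (coForm c p q) z :=
  div_pos (pow_pos (norm_pos_iff.2 h0) 2) ((h.linForm_pair hc).normSum_pos hz)

theorem sphDensity_pos (h : IsHoloPair s p q) (hz : z ∈ Metric.ball (0 : ℂ) s)
    (h0 : wronskian p q z ≠ 0) : 0 < sphDensity p q z :=
  div_pos (pow_pos (norm_pos_iff.2 h0) 2) (pow_pos (h.normSum_pos hz) 2)

/-- Only the smallest `v i` can be close to zero; all others are at least `d` and cost a constant.
For that index, `(log σ - log v)/2` is exactly half the logarithm of `σ` times the weight, plus
`log(2 - log v)`. Both are then increased to the sums over all indices, which no longer depend on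
the choice of `i`. -/
theorem logSingular_le (h : IsHoloPair s p q) (hm : 0 < m)
    (ha : ∀ j, ‖(a j).1‖ ^ 2 + ‖(a j).2‖ ^ 2 = 1) {d : ℝ} (hd0 : 0 < d) (hd1 : d ≤ 1)
    (hd : ∀ i j, i ≠ j → d ≤ ‖(a i).1 * (a j).2 - (a i).2 * (a j).1‖ ^ 2 / 8)
    (hz : z ∈ Metric.ball (0 : ℂ) s) (hWz : wronskian p q z ≠ 0) (hLz : ∀ j, linForm (a j) p q z ≠ 0) :
    logSingular a p q z ≤ Real.log (singularDensity a p q z) / 2 +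
      Real.log (∑ j, logProximity (a j) p q z) + (m : ℝ) / 2 * (-Real.log d) := by
  classical
  have : Nonempty (Fin m) := ⟨⟨0, hm⟩⟩
  set v : Fin m → ℝ := fun j => chordSq (linForm (a j) p q) (coForm (a j) p q) z with hv
  have hv0 : ∀ j, 0 < v j := fun j => h.chordSq_pos (ha j) hz (hLz j)
  have hσ := h.sphDensity_pos hz hWz
  have hN := h.normSum_pos hz
  obtain ⟨i, hi⟩ := Finite.exists_min v
  have hsep : ∀ j, j ≠ i → d ≤ v j := by
    intro j hj
    have e : ∀ k, ‖linForm (a k) p q z‖ ^ 2 = v k * normSum p q z := fun k => by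
      simp only [hv, chordSq, normSum_linForm (ha k)]; field_simp
    have h1 := normSum_le_of_det (ha i) (ha j) p q z
    rw [e i, e j] at h1
    have h2 : ‖(a i).1 * (a j).2 - (a i).2 * (a j).1‖ ^ 2 ≤ 4 * (v i + v j) := by
      refine le_of_mul_le_mul_right ?_ hN
      linarith
    have := hd i j hj.symm
    linarith [hi j]
  have hd' : 0 ≤ -Real.log d := by linarith [Real.log_nonpos hd0.le hd1]
  -- There are `m - 1` remaining indices; `m` may be written since `log d ≤ 0`.
  have hlow : Real.log (v i) + (m : ℝ) * Real.log d ≤ ∑ j, Real.log (v j) := by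
    rw [← Finset.add_sum_erase _ _ (Finset.mem_univ i)]
    have h1 : ∑ j ∈ Finset.univ.erase i, Real.log d ≤ ∑ j ∈ Finset.univ.erase i, Real.log (v j) :=
      Finset.sum_le_sum fun j hj => Real.log_le_log hd0 (hsep j (Finset.ne_of_mem_erase hj))
    rw [Finset.sum_const, Finset.card_erase_of_mem (Finset.mem_univ i), Finset.card_univ,
      Fintype.card_fin, nsmul_eq_mul, Nat.cast_sub hm] at h1
    push_cast at h1
    nlinarith
  have hLi : 1 ≤ 2 - Real.log (v i) := one_le_logProximity (a i) p q z
  have hsum : 2 - Real.log (v i) ≤ ∑ j, logProximity (a j) p q z :=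
    Finset.single_le_sum (f := fun j => logProximity (a j) p q z)
      (fun j _ => zero_le_one.trans (one_le_logProximity (a j) p q z)) (Finset.mem_univ i)
  have hw : 0 < logWeight (v i) := by
    have := hv0 i
    unfold logWeight; positivity
  have hK : sphDensity p q z * logWeight (v i) ≤ singularDensity a p q z :=
    Finset.single_le_sum (f := fun j => sphDensity p q z * logWeight (v j))
      (fun j _ => mul_nonneg hσ.le (logWeight_nonneg (hv0 j).le)) (Finset.mem_univ i)
  have e1 : Real.log (sphDensity p q z * logWeight (v i)) =
      Real.log (sphDensity p q z) - 2 * Real.log (2 - Real.log (v i)) - Real.log (v i) := by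
    rw [Real.log_mul hσ.ne' hw.ne', logWeight, one_div, Real.log_inv,
      Real.log_mul (by positivity) (hv0 i).ne', Real.log_pow]
    push_cast; ring
  have e2 := Real.log_le_log (mul_pos hσ hw) hK
  have e3 := Real.log_le_log (by linarith) hsum
  unfold logSingular
  rw [e1] at e2
  change (Real.log (sphDensity p q z) - ∑ j, Real.log (v j)) / 2 ≤ _
  linarith

theorem continuousOn_singularDensity (h : IsHoloPair s p q)
    (ha : ∀ j, ‖(a j).1‖ ^ 2 + ‖(a j).2‖ ^ 2 = 1) {ρ : ℝ} (hρ : ρ < s)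
    (hL : ∀ z ∈ Metric.sphere (0 : ℂ) ρ, ∀ j, linForm (a j) p q z ≠ 0) :
    ContinuousOn (singularDensity a p q) (Metric.sphere 0 ρ) := by
  have hsub : Metric.sphere (0 : ℂ) ρ ⊆ Metric.ball 0 s := fun z hz => by
    rw [mem_sphere_zero_iff_norm] at hz; rwa [mem_ball_zero_iff, hz]
  refine continuousOn_finsetSum _ fun j _ => (h.continuousOn_sphDensity.mono hsub).mul ?_
  have hv := (h.linForm_pair (ha j)).continuousOn_chordSq.mono hsub
  have h0 : ∀ z ∈ Metric.sphere (0 : ℂ) ρ, chordSq (linForm (a j) p q) (coForm (a j) p q) z ≠ 0 :=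
    fun z hz => (h.chordSq_pos (ha j) (hsub hz) (hL z hz j)).ne'
  refine continuousOn_const.div (((continuousOn_const.sub (hv.log h0)).pow 2).mul hv) fun z hz => ?_
  have := one_le_logProximity (a j) p q z
  refine mul_ne_zero (pow_ne_zero _ ?_) (h0 z hz)
  unfold logProximity at this
  exact (by linarith : 2 - Real.log (chordSq (linForm (a j) p q) (coForm (a j) p q) z) ≠ 0)

theorem continuousOn_logProximity (h : IsHoloPair s p q) {c : ℂ × ℂ}
    (hc : ‖c.1‖ ^ 2 + ‖c.2‖ ^ 2 = 1) {ρ : ℝ} (hρ : ρ < s)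
    (hL : ∀ z ∈ Metric.sphere (0 : ℂ) ρ, linForm c p q z ≠ 0) :
    ContinuousOn (logProximity c p q) (Metric.sphere 0 ρ) := by
  have hsub : Metric.sphere (0 : ℂ) ρ ⊆ Metric.ball 0 s := fun z hz => by
    rw [mem_sphere_zero_iff_norm] at hz; rwa [mem_ball_zero_iff, hz]
  exact continuousOn_const.sub (((h.linForm_pair hc).continuousOn_chordSq.mono hsub).log
    fun z hz => (h.chordSq_pos hc (hsub hz) (hL z hz)).ne')

/-- The first main theorem, as an inequality. -/
theorem circleAverage_logProximity_le (h : IsHoloPair s p q)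
    (hW : ∃ z ∈ Metric.ball (0 : ℂ) s, wronskian p q z ≠ 0) {c : ℂ × ℂ}
    (hc : ‖c.1‖ ^ 2 + ‖c.2‖ ^ 2 = 1) {r₁ r : ℝ} (hr₁ : 0 < r₁) (hr : r₁ ≤ r) (hs : r < s)
    (hgood : ∀ ρ, ρ = r₁ ∨ ρ = r → ∀ z ∈ Metric.sphere (0 : ℂ) ρ, linForm c p q z ≠ 0) :
    circleAverage (logProximity c p q) 0 r ≤ circleAverage (logProximity c p q) 0 r₁ +
      2 * (circleAverage (fun z => Real.log (normSum p q z) / 2) 0 r -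
        circleAverage (fun z => Real.log (normSum p q z) / 2) 0 r₁) := by
  have hsub : Metric.closedBall (0 : ℂ) r ⊆ Metric.ball 0 s := Metric.closedBall_subset_ball hs
  have hL := (h.linForm_pair hc)
  have hW' : ∃ z ∈ Metric.ball (0 : ℂ) s, wronskian (linForm c p q) (coForm c p q) z ≠ 0 := by
    obtain ⟨z, hz, hz0⟩ := hW
    exact ⟨z, hz, by rwa [h.wronskian_linForm hc hz]⟩
  -- Jensen with an empty set of poles: the mean of `log ‖linForm c p q‖` does not decrease, the
  -- zeros being discarded.
  have jensen := circleAverage_log_norm_ge hr₁ hr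
    (fun z hz => (hL.analyticOnNhd_left z (hsub hz)).meromorphicAt)
    (fun z hz => hL.order_left_ne_top hW' (hsub hz)) ∅ (by simp)
    (fun z hz _ => (hL.analyticOnNhd_left z (hsub hz)).meromorphicOrderAt_nonneg)
  have hu : ContinuousOn (fun z => Real.log (normSum p q z) / 2) (Metric.ball 0 s) :=
    (h.continuousOn_normSum.log fun z hz => (h.normSum_pos hz).ne').div_const 2
  have hsplit : ∀ ρ, ρ = r₁ ∨ ρ = r → circleAverage (logProximity c p q) 0 ρ =
      2 - 2 * circleAverage (fun z => Real.log ‖linForm c p q z‖) 0 ρ +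
        2 * circleAverage (fun z => Real.log (normSum p q z) / 2) 0 ρ := by
    intro ρ hρ
    have hρ0 : 0 < ρ := by rcases hρ with rfl | rfl <;> linarith
    have hρs : ρ < s := by rcases hρ with rfl | rfl <;> linarith
    have hsp : Metric.sphere (0 : ℂ) |ρ| ⊆ Metric.ball 0 s := by
      intro z hz
      rw [mem_sphere_zero_iff_norm, abs_of_pos hρ0] at hz
      rwa [mem_ball_zero_iff, hz]
    have i1 : CircleIntegrable (fun z => Real.log ‖linForm c p q z‖) 0 ρ :=
      MeromorphicOn.circleIntegrable_log_norm fun z hz => (hL.analyticOnNhd_left z (hsp hz)).meromorphicAt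
    have i2 := circleIntegrable_of_continuousOn_ball hu hρ0.le hρs
    have e : EqOn (logProximity c p q) (fun z => (2 + (-2) * Real.log ‖linForm c p q z‖) +
        (0 + 2 * (Real.log (normSum p q z) / 2))) (Metric.sphere 0 |ρ|) := by
      intro z hz
      have h0 := hgood ρ hρ z (by rwa [abs_of_pos hρ0] at hz)
      simp only [logProximity, chordSq, normSum_linForm hc]
      rw [Real.log_div (pow_ne_zero _ (norm_ne_zero_iff.2 h0)) (h.normSum_pos (hsp hz)).ne',
        Real.log_pow]
      push_cast; ring
    rw [Real.circleAverage_congr_sphere e, Real.circleAverage_fun_add, circleAverage_const_add_mul i1,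
      circleAverage_const_add_mul i2]
    · ring
    · exact (circleIntegrable_const _ _ _).add (i1.const_smul (a := (-2 : ℝ)))
    · exact (circleIntegrable_const _ _ _).add (i2.const_smul (a := (2 : ℝ)))
  rw [hsplit r₁ (Or.inl rfl), hsplit r (Or.inr rfl)]
  simp only [Finset.sum_empty, sub_zero] at jensen
  linarith

/-- The mean of `logSingular` on the outer circle is squeezed: Jensen bounds it below by the defect,
while `logSingular_le` and concavity of the logarithm bound it above. The first main theorem
replaces the outer proximity terms by the inner ones and the characteristic function. -/
theorem second_main_inequality (h : IsHoloPair s p q) (hm : 0 < m)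
    (hW : ∃ z ∈ Metric.ball (0 : ℂ) s, wronskian p q z ≠ 0)
    (ha : ∀ j, ‖(a j).1‖ ^ 2 + ‖(a j).2‖ ^ 2 = 1)
    (hind : ∀ i j, i ≠ j → (a i).1 * (a j).2 - (a i).2 * (a j).1 ≠ 0)
    {d : ℝ} (hd0 : 0 < d) (hd1 : d ≤ 1)
    (hd : ∀ i j, i ≠ j → d ≤ ‖(a i).1 * (a j).2 - (a i).2 * (a j).1‖ ^ 2 / 8)
    {r₁ r : ℝ} (hr₁ : 0 < r₁) (hr : r₁ ≤ r) (hs : r < s)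
    (hgood : ∀ ρ, ρ = r₁ ∨ ρ = r → ∀ z ∈ Metric.sphere (0 : ℂ) ρ,
      wronskian p q z ≠ 0 ∧ ∀ j, linForm (a j) p q z ≠ 0) :
    ((m : ℝ) - 2) * (circleAverage (fun z => Real.log (normSum p q z) / 2) 0 r -
        circleAverage (fun z => Real.log (normSum p q z) / 2) 0 r₁) ≤
      ∑ j, (∫ t in r₁..r,
        (({z | z ∈ Metric.ball (0 : ℂ) t ∧ linForm (a j) p q z = 0}.ncard : ℝ) / t)) +
      ((m : ℝ) / 2 * (-Real.log d) - circleAverage (logSingular a p q) 0 r₁) +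
      Real.log (circleAverage (singularDensity a p q) 0 r) / 2 +
      Real.log (∑ j, circleAverage (logProximity (a j) p q) 0 r₁ + 2 * m *
        (circleAverage (fun z => Real.log (normSum p q z) / 2) 0 r -
        circleAverage (fun z => Real.log (normSum p q z) / 2) 0 r₁)) := by
  classical
  have hr0 : 0 ≤ r := hr₁.le.trans hr
  have hgr := hgood r (Or.inr rfl)
  have hsub : Metric.sphere (0 : ℂ) r ⊆ Metric.ball 0 s := fun z hz => by
    rw [mem_sphere_zero_iff_norm] at hz; rwa [mem_ball_zero_iff, hz]
  have hmain := h.circleAverage_logSingular_ge hW ha hind hr₁ hr hs hgood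
  have hKc := h.continuousOn_singularDensity ha hs fun z hz => (hgr z hz).2
  have hK0 : ∀ z ∈ Metric.sphere (0 : ℂ) r, 0 < singularDensity a p q z := by
    intro z hz
    have hne : (Finset.univ : Finset (Fin m)).Nonempty := ⟨⟨0, hm⟩, Finset.mem_univ _⟩
    refine Finset.sum_pos (fun j _ => ?_) hne
    have h1 := h.sphDensity_pos (hsub hz) (hgr z hz).1
    have h2 := h.chordSq_pos (ha j) (hsub hz) ((hgr z hz).2 j)
    have h3 := one_le_logProximity (a j) p q z
    unfold logProximity at h3
    refine mul_pos h1 (div_pos one_pos (mul_pos (pow_pos (by linarith) 2) h2))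
  have hLc : ∀ j, ContinuousOn (logProximity (a j) p q) (Metric.sphere 0 r) := fun j =>
    h.continuousOn_logProximity (ha j) hs fun z hz => (hgr z hz).2 j
  have hSc : ContinuousOn (fun z => ∑ j, logProximity (a j) p q z) (Metric.sphere 0 r) :=
    continuousOn_finsetSum _ fun j _ => hLc j
  have hS0 : ∀ z ∈ Metric.sphere (0 : ℂ) r, 0 < ∑ j, logProximity (a j) p q z := fun z _ =>
    Finset.sum_pos (fun j _ => zero_lt_one.trans_le (one_le_logProximity (a j) p q z))
      ⟨⟨0, hm⟩, Finset.mem_univ _⟩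
  have i1 := (hKc.log fun z hz => (hK0 z hz).ne').circleIntegrable hr0
  have i2 := (hSc.log fun z hz => (hS0 z hz).ne').circleIntegrable hr0
  have i3 : CircleIntegrable (logSingular a p q) 0 r := by
    refine ContinuousOn.circleIntegrable hr0 (ContinuousOn.div_const (ContinuousOn.sub ?_ ?_) _)
    · exact (h.continuousOn_sphDensity.mono hsub).log fun z hz =>
        (h.sphDensity_pos (hsub hz) (hgr z hz).1).ne'
    · exact continuousOn_finsetSum _ fun j _ =>
        ((h.linForm_pair (ha j)).continuousOn_chordSq.mono hsub).log fun z hz =>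
          (h.chordSq_pos (ha j) (hsub hz) ((hgr z hz).2 j)).ne'
  have j1 : CircleIntegrable (fun z => (0 : ℝ) + 1 / 2 * Real.log (singularDensity a p q z)) 0 r :=
    (circleIntegrable_const _ _ _).add (i1.const_smul (a := (1 / 2 : ℝ)))
  have j2 : CircleIntegrable (fun z => (m : ℝ) / 2 * (-Real.log d) +
      1 * Real.log (∑ j, logProximity (a j) p q z)) 0 r :=
    (circleIntegrable_const _ _ _).add (i2.const_smul (a := (1 : ℝ)))
  have hup : circleAverage (logSingular a p q) 0 r ≤
      (0 + 1 / 2 * circleAverage (fun z => Real.log (singularDensity a p q z)) 0 r) +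
      ((m : ℝ) / 2 * (-Real.log d) +
        1 * circleAverage (fun z => Real.log (∑ j, logProximity (a j) p q z)) 0 r) := by
    rw [← circleAverage_const_add_mul i1, ← circleAverage_const_add_mul i2,
      ← Real.circleAverage_fun_add j1 j2]
    refine Real.circleAverage_mono i3 (j1.add j2) fun z hz => ?_
    rw [abs_of_nonneg hr0] at hz
    have := h.logSingular_le hm ha hd0 hd1 hd (hsub hz) (hgr z hz).1 (hgr z hz).2
    linarith
  have hup1 := circleAverage_log_le hr0 hKc hK0
  have hup2 := circleAverage_log_le hr0 hSc hS0
  have hprox : circleAverage (fun z => ∑ j, logProximity (a j) p q z) 0 r ≤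
      ∑ j, circleAverage (logProximity (a j) p q) 0 r₁ + 2 * m *
        (circleAverage (fun z => Real.log (normSum p q z) / 2) 0 r -
        circleAverage (fun z => Real.log (normSum p q z) / 2) 0 r₁) := by
    rw [Real.circleAverage_fun_sum fun j _ => (hLc j).circleIntegrable hr0]
    refine (Finset.sum_le_sum fun j _ => h.circleAverage_logProximity_le hW (ha j) hr₁ hr hs
      fun ρ hρ z hz => (hgood ρ hρ z hz).2 j).trans (le_of_eq ?_)
    rw [Finset.sum_add_distrib, Finset.sum_const, Finset.card_univ, Fintype.card_fin, nsmul_eq_mul]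
    ring
  have hup3 := Real.log_le_log (circleAverage_pos hr0 hSc hS0) hprox
  linarith

end IsHoloPair

end HoloNevanlinna

namespace HoloNevanlinna

open Real (circleAverage)

/-! ### The second main theorem on a disc -/

variable {m : ℕ} {a : Fin m → ℂ × ℂ}

/-- The functions `σ` and `v j` are the spherical density and the chordal distances of a holomorphic
curve, which on each smaller disc is given by a pair of holomorphic functions. -/
structure IsCurveData (R : EReal) (a : Fin m → ℂ × ℂ) (σ : ℂ → ℝ) (v : Fin m → ℂ → ℝ) : Prop where
  unit : ∀ j, ‖(a j).1‖ ^ 2 + ‖(a j).2‖ ^ 2 = 1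
  independent : ∀ i j, i ≠ j → (a i).1 * (a j).2 - (a i).2 * (a j).1 ≠ 0
  measurable_density : Measurable σ
  measurable_chord : ∀ j, Measurable (v j)
  exists_pair : ∀ s : ℝ, (s : EReal) < R → ∃ p q, IsHoloPair s p q ∧ ∀ z ∈ Metric.ball (0 : ℂ) s,
    σ z = sphDensity p q z ∧ ∀ j, v j z = chordSq (linForm (a j) p q) (coForm (a j) p q) z
  nonconstant : ∃ z₀ : ℂ, ((‖z₀‖ : ℝ) : EReal) < R ∧ σ z₀ ≠ 0

/-- The area of the image of the disc of radius `t`, with respect to the Fubini-Study form. -/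
def sphArea (σ : ℂ → ℝ) (t : ℝ) : ℝ :=
  (∫⁻ z in Metric.ball 0 t, ENNReal.ofReal (σ z / Real.pi)).toReal

theorem EReal.exists_real_gt {x : ℝ} {R : EReal} (h : (x : EReal) < R) :
    ∃ y : ℝ, x < y ∧ (y : EReal) < R := by
  obtain ⟨y, h1, h2⟩ := EReal.lt_iff_exists_real_btwn.1 h
  exact ⟨y, by exact_mod_cast h1, h2⟩

theorem zero_eq_chordSq_iff {p q : ℂ → ℂ} {s : ℝ} (h : IsHoloPair s p q) {c : ℂ × ℂ}
    (hc : ‖c.1‖ ^ 2 + ‖c.2‖ ^ 2 = 1) {z : ℂ} (hz : z ∈ Metric.ball (0 : ℂ) s) :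
    chordSq (linForm c p q) (coForm c p q) z = 0 ↔ linForm c p q z = 0 := by
  have := ((h.linForm_pair hc).normSum_pos hz).ne'
  simp [chordSq, this]

theorem zero_eq_sphDensity_iff {p q : ℂ → ℂ} {s : ℝ} (h : IsHoloPair s p q) {z : ℂ}
    (hz : z ∈ Metric.ball (0 : ℂ) s) : sphDensity p q z = 0 ↔ wronskian p q z = 0 := by
  have := (h.normSum_pos hz).ne'
  simp [sphDensity, this]

namespace IsCurveData

variable {R : EReal} {σ : ℂ → ℝ} {v : Fin m → ℂ → ℝ}

theorem sphArea_eq {s t : ℝ} {p q : ℂ → ℂ} (hp : IsHoloPair s p q)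
    (hpq : ∀ z ∈ Metric.ball (0 : ℂ) s, σ z = sphDensity p q z) (ht : 0 ≤ t) (hts : t < s) :
    sphArea σ t = discIntegral (fun z => 2 * sphDensity p q z) t := by
  rw [sphArea, setLIntegral_congr_fun Metric.isOpen_ball.measurableSet
    (g := fun z => ENNReal.ofReal (sphDensity p q z / Real.pi)), hp.lintegral_sphDensity ht hts]
  · rfl
  · intro z hz
    simp only [hpq z (Metric.ball_subset_ball hts.le hz)]

theorem intervalIntegrable_sphArea_div (h : IsCurveData R a σ v) {r₁ r : ℝ} (hr₁ : 0 < r₁)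
    (hr : r₁ ≤ r) (hR : (r : EReal) < R) :
    IntervalIntegrable (fun t => sphArea σ t / t) volume r₁ r := by
  obtain ⟨s, hrs, hsR⟩ := EReal.exists_real_gt hR
  obtain ⟨p, q, hp, hpq⟩ := h.exists_pair s hsR
  refine (intervalIntegrable_discIntegral_div (f := fun z => 2 * sphDensity p q z)
    (continuousOn_const.mul hp.continuousOn_sphDensity) hr₁ hr hrs).congr fun t ht => ?_
  rw [uIoc_of_le hr] at ht
  rw [sphArea_eq hp (fun z hz => (hpq z hz).1) (hr₁.trans ht.1).le (ht.2.trans_lt hrs)]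

theorem integral_sphArea_div {s r₁ r : ℝ} {p q : ℂ → ℂ}
    (hp : IsHoloPair s p q) (hpq : ∀ z ∈ Metric.ball (0 : ℂ) s, σ z = sphDensity p q z)
    (hr₁ : 0 < r₁) (hr : r₁ ≤ r) (hs : r < s) :
    ∫ t in r₁..r, sphArea σ t / t = circleAverage (fun z => Real.log (normSum p q z) / 2) 0 r -
        circleAverage (fun z => Real.log (normSum p q z) / 2) 0 r₁ := by
  rw [hp.circleAverage_log_normSum_sub hr₁ hr hs]
  refine intervalIntegral.integral_congr fun t ht => ?_
  rw [uIcc_of_le hr] at ht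
  rw [sphArea_eq hp hpq (hr₁.trans_le ht.1).le (ht.2.trans_lt hs)]
  rfl

theorem sphArea_nonneg (t : ℝ) : 0 ≤ sphArea σ t := ENNReal.toReal_nonneg

/-- The pair on a disc which contains a point where the density does not vanish. -/
theorem exists_wronskian_ne_zero {z₀ : ℂ} (h0 : σ z₀ ≠ 0) {s : ℝ}
    {p q : ℂ → ℂ} (hp : IsHoloPair s p q)
    (hpq : ∀ z ∈ Metric.ball (0 : ℂ) s, σ z = sphDensity p q z) (hs : ‖z₀‖ < s) :
    ∃ z ∈ Metric.ball (0 : ℂ) s, wronskian p q z ≠ 0 := by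
  have hz : z₀ ∈ Metric.ball (0 : ℂ) s := by simpa using hs
  refine ⟨z₀, hz, fun hw => h0 ?_⟩
  rw [hpq z₀ hz, (zero_eq_sphDensity_iff hp hz).2 hw]

theorem finite_zeros (h : IsCurveData R a σ v) {r : ℝ} (hR : (r : EReal) < R) :
    {z | z ∈ Metric.closedBall (0 : ℂ) r ∧ (σ z = 0 ∨ ∃ j, v j z = 0)}.Finite := by
  obtain ⟨z₀, hz₀, h0⟩ := h.nonconstant
  have hmax : ((max r ‖z₀‖ : ℝ) : EReal) < R := by
    rcases max_choice r ‖z₀‖ with e | e <;> rw [e] <;> assumption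
  obtain ⟨s, hrs, hsR⟩ := EReal.exists_real_gt hmax
  obtain ⟨p, q, hp, hpq⟩ := h.exists_pair s hsR
  have hr : r < s := (le_max_left _ _).trans_lt hrs
  have hsub : Metric.closedBall (0 : ℂ) r ⊆ Metric.ball 0 s := Metric.closedBall_subset_ball hr
  have hW := exists_wronskian_ne_zero h0 hp (fun z hz => (hpq z hz).1) ((le_max_right _ _).trans_lt hrs)
  have f1 := finite_zeros_of_analyticOnNhd hp.analyticOnNhd_wronskian
    (fun z hz => hp.order_wronskian_ne_top hW hz) hr
  have f2 : ∀ j, {z | z ∈ Metric.closedBall (0 : ℂ) r ∧ linForm (a j) p q z = 0}.Finite := fun j =>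
    (hp.linForm_pair (h.unit j)).finite_zeros_left (by
      obtain ⟨z, hz, hz0⟩ := hW
      exact ⟨z, hz, by rwa [hp.wronskian_linForm (h.unit j) hz]⟩) hr
  refine (f1.union (finite_iUnion f2)).subset ?_
  rintro z ⟨hz, hz0 | ⟨j, hj⟩⟩
  · left
    rw [(hpq z (hsub hz)).1] at hz0
    exact ⟨hz, (zero_eq_sphDensity_iff hp (hsub hz)).1 hz0⟩
  · right
    rw [(hpq z (hsub hz)).2 j] at hj
    exact mem_iUnion.2 ⟨j, hz, (zero_eq_chordSq_iff hp (h.unit j) (hsub hz)).1 hj⟩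

/-- The radii of the circles which contain a zero of the density or of a chordal distance. -/
def badRadii (R : EReal) (σ : ℂ → ℝ) (v : Fin m → ℂ → ℝ) : Set ℝ :=
  {ρ | (ρ : EReal) < R ∧ ∃ z ∈ Metric.sphere (0 : ℂ) ρ, σ z = 0 ∨ ∃ j, v j z = 0}

theorem countable_badRadii (h : IsCurveData R a σ v) : (badRadii R σ v).Countable := by
  -- Each bad radius is the modulus of one of the finitely many zeros in a disc of rational radius.
  have : badRadii R σ v ⊆ ⋃ x ∈ {x : ℚ | ((x : ℝ) : EReal) < R},
      (fun z : ℂ => ‖z‖) '' {z | z ∈ Metric.closedBall (0 : ℂ) x ∧ (σ z = 0 ∨ ∃ j, v j z = 0)} := by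
    rintro ρ ⟨hρ, z, hz, h0⟩
    obtain ⟨s, hs1, hs2⟩ := EReal.exists_real_gt hρ
    obtain ⟨x, hx1, hx2⟩ := exists_rat_btwn hs1
    rw [mem_sphere_zero_iff_norm] at hz
    refine mem_iUnion₂.2 ⟨x, lt_trans (by exact_mod_cast hx2) hs2, z, ⟨?_, h0⟩, hz⟩
    rw [mem_closedBall_zero_iff, hz]; exact hx1.le
  refine Countable.mono this (Countable.biUnion (to_countable _) fun x hx => ?_)
  exact ((h.finite_zeros hx).image _).countable

theorem monotoneOn_ncard (h : IsCurveData R a σ v) {r : ℝ} (hR : (r : EReal) < R) (j : Fin m) :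
    MonotoneOn (fun t => ({z | z ∈ Metric.ball (0 : ℂ) t ∧ v j z = 0}.ncard : ℝ)) (Iic r) := by
  intro x hx y hy hxy
  have hfin : {z | z ∈ Metric.ball (0 : ℂ) y ∧ v j z = 0}.Finite :=
    (h.finite_zeros hR).subset fun z hz => ⟨Metric.ball_subset_closedBall
      (Metric.ball_subset_ball hy hz.1), Or.inr ⟨j, hz.2⟩⟩
  exact Nat.cast_le.2 (Set.ncard_le_ncard (show {z | z ∈ Metric.ball (0 : ℂ) x ∧ v j z = 0} ⊆
    {z | z ∈ Metric.ball (0 : ℂ) y ∧ v j z = 0} from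
    fun z hz => ⟨Metric.ball_subset_ball hxy hz.1, hz.2⟩) hfin)

theorem intervalIntegrable_ncard_div (h : IsCurveData R a σ v) {r₁ r : ℝ} (hr₁ : 0 < r₁)
    (hr : r₁ ≤ r) (hR : (r : EReal) < R) (j : Fin m) :
    IntervalIntegrable (fun t => ({z | z ∈ Metric.ball (0 : ℂ) t ∧ v j z = 0}.ncard : ℝ) / t)
      volume r₁ r := by
  have h1 : IntervalIntegrable (fun t => ({z | z ∈ Metric.ball (0 : ℂ) t ∧ v j z = 0}.ncard : ℝ))
      volume r₁ r := by
    apply MonotoneOn.intervalIntegrable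
    rw [uIcc_of_le hr]
    exact (h.monotoneOn_ncard hR j).mono fun x hx => hx.2
  simp only [div_eq_mul_inv]
  refine h1.mul_continuousOn ?_
  rw [uIcc_of_le hr]
  exact continuousOn_id.inv₀ fun x hx => (hr₁.trans_le hx.1).ne'

/-- The sum of the singular densities. -/
def weightSum (σ : ℂ → ℝ) (v : Fin m → ℂ → ℝ) (z : ℂ) : ℝ := ∑ j, σ z * logWeight (v j z)

theorem measurable_logWeight : Measurable logWeight := by
  unfold logWeight; fun_prop

theorem measurable_weightSum (h : IsCurveData R a σ v) : Measurable (weightSum σ v) :=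
  Finset.measurable_sum _ fun j _ => h.measurable_density.mul
    (measurable_logWeight.comp (h.measurable_chord j))

/-- The area bound for the singular densities. -/
theorem lintegral_weightSum_le (h : IsCurveData R a σ v) {r₁ r : ℝ} (hr₁ : 0 < r₁) (hr : r₁ ≤ r)
    (hR : (r : EReal) < R) (hgood : r₁ ∉ badRadii R σ v) :
    ∫⁻ t in Ioo r₁ r, ENNReal.ofReal (1 / t) * ∫⁻ z in Metric.ball 0 t,
      ENNReal.ofReal (weightSum σ v z) ≤
    ENNReal.ofReal (Real.pi / 2 * (∑ j, circleAverage (fun z => 2 - Real.log (v j z)) 0 r₁ +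
      6 * m * ∫ t in r₁..r, sphArea σ t / t)) := by
  obtain ⟨s, hrs, hsR⟩ := EReal.exists_real_gt hR
  obtain ⟨p, q, hp, hpq⟩ := h.exists_pair s hsR
  have hr₁R : (r₁ : EReal) < R := lt_of_le_of_lt (by exact_mod_cast hr) hR
  rw [integral_sphArea_div hp (fun z hz => (hpq z hz).1) hr₁ hr hrs]
  set T := circleAverage (fun z => Real.log (normSum p q z) / 2) 0 r -
        circleAverage (fun z => Real.log (normSum p q z) / 2) 0 r₁ with hT
  have hsp : Metric.sphere (0 : ℂ) |r₁| ⊆ Metric.ball 0 s := fun z hz => by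
    rw [mem_sphere_zero_iff_norm, abs_of_pos hr₁] at hz
    rw [mem_ball_zero_iff, hz]; linarith
  have hbound : ∀ j, ∫⁻ t in Ioo r₁ r, ENNReal.ofReal (1 / t) * ∫⁻ z in Metric.ball 0 t,
      ENNReal.ofReal (σ z * logWeight (v j z)) ≤
      ENNReal.ofReal (Real.pi / 2 * (circleAverage (fun z => 2 - Real.log (v j z)) 0 r₁ + 6 * T)) := by
    intro j
    have hL := hp.linForm_pair (h.unit j)
    have h1 := hL.lintegral_logWeight_le hr₁ hr hrs (fun z hz h0 => hgood ⟨hr₁R, z, hz, Or.inr ⟨j, by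
      have hz' : z ∈ Metric.ball (0 : ℂ) s := hsp (by rwa [abs_of_pos hr₁])
      rw [(hpq z hz').2 j, (zero_eq_chordSq_iff hp (h.unit j) hz').2 h0]⟩⟩)
    simp only [normSum_linForm (h.unit j)] at h1
    rw [← hT] at h1
    have e1 : circleAverage (fun z => 2 - Real.log (v j z)) 0 r₁ = circleAverage (fun z => 2 -
        Real.log (chordSq (linForm (a j) p q) (coForm (a j) p q) z)) 0 r₁ :=
      Real.circleAverage_congr_sphere fun z hz => by simp only [(hpq z (hsp hz)).2 j]
    rw [e1]
    refine le_trans (le_of_eq ?_) h1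
    refine setLIntegral_congr_fun measurableSet_Ioo fun t ht => ?_
    congr 1
    refine setLIntegral_congr_fun Metric.isOpen_ball.measurableSet fun z hz => ?_
    have hz' : z ∈ Metric.ball (0 : ℂ) s := Metric.ball_subset_ball (ht.2.trans hrs).le hz
    rw [(hpq z hz').1, (hpq z hz').2 j, hp.sphDensity_linForm (h.unit j) hz']
  have hσ0 : ∀ t ∈ Ioo r₁ r, ∀ z ∈ Metric.ball (0 : ℂ) t, ∀ j, 0 ≤ σ z * logWeight (v j z) := by
    intro t ht z hz j
    have hz' : z ∈ Metric.ball (0 : ℂ) s := Metric.ball_subset_ball (ht.2.trans hrs).le hz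
    rw [(hpq z hz').1, (hpq z hz').2 j]
    exact mul_nonneg (sphDensity_nonneg _ _ _) (logWeight_nonneg (chordSq_nonneg _ _ _))
  have hmeas : ∀ j, Measurable fun z => ENNReal.ofReal (σ z * logWeight (v j z)) := fun j =>
    (h.measurable_density.mul (measurable_logWeight.comp (h.measurable_chord j))).ennreal_ofReal
  have hmono : ∀ j, Monotone fun t : ℝ => ∫⁻ z in Metric.ball (0 : ℂ) t,
      ENNReal.ofReal (σ z * logWeight (v j z)) := fun j x y hxy =>
    lintegral_mono_set (Metric.ball_subset_ball hxy)
  -- The bound is proved for each target point separately; nonnegativity of every summand lets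
  -- `ENNReal.ofReal` pass through the sum.
  have hsum : ∫⁻ t in Ioo r₁ r, ENNReal.ofReal (1 / t) * ∫⁻ z in Metric.ball 0 t,
      ENNReal.ofReal (weightSum σ v z) = ∑ j, ∫⁻ t in Ioo r₁ r, ENNReal.ofReal (1 / t) *
        ∫⁻ z in Metric.ball 0 t, ENNReal.ofReal (σ z * logWeight (v j z)) := by
    have hm : ∀ j, Measurable fun t : ℝ => ENNReal.ofReal (1 / t) * ∫⁻ z in Metric.ball (0 : ℂ) t,
        ENNReal.ofReal (σ z * logWeight (v j z)) := fun j => (ENNReal.measurable_ofReal.comp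
      (measurable_const.div measurable_id)).mul (hmono j).measurable
    rw [← lintegral_finsetSum' _ fun j _ => (hm j).aemeasurable]
    refine setLIntegral_congr_fun measurableSet_Ioo fun t ht => ?_
    rw [← Finset.mul_sum, ← lintegral_finsetSum' _ fun j _ => (hmeas j).aemeasurable]
    congr 1
    refine setLIntegral_congr_fun Metric.isOpen_ball.measurableSet fun z hz => ?_
    simp only [weightSum]
    rw [ENNReal.ofReal_sum_of_nonneg fun j _ => hσ0 t ht z hz j]
  rw [hsum]
  refine (Finset.sum_le_sum fun j _ => hbound j).trans ?_
  rw [← ENNReal.ofReal_sum_of_nonneg]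
  · refine ENNReal.ofReal_le_ofReal (le_of_eq ?_)
    rw [← Finset.mul_sum, Finset.sum_add_distrib, Finset.sum_const, Finset.card_univ,
      Fintype.card_fin, nsmul_eq_mul]
    ring
  · intro j _
    have hT0 : 0 ≤ T := by
      rw [hT, ← integral_sphArea_div hp (fun z hz => (hpq z hz).1) hr₁ hr hrs]
      exact intervalIntegral.integral_nonneg hr fun t ht =>
        div_nonneg (sphArea_nonneg t) (hr₁.le.trans ht.1)
    have hL0 : 0 ≤ circleAverage (fun z => 2 - Real.log (v j z)) 0 r₁ := by
      refine Real.circleAverage_nonneg_of_nonneg fun z hz => ?_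
      rw [(hpq z (hsp hz)).2 j]
      exact zero_le_one.trans (one_le_logProximity (a j) p q z)
    have := Real.pi_pos
    positivity

end IsCurveData

end HoloNevanlinna

/-! ### The growth lemma and the error term on a disc -/

namespace HoloNevanlinna

open Real (circleAverage)

variable {m : ℕ} {a : Fin m → ℂ × ℂ}

theorem log_max_one_le_posLog (x : ℝ) : Real.log (max x 1) ≤ Real.posLog x := by
  rcases le_total x 1 with h | h
  · rw [max_eq_right h, Real.log_one]; exact Real.posLog_nonneg
  · rw [max_eq_left h]; exact le_max_right _ _

theorem log_one_add_le_posLog (x : ℝ) : Real.log (1 + x) ≤ Real.log 2 + Real.posLog x := by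
  have h1 : Real.log (1 + x) ≤ Real.posLog (1 + x) := le_max_right _ _
  have h2 := Real.posLog_add (x := 1) (y := x)
  have h3 : Real.posLog 1 = 0 := by simp [Real.posLog]
  linarith

/-- The logarithm of a quantity bounded by two applications of the growth lemma. -/
theorem log_le_of_growth {k r r₁ G B δ : ℝ} (hk : 0 ≤ k) (hr₁ : 0 < r₁) (hr : r₁ ≤ r) (hG : 1 ≤ G)
    (hB : 0 ≤ B) (hδ0 : 0 < δ) (hδ1 : δ ≤ 1)
    (h : r * (2 * Real.pi * k) ≤ G * (1 + r * (G * (1 + B) ^ (1 + δ))) ^ (1 + δ)) :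
    Real.log k ≤ 3 * Real.log G + 4 * Real.log (1 + B) + δ * Real.posLog r +
      (2 * Real.log 2 + Real.posLog r₁⁻¹) := by
  have hr0 : 0 < r := hr₁.trans_le hr
  have hG0 : 0 < G := by linarith
  have lG := Real.log_nonneg hG
  have lB : 0 ≤ Real.log (1 + B) := Real.log_nonneg (by linarith)
  have l2 : 0 ≤ Real.log 2 := Real.log_nonneg (by norm_num)
  have p1 : 0 ≤ Real.posLog r := Real.posLog_nonneg
  have p2 : 0 ≤ Real.posLog r₁⁻¹ := Real.posLog_nonneg
  rcases hk.eq_or_lt with h0 | hk0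
  · rw [← h0, Real.log_zero]; positivity
  have hm1 : 1 ≤ max r 1 := le_max_right _ _
  have hBp : 1 ≤ (1 + B) ^ (1 + δ) := Real.one_le_rpow (by linarith) (by linarith)
  have hmG : 1 ≤ max r 1 * (G * (1 + B) ^ (1 + δ)) := by
    have := one_le_mul_of_one_le_of_one_le hG hBp
    exact one_le_mul_of_one_le_of_one_le hm1 this
  have hY : 1 + r * (G * (1 + B) ^ (1 + δ)) ≤ 2 * (max r 1 * (G * (1 + B) ^ (1 + δ))) := by
    have : r * (G * (1 + B) ^ (1 + δ)) ≤ max r 1 * (G * (1 + B) ^ (1 + δ)) := by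
      gcongr; exact le_max_left _ _
    linarith
  have hYpos : 0 < 1 + r * (G * (1 + B) ^ (1 + δ)) := by positivity
  have hlogY : Real.log (1 + r * (G * (1 + B) ^ (1 + δ))) ≤
      Real.log 2 + (Real.posLog r + (Real.log G + (1 + δ) * Real.log (1 + B))) := by
    refine (Real.log_le_log hYpos hY).trans ?_
    rw [Real.log_mul (by norm_num) (by positivity), Real.log_mul (by positivity) (by positivity),
      Real.log_mul (by positivity) (by positivity), Real.log_rpow (by linarith)]
    have := log_max_one_le_posLog r
    linarith
  have hpi : 1 ≤ 2 * Real.pi := by have := Real.pi_gt_three; linarith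
  have h' : r * k ≤ G * (1 + r * (G * (1 + B) ^ (1 + δ))) ^ (1 + δ) := by
    refine le_trans ?_ h
    gcongr
    nlinarith
  have hl := Real.log_le_log (by positivity) h'
  rw [Real.log_mul hr0.ne' hk0.ne', Real.log_mul hG0.ne' (by positivity),
    Real.log_rpow hYpos] at hl
  -- The factor `r` on the left of the hypothesis cancels one full `log r`, so only `δ * log⁺ r`
  -- survives, up to `log⁺ (1 / r)`.
  have hrr : Real.posLog r - Real.log r ≤ Real.posLog r₁⁻¹ := by
    have e : Real.posLog r - Real.log r = Real.posLog r⁻¹ := by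
      have := Real.posLog_sub_posLog_inv (x := r)
      linarith
    rw [e]
    exact Real.posLog_le_posLog (by positivity) (by gcongr)
  have h4 : (1 + δ) * Real.log (1 + r * (G * (1 + B) ^ (1 + δ))) ≤
      (1 + δ) * (Real.log 2 + (Real.posLog r + (Real.log G + (1 + δ) * Real.log (1 + B)))) := by
    gcongr
  -- With `δ ≤ 1` the coefficients collapse to absolute constants: `2 + δ ≤ 3` for `log G` and `(1 +
  -- δ)² ≤ 4` for `log(1 + B)`. They must not depend on `δ`.
  have h5 : δ * Real.log 2 ≤ Real.log 2 := mul_le_of_le_one_left l2 hδ1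
  have h6 : δ * Real.log G ≤ Real.log G := mul_le_of_le_one_left lG hδ1
  have h7 : δ * Real.log (1 + B) ≤ Real.log (1 + B) := mul_le_of_le_one_left lB hδ1
  have h8 : δ * (δ * Real.log (1 + B)) ≤ Real.log (1 + B) :=
    (mul_le_of_le_one_left (by positivity) hδ1).trans h7
  nlinarith

namespace IsCurveData

variable {R : EReal} {σ : ℂ → ℝ} {v : Fin m → ℂ → ℝ}

theorem sphere_subset_ball' {ρ s : ℝ} (h : ρ < s) : Metric.sphere (0 : ℂ) ρ ⊆ Metric.ball 0 s :=
  fun z hz => by rw [mem_sphere_zero_iff_norm] at hz; rwa [mem_ball_zero_iff, hz]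

theorem wronskian_linForm_ne_zero (h : IsCurveData R a σ v) {s ρ : ℝ} {p q : ℂ → ℂ}
    (hp : IsHoloPair s p q) (hpq : ∀ z ∈ Metric.ball (0 : ℂ) s,
    σ z = sphDensity p q z ∧ ∀ j, v j z = chordSq (linForm (a j) p q) (coForm (a j) p q) z)
    (hρ : ρ < s) (hR : (ρ : EReal) < R) (hgood : ρ ∉ badRadii R σ v) :
    ∀ z ∈ Metric.sphere (0 : ℂ) ρ, wronskian p q z ≠ 0 ∧ ∀ j, linForm (a j) p q z ≠ 0 := by
  intro z hz
  have hz' := sphere_subset_ball' hρ hz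
  refine ⟨fun h0 => hgood ⟨hR, z, hz, Or.inl ?_⟩, fun j h0 => hgood ⟨hR, z, hz, Or.inr ⟨j, ?_⟩⟩⟩
  · rw [(hpq z hz').1, (zero_eq_sphDensity_iff hp hz').2 h0]
  · rw [(hpq z hz').2 j, (zero_eq_chordSq_iff hp (h.unit j) hz').2 h0]

/-- The mean values of the singular density over good circles bound the error term. -/
theorem second_main_inequality (h : IsCurveData R a σ v) (hm : 0 < m) {r₁ : ℝ} (hr₁ : 0 < r₁)
    (hgood₁ : r₁ ∉ badRadii R σ v) : ∃ c₀ : ℝ, ∀ r, r₁ ≤ r → (r : EReal) < R →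
      r ∉ badRadii R σ v →
    ((m : ℝ) - 2) * (∫ t in r₁..r, sphArea σ t / t) ≤
      ∑ j, (∫ t in r₁..r, (({z | z ∈ Metric.ball (0 : ℂ) t ∧ v j z = 0}.ncard : ℝ) / t)) + c₀ +
      Real.log (circleAverage (weightSum σ v) 0 r) / 2 +
      Real.log (∑ j, circleAverage (fun z => 2 - Real.log (v j z)) 0 r₁ + 2 * m *
        ∫ t in r₁..r, sphArea σ t / t) := by
  obtain ⟨d, hd0, hd1, hd⟩ := exists_separation h.independent
  -- The constant is written through `σ` and `v` on the circle of radius `r₁`. The pair `(p, q)`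
  -- varies with `r`, but these functions do not, so one constant serves all radii.
  refine ⟨(m : ℝ) / 2 * (-Real.log d) -
    circleAverage (fun z => (Real.log (σ z) - ∑ j, Real.log (v j z)) / 2) 0 r₁,
    fun r hr hR hgood => ?_⟩
  obtain ⟨s₀, hrs₀, hsR₀⟩ := EReal.exists_real_gt hR
  obtain ⟨z₀, hz₀, h0⟩ := h.nonconstant
  -- The disc is enlarged to contain `z₀`, where the density is nonzero, so that the Wronskian of
  -- the pair is not identically zero.
  have hmax : ((max r ‖z₀‖ : ℝ) : EReal) < R := by
    rcases max_choice r ‖z₀‖ with e | e <;> rw [e] <;> assumption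
  obtain ⟨s, hmrs, hsR⟩ := EReal.exists_real_gt hmax
  have hrs : r < s := (le_max_left _ _).trans_lt hmrs
  obtain ⟨p, q, hp, hpq⟩ := h.exists_pair s hsR
  have hr₁R : (r₁ : EReal) < R := lt_of_le_of_lt (by exact_mod_cast hr) hR
  have hW := exists_wronskian_ne_zero h0 hp (fun z hz => (hpq z hz).1)
    ((le_max_right _ _).trans_lt hmrs)
  have main := hp.second_main_inequality hm hW h.unit h.independent hd0 hd1 hd hr₁ hr hrs (by
    rintro ρ (rfl | rfl)
    · exact h.wronskian_linForm_ne_zero hp hpq (hr.trans_lt hrs) hr₁R hgood₁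
    · exact h.wronskian_linForm_ne_zero hp hpq hrs hR hgood)
  rw [← integral_sphArea_div hp (fun z hz => (hpq z hz).1) hr₁ hr hrs] at main
  have hs1 : Metric.sphere (0 : ℂ) |r₁| ⊆ Metric.ball 0 s := by
    rw [abs_of_pos hr₁]; exact sphere_subset_ball' (hr.trans_lt hrs)
  have hs2 : Metric.sphere (0 : ℂ) |r| ⊆ Metric.ball 0 s := by
    rw [abs_of_pos (hr₁.trans_le hr)]; exact sphere_subset_ball' hrs
  have e1 : circleAverage (fun z => (Real.log (σ z) - ∑ j, Real.log (v j z)) / 2) 0 r₁ =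
      circleAverage (IsHoloPair.logSingular a p q) 0 r₁ :=
    Real.circleAverage_congr_sphere fun z hz => by
      simp only [IsHoloPair.logSingular, (hpq z (hs1 hz)).1, (hpq z (hs1 hz)).2]
  have e2 : circleAverage (weightSum σ v) 0 r = circleAverage (singularDensity a p q) 0 r :=
    Real.circleAverage_congr_sphere fun z hz => by
      simp only [weightSum, singularDensity, (hpq z (hs2 hz)).1, (hpq z (hs2 hz)).2]
  have e3 : ∀ j, circleAverage (fun z => 2 - Real.log (v j z)) 0 r₁ =
      circleAverage (logProximity (a j) p q) 0 r₁ := fun j =>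
    Real.circleAverage_congr_sphere fun z hz => by
      simp only [logProximity, (hpq z (hs1 hz)).2]
  have e4 : ∀ j, (∫ t in r₁..r, (({z | z ∈ Metric.ball (0 : ℂ) t ∧ v j z = 0}.ncard : ℝ) / t)) =
      ∫ t in r₁..r, (({z | z ∈ Metric.ball (0 : ℂ) t ∧ linForm (a j) p q z = 0}.ncard : ℝ) / t) := by
    intro j
    refine intervalIntegral.integral_congr fun t ht => ?_
    rw [uIcc_of_le hr] at ht
    have : {z | z ∈ Metric.ball (0 : ℂ) t ∧ v j z = 0} =
        {z | z ∈ Metric.ball (0 : ℂ) t ∧ linForm (a j) p q z = 0} := by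
      ext z
      refine and_congr_right fun hz => ?_
      have hz' := Metric.ball_subset_ball (ht.2.trans hrs.le) hz
      rw [(hpq z hz').2 j, zero_eq_chordSq_iff hp (h.unit j) hz']
    simp only [this]
  simp only [e1, e2, e3, e4]
  linarith

/-- Outside a small set, the mean values of the singular density are small. -/
theorem exists_log_circleAverage_le (h : IsCurveData R a σ v) {r₁ : ℝ} (hr₁ : 0 < r₁)
    (hgood₁ : r₁ ∉ badRadii R σ v) {g : ℝ → ℝ} (hg : Measurable g) {δ : ℝ} (hδ0 : 0 < δ)
    (hδ1 : δ ≤ 1) : ∃ E : Set ℝ, MeasurableSet E ∧ ∫⁻ r in E, ENNReal.ofReal (g r) < ⊤ ∧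
      ∀ r, r₁ < r → (r : EReal) < R → r ∉ E → r ∉ badRadii R σ v ∧
        ∀ B, 0 ≤ B → Real.pi / 2 * (∑ j, circleAverage (fun z => 2 - Real.log (v j z)) 0 r₁ +
          6 * m * ∫ t in r₁..r, sphArea σ t / t) ≤ B →
        Real.log (circleAverage (weightSum σ v) 0 r) ≤ 3 * Real.posLog (g r) +
          4 * Real.log (1 + B) + δ * Real.posLog r + (2 * Real.log 2 + Real.posLog r₁⁻¹) := by
  have hw : Measurable fun z => ENNReal.ofReal (weightSum σ v z) :=
    h.measurable_weightSum.ennreal_ofReal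
  have hD1 : Measurable fun ρ : ℝ => ENNReal.ofReal ρ * ∫⁻ θ in Ioo (-Real.pi) Real.pi,
      ENNReal.ofReal (weightSum σ v (circleMap 0 ρ θ)) := by
    refine ENNReal.measurable_ofReal.mul ?_
    exact Measurable.lintegral_prod_right'
      (f := fun x : ℝ × ℝ => ENNReal.ofReal (weightSum σ v (circleMap 0 x.1 x.2)))
      (hw.comp continuous_circleMap_uncurry.measurable)
  have hmono : Monotone fun t : ℝ => ∫⁻ z in Metric.ball (0 : ℂ) t,
      ENNReal.ofReal (weightSum σ v z) := fun x y hxy =>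
    lintegral_mono_set (Metric.ball_subset_ball hxy)
  have hD2 : Measurable fun t : ℝ => ENNReal.ofReal (1 / t) * ∫⁻ z in Metric.ball (0 : ℂ) t,
      ENNReal.ofReal (weightSum σ v z) :=
    (ENNReal.measurable_ofReal.comp (measurable_const.div measurable_id)).mul hmono.measurable
  -- Two differentiations: the first application compares the circle integral with its primitive,
  -- the area integral; the second compares the area integral divided by `t` with its own primitive,
  -- which the characteristic function controls.
  obtain ⟨E₁, mE₁, iE₁, hE₁⟩ := borel_growth hD1 0 hδ0 hg
  obtain ⟨E₂, mE₂, iE₂, hE₂⟩ := borel_growth hD2 r₁ hδ0 hg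
  have hc := h.countable_badRadii
  -- The bad radii are countable, hence cost nothing.
  refine ⟨E₁ ∪ E₂ ∪ badRadii R σ v, (mE₁.union mE₂).union hc.measurableSet, ?_, ?_⟩
  · refine (lintegral_union_le _ _ _).trans_lt (ENNReal.add_lt_top.2
      ⟨(lintegral_union_le _ _ _).trans_lt (ENNReal.add_lt_top.2 ⟨iE₁, iE₂⟩), ?_⟩)
    rw [setLIntegral_measure_zero _ _ (hc.measure_zero volume)]
    exact ENNReal.zero_lt_top
  intro r hr hR hrE
  simp only [mem_union, not_or] at hrE
  obtain ⟨⟨hr1, hr2⟩, hr3⟩ := hrE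
  refine ⟨hr3, fun B hB hBle => ?_⟩
  have hr0 : 0 < r := hr₁.trans hr
  set G := max (g r) 1 with hGdef
  have hG1 : 1 ≤ G := le_max_right _ _
  have hG0 : 0 ≤ G := by linarith
  have hV2 := (h.lintegral_weightSum_le hr₁ hr.le hR hgood₁).trans (ENNReal.ofReal_le_ofReal hBle)
  have b2 := hE₂ r hr hr2 (hV2.trans_lt ENNReal.ofReal_lt_top)
  have hV : ∫⁻ z in Metric.ball (0 : ℂ) r, ENNReal.ofReal (weightSum σ v z) ≤
      ENNReal.ofReal (r * (G * (1 + B) ^ (1 + δ))) := by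
    have e : ENNReal.ofReal (max (g r) 1) * (1 + ENNReal.ofReal B) ^ (1 + δ) =
        ENNReal.ofReal (G * (1 + B) ^ (1 + δ)) := by
      rw [ENNReal.ofReal_mul hG0, ← ENNReal.ofReal_rpow_of_nonneg (by linarith) (by linarith),
        ENNReal.ofReal_add zero_le_one hB, ENNReal.ofReal_one]
    have b2' := b2.trans (mul_le_mul_right (ENNReal.rpow_le_rpow (add_le_add_right hV2 1)
      (by linarith : (0 : ℝ) ≤ 1 + δ)) _)
    rw [e] at b2'
    have b3 := mul_le_mul_right b2' (ENNReal.ofReal r)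
    rw [← mul_assoc, ← ENNReal.ofReal_mul hr0.le, mul_one_div_cancel hr0.ne', ENNReal.ofReal_one,
      one_mul, ← ENNReal.ofReal_mul hr0.le] at b3
    exact b3
  have hVe := lintegral_ball_eq_lintegral_circleMap hw r
  have b1 := hE₁ r hr0 hr1 (by rw [← hVe]; exact hV.trans_lt ENNReal.ofReal_lt_top)
  rw [← hVe] at b1
  obtain ⟨s, hrs, hsR⟩ := EReal.exists_real_gt hR
  obtain ⟨p, q, hp, hpq⟩ := h.exists_pair s hsR
  have hgd := h.wronskian_linForm_ne_zero hp hpq hrs hR hr3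
  have hcont : ContinuousOn (weightSum σ v) (Metric.sphere 0 r) :=
    (hp.continuousOn_singularDensity h.unit hrs fun z hz => (hgd z hz).2).congr fun z hz => by
      have hz' := sphere_subset_ball' hrs hz
      simp only [weightSum, singularDensity, (hpq z hz').1, (hpq z hz').2]
  have hnn : ∀ z ∈ Metric.sphere (0 : ℂ) r, 0 ≤ weightSum σ v z := fun z hz => by
    have hz' := sphere_subset_ball' hrs hz
    refine Finset.sum_nonneg fun j _ => ?_
    rw [(hpq z hz').1, (hpq z hz').2 j]
    exact mul_nonneg (sphDensity_nonneg _ _ _) (logWeight_nonneg (chordSq_nonneg _ _ _))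
  have hcm : ∀ θ, circleMap 0 r θ ∈ Metric.sphere (0 : ℂ) r := circleMap_mem_sphere 0 hr0.le
  rw [lintegral_circleMap_eq_circleAverage (hcont.comp_continuous (continuous_circleMap 0 r) hcm)
    fun θ => hnn _ (hcm θ)] at b1
  have hk : 0 ≤ circleAverage (weightSum σ v) 0 r :=
    Real.circleAverage_nonneg_of_nonneg (by rwa [abs_of_pos hr0])
  have hY0 : 0 ≤ r * (G * (1 + B) ^ (1 + δ)) := by positivity
  have b1' := b1.trans (mul_le_mul_right (ENNReal.rpow_le_rpow (add_le_add_right hV 1)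
      (by linarith : (0 : ℝ) ≤ 1 + δ)) _)
  rw [← ENNReal.ofReal_mul hr0.le, ← ENNReal.ofReal_one, ← ENNReal.ofReal_add zero_le_one hY0,
    ENNReal.ofReal_rpow_of_nonneg (by linarith) (by linarith), ← ENNReal.ofReal_mul hG0,
    ENNReal.ofReal_le_ofReal_iff (by positivity)] at b1'
  have := log_le_of_growth hk hr₁ hr.le hG1 hB hδ0 hδ1 b1'
  have := log_max_one_le_posLog (g r)
  linarith

theorem sphArea_mono (h : IsCurveData R a σ v) {t r : ℝ} (ht : t ≤ r) (hR : (r : EReal) < R) :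
    sphArea σ t ≤ sphArea σ r := by
  refine ENNReal.toReal_mono ?_ (lintegral_mono_set (Metric.ball_subset_ball ht))
  obtain ⟨s, hrs, hsR⟩ := EReal.exists_real_gt hR
  obtain ⟨p, q, hp, hpq⟩ := h.exists_pair s hsR
  have hsub : Metric.closedBall (0 : ℂ) r ⊆ Metric.ball 0 s := Metric.closedBall_subset_ball hrs
  have hi : IntegrableOn (fun z => σ z / Real.pi) (Metric.closedBall (0 : ℂ) r) :=
    ContinuousOn.integrableOn_compact (isCompact_closedBall 0 r)
      (((hp.continuousOn_sphDensity.mono hsub).congr fun z hz => (hpq z (hsub hz)).1).div_const _)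
  exact (hi.mono_set Metric.ball_subset_closedBall).lintegral_lt_top.ne

/-- The density is nonnegative and has only finitely many zeros in the disc. Positivity makes the
characteristic function grow at least like a multiple of `log (r / r₀)`. -/
theorem sphArea_pos (h : IsCurveData R a σ v) {r : ℝ} (hr : 0 < r) (hR : (r : EReal) < R) :
    0 < sphArea σ r := by
  obtain ⟨s, hrs, hsR⟩ := EReal.exists_real_gt hR
  obtain ⟨p, q, hp, hpq⟩ := h.exists_pair s hsR
  have hsub : Metric.closedBall (0 : ℂ) r ⊆ Metric.ball 0 s := Metric.closedBall_subset_ball hrs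
  have hi : IntegrableOn (fun z => σ z / Real.pi) (Metric.closedBall (0 : ℂ) r) :=
    ContinuousOn.integrableOn_compact (isCompact_closedBall 0 r)
      (((hp.continuousOn_sphDensity.mono hsub).congr fun z hz => (hpq z (hsub hz)).1).div_const _)
  refine ENNReal.toReal_pos (ne_of_gt ?_)
    (hi.mono_set Metric.ball_subset_closedBall).lintegral_lt_top.ne
  rw [setLIntegral_pos_iff (h.measurable_density.div_const _).ennreal_ofReal]
  have hfin := h.finite_zeros hR
  refine lt_of_lt_of_le ?_ (measure_mono (μ := volume) (s := Metric.ball (0 : ℂ) r \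
    {z | z ∈ Metric.closedBall (0 : ℂ) r ∧ (σ z = 0 ∨ ∃ j, v j z = 0)}) ?_)
  · rw [measure_sdiff_null (hfin.measure_zero volume)]
    exact Metric.measure_ball_pos _ _ hr
  · rintro z ⟨hz, hz0⟩
    have hz' := Metric.ball_subset_closedBall hz
    have hne : σ z ≠ 0 := fun e => hz0 ⟨hz', Or.inl e⟩
    refine ⟨?_, hz⟩
    rw [Function.mem_support, ENNReal.ofReal_ne_zero_iff]
    refine div_pos (lt_of_le_of_ne ?_ hne.symm) Real.pi_pos
    rw [(hpq z (hsub hz')).1]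
    exact sphDensity_nonneg _ _ _

/-- The second main theorem for a holomorphic curve on a disc. -/
theorem second_main_theorem (h : IsCurveData R a σ v) (hm : 0 < m) {r₀ : ℝ} (hr₀ : 0 < r₀)
    (hr₀R : (r₀ : EReal) < R) {g : ℝ → ℝ} (hg : Measurable g) :
    ∃ c r₁ : ℝ, 0 ≤ c ∧ r₀ < r₁ ∧ (r₁ : EReal) < R ∧
      ∀ δ, 0 < δ → δ ≤ 1 → ∃ E : Set ℝ,
      MeasurableSet E ∧ ∫⁻ r in E, ENNReal.ofReal (g r) < ⊤ ∧
      ∀ r, r₁ < r → (r : EReal) < R → r ∉ E →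
        ((m : ℝ) - 2) * (∫ t in r₀..r, sphArea σ t / t) ≤
        ∑ j, (∫ t in r₀..r, (({z | z ∈ Metric.ball (0 : ℂ) t ∧ v j z = 0}.ncard : ℝ) / t)) +
        c * (1 + Real.posLog (∫ t in r₀..r, sphArea σ t / t) + Real.posLog (g r) +
          δ * Real.posLog r) := by
  -- The circle of radius `r₀` may carry zeros, where the initial means are not under control. Good
  -- radii are dense, so the argument starts at a slightly larger one; the interval from `r₀` to
  -- `r₁` changes only constants.
  obtain ⟨r₁, hr₁, hr₁R, hgood₁⟩ : ∃ r₁ : ℝ, r₀ < r₁ ∧ (r₁ : EReal) < R ∧ r₁ ∉ badRadii R σ v := by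
    obtain ⟨s, hs, hsR⟩ := EReal.exists_real_gt hr₀R
    obtain ⟨x, hx, hx1, hx2⟩ := (h.countable_badRadii.dense_compl ℝ).exists_between hs
    exact ⟨x, hx1, lt_trans (by exact_mod_cast hx2) hsR, hx⟩
  have hr₁0 : 0 < r₁ := hr₀.trans hr₁
  obtain ⟨c₀, hc₀⟩ := h.second_main_inequality hm hr₁0 hgood₁
  set M := ∑ j, circleAverage (fun z => 2 - Real.log (v j z)) 0 r₁ with hM
  set T₀ := ∫ t in r₀..r₁, sphArea σ t / t with hT₀
  have hT₀0 : 0 ≤ T₀ := intervalIntegral.integral_nonneg hr₁.le fun t ht =>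
    div_nonneg (sphArea_nonneg t) (hr₀.le.trans ht.1)
  -- Chosen so that `1 + B ≤ κ * (1 + T)`.
  set κ := 1 + Real.pi / 2 * (|M| + 6 * m) with hκ
  have hκ1 : 1 ≤ κ := by
    have := Real.pi_pos
    have : 0 ≤ Real.pi / 2 * (|M| + 6 * m) := by positivity
    linarith
  have lκ := Real.log_nonneg hκ1
  have l2 : 0 ≤ Real.log 2 := Real.log_nonneg (by norm_num)
  have pr : 0 ≤ Real.posLog r₁⁻¹ := Real.posLog_nonneg
  set c₁ := |((m : ℝ) - 2) * T₀| + |c₀| + 4 * (Real.log κ + Real.log 2) + 2 * Real.log 2 +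
    Real.posLog r₁⁻¹ with hc₁
  have hc₁0 : 0 ≤ c₁ := by positivity
  refine ⟨c₁ + 4, r₁, by linarith, hr₁, hr₁R, fun δ hδ0 hδ1 => ?_⟩
  obtain ⟨E, mE, iE, hE⟩ := h.exists_log_circleAverage_le hr₁0 hgood₁ hg hδ0 hδ1
  refine ⟨E, mE, iE, fun r hr hR hrE => ?_⟩
  obtain ⟨hgood, hk⟩ := hE r hr hR hrE
  have main := hc₀ r hr.le hR hgood
  have i1 := h.intervalIntegrable_sphArea_div hr₀ hr₁.le hr₁R
  have i2 := h.intervalIntegrable_sphArea_div hr₁0 hr.le hR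
  have hT := intervalIntegral.integral_add_adjacent_intervals i1 i2
  set T := ∫ t in r₀..r, sphArea σ t / t with hTdef
  set T₁ := ∫ t in r₁..r, sphArea σ t / t with hT₁
  have hT₁0 : 0 ≤ T₁ := intervalIntegral.integral_nonneg hr.le fun t ht =>
    div_nonneg (sphArea_nonneg t) (hr₁0.le.trans ht.1)
  have hTT : T = T₀ + T₁ := hT.symm
  have hN : ∑ j, (∫ t in r₁..r, (({z | z ∈ Metric.ball (0 : ℂ) t ∧ v j z = 0}.ncard : ℝ) / t)) ≤
      ∑ j, (∫ t in r₀..r, (({z | z ∈ Metric.ball (0 : ℂ) t ∧ v j z = 0}.ncard : ℝ) / t)) := by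
    refine Finset.sum_le_sum fun j _ => ?_
    have k1 := h.intervalIntegrable_ncard_div hr₀ hr₁.le hr₁R j
    have k2 := h.intervalIntegrable_ncard_div hr₁0 hr.le hR j
    rw [← intervalIntegral.integral_add_adjacent_intervals k1 k2]
    refine le_add_of_nonneg_left (intervalIntegral.integral_nonneg hr₁.le fun t ht =>
      div_nonneg (Nat.cast_nonneg _) (hr₀.le.trans ht.1))
  set B := Real.pi / 2 * (|M| + 6 * m * T₁) with hB
  have hpi := Real.pi_gt_three
  have hB0 : 0 ≤ B := by positivity
  have hk1 := hk B hB0 (by rw [hB]; gcongr; exact le_abs_self M)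
  have hmT : 0 ≤ (m : ℝ) * T₁ := by positivity
  have hM0 := abs_nonneg M
  have hprox : Real.log (M + 2 * m * T₁) ≤ Real.log (1 + B) := by
    rcases le_or_gt (M + 2 * m * T₁) 0 with hle | hlt
    · have hM' : 0 ≤ M := by
        obtain ⟨s, hrs, hsR⟩ := EReal.exists_real_gt hr₁R
        obtain ⟨p, q, hp, hpq⟩ := h.exists_pair s hsR
        refine Finset.sum_nonneg fun j _ => Real.circleAverage_nonneg_of_nonneg fun z hz => ?_
        rw [abs_of_pos hr₁0] at hz
        rw [(hpq z (sphere_subset_ball' hrs hz)).2 j]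
        exact zero_le_one.trans (one_le_logProximity (a j) p q z)
      have : M + 2 * m * T₁ = 0 := le_antisymm hle (by positivity)
      rw [this, Real.log_zero]
      exact Real.log_nonneg (by linarith)
    · refine Real.log_le_log hlt ?_
      have := le_abs_self M
      rw [hB]
      nlinarith
  have hTle : T₁ ≤ T := by linarith
  have hT0 : 0 ≤ T := hT₁0.trans hTle
  have hlogB : Real.log (1 + B) ≤ Real.log κ + Real.log 2 + Real.posLog T := by
    have h1 : 1 + B ≤ κ * (1 + T) := by
      have e1 : B ≤ Real.pi / 2 * (|M| + 6 * m * T) := by rw [hB]; gcongr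
      have e2 : κ * (1 + T) = 1 + T + Real.pi / 2 * (|M| + 6 * m * T) +
        Real.pi / 2 * (|M| * T + 6 * m) := by rw [hκ]; ring
      have e3 : 0 ≤ Real.pi / 2 * (|M| * T + 6 * m) := by positivity
      linarith
    have h2 := Real.log_le_log (by linarith) h1
    rw [Real.log_mul (by linarith) (by linarith)] at h2
    have := log_one_add_le_posLog T
    linarith
  have p1 : 0 ≤ Real.posLog T := Real.posLog_nonneg
  have p2 : 0 ≤ Real.posLog (g r) := Real.posLog_nonneg
  have p3 : 0 ≤ δ * Real.posLog r := mul_nonneg hδ0.le Real.posLog_nonneg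
  have q1 := le_abs_self (((m : ℝ) - 2) * T₀)
  have q2 := le_abs_self c₀
  have hexp : (c₁ + 4) * (1 + Real.posLog T + Real.posLog (g r) + δ * Real.posLog r) =
      c₁ + 4 + 4 * Real.posLog T + 4 * Real.posLog (g r) + 4 * (δ * Real.posLog r) +
      c₁ * (Real.posLog T + Real.posLog (g r) + δ * Real.posLog r) := by ring
  have hc₁p : 0 ≤ c₁ * (Real.posLog T + Real.posLog (g r) + δ * Real.posLog r) := by positivity
  have hfin : ((m : ℝ) - 2) * T = ((m : ℝ) - 2) * T₀ + ((m : ℝ) - 2) * T₁ := by rw [hTT]; ring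
  rw [hfin, hexp]
  linarith

end IsCurveData

end HoloNevanlinna

namespace HoloNevanlinna

/-! ### Line integrals and the function `x̂` -/

variable {X : Type*} [TopologicalSpace X] [ChartedSpace ℂ X]

/-- A complex manifold is a smooth real manifold. -/
theorem isManifold_real [IsManifold 𝓘(ℂ) ω X] : IsManifold 𝓘(ℝ, ℂ) ∞ X := by
  refine isManifold_of_contDiffOn 𝓘(ℝ, ℂ) ∞ X fun e e' he he' => ?_
  have h := HasGroupoid.compatible (G := contDiffGroupoid ω 𝓘(ℂ)) he he'
  rw [contDiffGroupoid, mem_groupoid_of_pregroupoid] at h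
  have h1 : ContDiffOn ℂ ω (𝓘(ℂ) ∘ (e.symm ≫ₕ e') ∘ 𝓘(ℂ).symm)
    (𝓘(ℂ).symm ⁻¹' (e.symm ≫ₕ e').source ∩ range 𝓘(ℂ)) := h.1
  simpa using (h1.restrict_scalars ℝ).of_le le_top

theorem differentiableAt_coordChange [IsManifold 𝓘(ℂ) ω X] {e e' : OpenPartialHomeomorph X ℂ}
    (he : e ∈ atlas ℂ X) (he' : e' ∈ atlas ℂ X) {x : X} (hx : x ∈ e.source) (hx' : x ∈ e'.source) :
    DifferentiableAt ℂ (fun z => e' (e.symm z)) (e x) := by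
  have h1 : ContMDiffAt 𝓘(ℂ) 𝓘(ℂ) ω e.symm (e x) :=
    contMDiffAt_symm_of_mem_maximalAtlas (IsManifold.subset_maximalAtlas he) (e.map_source hx)
  have h2 : ContMDiffAt 𝓘(ℂ) 𝓘(ℂ) ω e' (e.symm (e x)) := by
    rw [e.left_inv hx]
    exact contMDiffAt_of_mem_maximalAtlas (IsManifold.subset_maximalAtlas he') hx'
  exact (contMDiffAt_iff_contDiffAt.1 (h2.comp (e x) h1)).differentiableAt (by simp)

theorem contDiffAt_chart_comp [IsManifold 𝓘(ℝ, ℂ) ∞ X] {c : ℝ → X} {t : ℝ}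
    (hc : ContMDiffAt 𝓘(ℝ, ℝ) 𝓘(ℝ, ℂ) ∞ c t) {e : OpenPartialHomeomorph X ℂ} (he : e ∈ atlas ℂ X)
    (ht : c t ∈ e.source) : ContDiffAt ℝ ∞ (fun s => e (c s)) t :=
  contMDiffAt_iff_contDiffAt.1 (ContMDiffAt.comp t
    (contMDiffAt_of_mem_maximalAtlas (IsManifold.subset_maximalAtlas he) ht) hc)

namespace HolomorphicForm

variable (S : HolomorphicForm X)

/-- The pull-back of the form by a curve, as a function of the parameter. -/
def pull (c : ℝ → X) (t : ℝ) : ℂ :=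
  S.coeff (chartAt ℂ (c t)) (chartAt ℂ (c t) (c t)) * deriv (fun s => chartAt ℂ (c t) (c s)) t

theorem lineIntegral_eq (c : ℝ → X) : S.lineIntegral c = ∫ t in (0 : ℝ)..1, S.pull c t := rfl

theorem pull_congr {c c' : ℝ → X} {t : ℝ} (h : c =ᶠ[𝓝 t] c') : S.pull c t = S.pull c' t := by
  unfold pull
  rw [h.eq_of_nhds]
  congr 1
  exact (h.fun_comp (chartAt ℂ (c' t))).deriv_eq

/-- Two curves which agree near `1/2` can be glued there. -/
theorem contMDiff_glue {c₁ c₂ : ℝ → X} (h₁ : ContMDiff 𝓘(ℝ, ℝ) 𝓘(ℝ, ℂ) ∞ c₁)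
    (h₂ : ContMDiff 𝓘(ℝ, ℝ) 𝓘(ℝ, ℂ) ∞ c₂) (h : c₁ =ᶠ[𝓝 (1 / 2)] c₂) :
    ContMDiff 𝓘(ℝ, ℝ) 𝓘(ℝ, ℂ) ∞ (fun t => if t ≤ 1 / 2 then c₁ t else c₂ t) := by
  intro t
  rcases lt_trichotomy t (1 / 2) with ht | ht | ht
  · refine (h₁ t).congr_of_eventuallyEq ?_
    filter_upwards [Iio_mem_nhds ht] with s hs
    exact if_pos (le_of_lt hs)
  · subst ht
    refine (h₁ _).congr_of_eventuallyEq ?_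
    filter_upwards [h] with s hs
    rw [← hs, ite_self]
  · refine (h₂ t).congr_of_eventuallyEq ?_
    filter_upwards [Ioi_mem_nhds ht] with s hs
    exact if_neg (not_le.2 hs)

theorem contMDiff_comp_real {c : ℝ → X} (hc : ContMDiff 𝓘(ℝ, ℝ) 𝓘(ℝ, ℂ) ∞ c) {φ : ℝ → ℝ}
    (hφ : ContDiff ℝ ∞ φ) : ContMDiff 𝓘(ℝ, ℝ) 𝓘(ℝ, ℂ) ∞ (fun t => c (φ t)) :=
  hc.comp hφ.contMDiff

variable [IsManifold 𝓘(ℝ, ℂ) ∞ X]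

theorem pull_comp {c : ℝ → X} (hc : ContMDiff 𝓘(ℝ, ℝ) 𝓘(ℝ, ℂ) ∞ c) {φ : ℝ → ℝ}
    (hφ : ContDiff ℝ ∞ φ) (t : ℝ) :
    S.pull (fun s => c (φ s)) t = deriv φ t • S.pull c (φ t) := by
  have hm := chart_mem_atlas ℂ (c (φ t))
  have hs := mem_chart_source ℂ (c (φ t))
  have hd := (contDiffAt_chart_comp hc.contMDiffAt hm hs).differentiableAt (by simp)
  have hφ' := (hφ.differentiable (by simp)).differentiableAt (x := t)
  have := (HasDerivAt.scomp t hd.hasDerivAt hφ'.hasDerivAt).deriv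
  unfold pull
  rw [show (fun s => chartAt ℂ (c (φ t)) (c (φ s))) =
    (fun s => chartAt ℂ (c (φ t)) (c s)) ∘ φ from rfl, this, mul_smul_comm]

variable [IsManifold 𝓘(ℂ) ω X]

/-- In `pull` the chart changes with the parameter, which hides its regularity. The transformation
law of the coefficients allows a single chart to be used along a whole stretch of the curve. -/
theorem pull_eq {c : ℝ → X} {t : ℝ} (hc : ContMDiffAt 𝓘(ℝ, ℝ) 𝓘(ℝ, ℂ) ∞ c t)
    {e : OpenPartialHomeomorph X ℂ} (he : e ∈ atlas ℂ X) (ht : c t ∈ e.source) :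
    S.pull c t = S.coeff e (e (c t)) * deriv (fun s => e (c s)) t := by
  set e' := chartAt ℂ (c t) with he'
  have hm := chart_mem_atlas ℂ (c t)
  have hs := mem_chart_source ℂ (c t)
  have hd := (contDiffAt_chart_comp hc hm hs).differentiableAt (by simp)
  have hcc := differentiableAt_coordChange hm he hs ht
  have hev : (fun s => e (c s)) =ᶠ[𝓝 t] (fun z => e (e'.symm z)) ∘ fun s => e' (c s) := by
    filter_upwards [hc.continuousAt.preimage_mem_nhds (e'.open_source.mem_nhds hs)] with s hs'
    simp only [Function.comp, e'.left_inv hs']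
  rw [hev.deriv_eq, pull, S.compatible e' hm e he (c t) ⟨hs, ht⟩]
  have := (hcc.hasDerivAt.scomp t hd.hasDerivAt).deriv
  rw [this, smul_eq_mul]
  ring

theorem continuous_pull {c : ℝ → X} (hc : ContMDiff 𝓘(ℝ, ℝ) 𝓘(ℝ, ℂ) ∞ c) :
    Continuous (S.pull c) := by
  refine continuous_iff_continuousAt.2 fun t => ?_
  set e := chartAt ℂ (c t)
  have hm := chart_mem_atlas ℂ (c t)
  have hs := mem_chart_source ℂ (c t)
  have hn := hc.continuous.continuousAt.preimage_mem_nhds (e.open_source.mem_nhds hs)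
  have hev : S.pull c =ᶠ[𝓝 t] fun s => S.coeff e (e (c s)) * deriv (fun s => e (c s)) s := by
    filter_upwards [hn] with s hs'
    exact S.pull_eq hc.contMDiffAt hm hs'
  refine ContinuousAt.congr (ContinuousAt.mul ?_ ?_) hev.symm
  · have h1 : ContinuousAt (S.coeff e) (e (c t)) :=
      (S.holomorphic e hm).continuousOn.continuousAt (e.open_target.mem_nhds (e.map_source hs))
    exact ContinuousAt.comp (f := fun s => e (c s)) h1
      (contDiffAt_chart_comp hc.contMDiffAt hm hs).continuousAt
  · have := (contDiffAt_chart_comp hc.contMDiffAt hm hs).fderiv_right (m := 0) (by simp)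
    exact this.continuousAt.clm_apply continuousAt_const

theorem integral_pull_comp {c : ℝ → X} (hc : ContMDiff 𝓘(ℝ, ℝ) 𝓘(ℝ, ℂ) ∞ c) {φ : ℝ → ℝ}
    (hφ : ContDiff ℝ ∞ φ) (a b : ℝ) :
    ∫ t in a..b, S.pull (fun s => c (φ s)) t = ∫ t in φ a..φ b, S.pull c t := by
  simp only [S.pull_comp hc hφ]
  exact intervalIntegral.integral_deriv_smul_comp
    (fun x _ => (hφ.differentiable (by simp)).differentiableAt.hasDerivAt)
    (hφ.continuous_deriv (by simp)).continuousOn (S.continuous_pull hc)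

theorem lineIntegral_glue {c₁ c₂ : ℝ → X} (h₁ : ContMDiff 𝓘(ℝ, ℝ) 𝓘(ℝ, ℂ) ∞ c₁)
    (h₂ : ContMDiff 𝓘(ℝ, ℝ) 𝓘(ℝ, ℂ) ∞ c₂) (h : c₁ =ᶠ[𝓝 (1 / 2)] c₂) :
    S.lineIntegral (fun t => if t ≤ 1 / 2 then c₁ t else c₂ t) =
      (∫ t in (0 : ℝ)..(1 / 2), S.pull c₁ t) + ∫ t in (1 / 2 : ℝ)..1, S.pull c₂ t := by
  have hg := S.continuous_pull (contMDiff_glue h₁ h₂ h)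
  rw [lineIntegral_eq, ← intervalIntegral.integral_add_adjacent_intervals
    (hg.intervalIntegrable 0 (1 / 2)) (hg.intervalIntegrable (1 / 2) 1)]
  congr 1
  · refine intervalIntegral.integral_congr_ae ?_
    filter_upwards [Measure.ae_ne volume (1 / 2)] with t ht h'
    rw [uIoc_of_le (by norm_num)] at h'
    refine S.pull_congr ?_
    filter_upwards [Iio_mem_nhds (lt_of_le_of_ne h'.2 ht)] with s hs
    exact if_pos (le_of_lt hs)
  · refine intervalIntegral.integral_congr_ae (ae_of_all _ fun t h' => ?_)
    rw [uIoc_of_le (by norm_num)] at h'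
    refine S.pull_congr ?_
    filter_upwards [Ioi_mem_nhds h'.1] with s hs
    exact if_neg (not_le.2 hs)

/-- The composition of two smooth curves, and the integral along it. -/
theorem exists_concat {p x y : X} {c₁ c₂ : ℝ → X} (h₁ : IsSmoothCurve c₁ p x)
    (h₂ : IsSmoothCurve c₂ x y) : ∃ c, IsSmoothCurve c p y ∧
      S.lineIntegral c = S.lineIntegral c₁ + S.lineIntegral c₂ := by
  -- The first reparametrised curve has arrived at `x` by time `1/4`, the second does not leave
  -- before `3/4`. Both are constant near `1/2`, so the glued curve is smooth.
  have hφ₁ : ContDiff ℝ ∞ fun t : ℝ => Real.smoothTransition (4 * t) :=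
    Real.smoothTransition.contDiff.comp (contDiff_const.mul contDiff_id)
  have hφ₂ : ContDiff ℝ ∞ fun t : ℝ => Real.smoothTransition (4 * t - 3) :=
    Real.smoothTransition.contDiff.comp ((contDiff_const.mul contDiff_id).sub contDiff_const)
  have k₁ := contMDiff_comp_real h₁.1 hφ₁
  have k₂ := contMDiff_comp_real h₂.1 hφ₂
  have hev : (fun t => c₁ (Real.smoothTransition (4 * t))) =ᶠ[𝓝 (1 / 2)]
      fun t => c₂ (Real.smoothTransition (4 * t - 3)) := by
    filter_upwards [Ioo_mem_nhds (show (1 / 4 : ℝ) < 1 / 2 by norm_num)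
      (show (1 / 2 : ℝ) < 3 / 4 by norm_num)] with t ht
    rw [Real.smoothTransition.one_of_one_le (by linarith [ht.1]),
      Real.smoothTransition.zero_of_nonpos (by linarith [ht.2]), h₁.2.2, h₂.2.1]
  refine ⟨_, ⟨contMDiff_glue k₁ k₂ hev, ?_, ?_⟩, ?_⟩
  · simp [h₁.2.1]
  · rw [if_neg (by norm_num), Real.smoothTransition.one_of_one_le (by norm_num), h₂.2.2]
  · rw [S.lineIntegral_glue k₁ k₂ hev, S.integral_pull_comp h₁.1 hφ₁, S.integral_pull_comp h₂.1 hφ₂,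
      lineIntegral_eq, lineIntegral_eq]
    have e0 : Real.smoothTransition 0 = 0 := Real.smoothTransition.zero
    have e1 : ∀ t : ℝ, 1 ≤ t → Real.smoothTransition t = 1 := fun t ht =>
      Real.smoothTransition.one_of_one_le ht
    rw [mul_zero, e0, e1 (4 * (1 / 2)) (by norm_num), e1 (4 * 1 - 3) (by norm_num),
      Real.smoothTransition.zero_of_nonpos (by norm_num)]

/-- The integral of a form without periods depends only on the end points. -/
theorem lineIntegral_eq_of_zeroPeriods (hS : S.ZeroPeriods) {p x : X} {c₁ c₂ : ℝ → X}
    (h₁ : IsSmoothCurve c₁ p x) (h₂ : IsSmoothCurve c₂ p x) :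
    S.lineIntegral c₁ = S.lineIntegral c₂ := by
  -- A parameter which rises from `0` to `1`, rests there on `(1/4, 3/4)` and returns to `0`.
  -- Following `c₁` in the first half and `c₂` in the second gives a smooth loop, out along `c₁` and
  -- back along `c₂`.
  have hφ : ContDiff ℝ ∞ fun t : ℝ =>
      Real.smoothTransition (4 * t) * Real.smoothTransition (4 - 4 * t) :=
    (Real.smoothTransition.contDiff.comp (contDiff_const.mul contDiff_id)).mul
      (Real.smoothTransition.contDiff.comp (contDiff_const.sub (contDiff_const.mul contDiff_id)))
  have k₁ := contMDiff_comp_real h₁.1 hφ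
  have k₂ := contMDiff_comp_real h₂.1 hφ
  have hone : ∀ t : ℝ, t ∈ Ioo (1 / 4 : ℝ) (3 / 4) →
      Real.smoothTransition (4 * t) * Real.smoothTransition (4 - 4 * t) = 1 := by
    intro t ht
    rw [Real.smoothTransition.one_of_one_le (by linarith [ht.1]),
      Real.smoothTransition.one_of_one_le (by linarith [ht.2]), one_mul]
  have hev : (fun t => c₁ (Real.smoothTransition (4 * t) * Real.smoothTransition (4 - 4 * t)))
      =ᶠ[𝓝 (1 / 2)]
      fun t => c₂ (Real.smoothTransition (4 * t) * Real.smoothTransition (4 - 4 * t)) := by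
    filter_upwards [Ioo_mem_nhds (show (1 / 4 : ℝ) < 1 / 2 by norm_num)
      (show (1 / 2 : ℝ) < 3 / 4 by norm_num)] with t ht
    rw [hone t ht, h₁.2.2, h₂.2.2]
  have hz := hS p _ ⟨contMDiff_glue k₁ k₂ hev, by simp [h₁.2.1], by
    rw [if_neg (by norm_num)]; simp [h₂.2.1]⟩
  rw [S.lineIntegral_glue k₁ k₂ hev, S.integral_pull_comp h₁.1 hφ, S.integral_pull_comp h₂.1 hφ,
    hone (1 / 2) (by norm_num)] at hz
  simp only [mul_zero, Real.smoothTransition.zero, zero_mul, mul_one, sub_self] at hz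
  rw [lineIntegral_eq, lineIntegral_eq, eq_neg_of_add_eq_zero_left hz,
    ← intervalIntegral.integral_symm]

theorem hat_eq (hS : S.ZeroPeriods) {o x : X} {c : ℝ → X} (h : IsSmoothCurve c o x) :
    S.hat o x = S.lineIntegral c := by
  have hc : ∃ c : ℝ → X, IsSmoothCurve c o x := ⟨c, h⟩
  rw [hat, dif_pos hc]
  exact S.lineIntegral_eq_of_zeroPeriods hS hc.choose_spec h

/-- Two points of a coordinate disc are joined by a curve, along which the integral is given by a
primitive. -/
theorem exists_curve_in_chart {e : OpenPartialHomeomorph X ℂ} (he : e ∈ atlas ℂ X) {z₀ : ℂ} {ε : ℝ}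
    (hb : Metric.ball z₀ ε ⊆ e.target) {w w' : ℂ} (hw : w ∈ Metric.ball z₀ ε)
    (hw' : w' ∈ Metric.ball z₀ ε) : ∃ c, IsSmoothCurve c (e.symm w) (e.symm w') ∧
      ∀ G : ℂ → ℂ, (∀ z ∈ Metric.ball z₀ ε, HasDerivAt G (S.coeff e z) z) →
        S.lineIntegral c = G w' - G w := by
  set l : ℝ → ℂ := fun t => w + Real.smoothTransition t • (w' - w) with hl
  have hl' : ContDiff ℝ ∞ l := contDiff_const.add (Real.smoothTransition.contDiff.smul contDiff_const)
  have hmem : ∀ t, l t ∈ Metric.ball z₀ ε := fun t =>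
    (convex_ball z₀ ε).add_smul_sub_mem hw hw' ⟨Real.smoothTransition.nonneg t,
      Real.smoothTransition.le_one t⟩
  have hc : ContMDiff 𝓘(ℝ, ℝ) 𝓘(ℝ, ℂ) ∞ fun t => e.symm (l t) := fun t =>
    ContMDiffAt.comp t (contMDiffAt_symm_of_mem_maximalAtlas (IsManifold.subset_maximalAtlas he)
      (hb (hmem t))) hl'.contMDiff.contMDiffAt
  refine ⟨_, ⟨hc, by simp [hl], by simp [hl]⟩, fun G hG => ?_⟩
  have hd : ∀ t, HasDerivAt (fun s => G (l s)) (S.pull (fun s => e.symm (l s)) t) t := by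
    intro t
    rw [S.pull_eq hc.contMDiffAt he (e.map_target (hb (hmem t)))]
    simp only [e.right_inv (hb (hmem _))]
    have h1 := (hl'.differentiable (by simp)).differentiableAt (x := t)
    have := (hG _ (hmem t)).scomp t h1.hasDerivAt
    rwa [smul_eq_mul, mul_comm] at this
  rw [lineIntegral_eq, intervalIntegral.integral_eq_sub_of_hasDerivAt (fun t _ => hd t)
    ((S.continuous_pull hc).intervalIntegrable 0 1)]
  simp [hl]

/-- The points reachable from `o` form a clopen set: any two points of a coordinate disc are joined
by a smooth curve, and smooth curves can be composed. -/
theorem exists_curve (S : HolomorphicForm X) [ConnectedSpace X] (o x : X) : ∃ c : ℝ → X, IsSmoothCurve c o x := by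
  have hball : ∀ y : X, ∃ ε > 0, Metric.ball (chartAt ℂ y y) ε ⊆ (chartAt ℂ y).target := fun y =>
    Metric.isOpen_iff.1 (chartAt ℂ y).open_target _ (mem_chart_target ℂ y)
  have hnear : ∀ y : X, ∃ U ∈ 𝓝 y, ∀ a ∈ U, ∀ b ∈ U, ∃ c : ℝ → X, IsSmoothCurve c a b := by
    intro y
    obtain ⟨ε, hε, hb⟩ := hball y
    set e := chartAt ℂ y
    refine ⟨e.source ∩ e ⁻¹' Metric.ball (e y) ε, inter_mem (chart_source_mem_nhds ℂ y)
      ((e.continuousAt (mem_chart_source ℂ y)).preimage_mem_nhds (Metric.ball_mem_nhds _ hε)), ?_⟩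
    intro a ha b hb'
    obtain ⟨c, hc, -⟩ := S.exists_curve_in_chart (chart_mem_atlas ℂ y) hb ha.2 hb'.2
    rw [e.left_inv ha.1, e.left_inv hb'.1] at hc
    exact ⟨c, hc⟩
  have hclopen : IsClopen {x | ∃ c : ℝ → X, IsSmoothCurve c o x} := by
    constructor
    · refine isClosed_of_closure_subset fun y hy => ?_
      obtain ⟨U, hU, h⟩ := hnear y
      obtain ⟨a, ha, c₁, hc₁⟩ := mem_closure_iff_nhds.1 hy U hU
      obtain ⟨c₂, hc₂⟩ := h a ha y (mem_of_mem_nhds hU)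
      obtain ⟨c, hc, -⟩ := S.exists_concat hc₁ hc₂
      exact ⟨c, hc⟩
    · refine isOpen_iff_mem_nhds.2 fun y ⟨c₁, hc₁⟩ => ?_
      obtain ⟨U, hU, h⟩ := hnear y
      filter_upwards [hU] with b hb
      obtain ⟨c₂, hc₂⟩ := h y (mem_of_mem_nhds hU) b hb
      obtain ⟨c, hc, -⟩ := S.exists_concat hc₁ hc₂
      exact ⟨c, hc⟩
  exact (Set.ext_iff.1 (hclopen.eq_univ ⟨o, fun _ => o, contMDiff_const, rfl, rfl⟩) x).2 (mem_univ x)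

/-- The function `x̂` is holomorphic, with differential `S`. -/
theorem hasDerivAt_hat [ConnectedSpace X] (hS : S.ZeroPeriods) (o : X)
    {e : OpenPartialHomeomorph X ℂ} (he : e ∈ atlas ℂ X) {w : ℂ} (hw : w ∈ e.target) :
    HasDerivAt (fun z => S.hat o (e.symm z)) (S.coeff e w) w := by
  obtain ⟨ε, hε, hb⟩ := Metric.isOpen_iff.1 e.open_target w hw
  -- On a coordinate disc the coefficient has a primitive. Extending a curve from the centre to a
  -- nearby point shows that `x̂` differs from that primitive by a constant.
  obtain ⟨G, hG⟩ := ((S.holomorphic e he).mono hb).isExactOn_ball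
  refine ((hG w (Metric.mem_ball_self hε)).add_const (S.hat o (e.symm w) - G w)).congr_of_eventuallyEq ?_
  filter_upwards [Metric.ball_mem_nhds w hε] with z hz
  obtain ⟨c₁, hc₁⟩ := S.exists_curve o (e.symm w)
  obtain ⟨c₂, hc₂, hI⟩ := S.exists_curve_in_chart he hb (Metric.mem_ball_self hε) hz
  obtain ⟨c, hc, hI'⟩ := S.exists_concat hc₁ hc₂
  rw [S.hat_eq hS hc, hI', hI G hG, S.hat_eq hS hc₁]
  ring

end HolomorphicForm

end HoloNevanlinna

namespace HoloNevanlinna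

/-! ### The function `x̂` maps the surface onto a disc -/

/-- A proper local homeomorphism to a connected space, one of whose fibres is a single point, is
bijective: properness is expressed on an exhaustion of the target by closed discs. -/
theorem existsUnique_of_isLocalHomeomorph {X : Type*} [TopologicalSpace X] [T2Space X] {H : X → ℂ}
    (hH : IsLocalHomeomorph H) {s s' : ℝ} (hs : s < s')
    (hcompact : IsCompact (H ⁻¹' Metric.closedBall 0 s')) (hs0 : 0 < s) (h0 : ∃! x, H x = 0) {w : ℂ}
    (hw : w ∈ Metric.ball (0 : ℂ) s) : ∃! x, H x = w := by
  have hcont := hH.continuous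
  have hopen := hH.isOpenMap
  set K := H ⁻¹' Metric.closedBall 0 s' with hK
  -- Connectedness of the disc is applied to the points with exactly one preimage: the set is open,
  -- relatively closed and contains `0`.
  set A := {w | ∃! x, H x = w} ∩ Metric.ball (0 : ℂ) s with hA
  have hAopen : IsOpen A := by
    refine isOpen_iff_mem_nhds.2 fun w ⟨⟨x, hx, hu⟩, hws⟩ => ?_
    obtain ⟨e, hxe, rfl⟩ := hH x
    -- Properness: outside the chart around the only preimage the image is closed and misses `w`, so
    -- points near `w` have all their preimages in that chart, where the map is injective.
    have hU : IsCompact (K \ e.source) := hcompact.diff e.open_source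
    have himg : IsClosed (e '' (K \ e.source)) := (hU.image hcont).isClosed
    have hwn : w ∉ e '' (K \ e.source) := by
      rintro ⟨y, ⟨-, hy⟩, hyw⟩
      exact hy (hu y hyw ▸ hxe)
    have hV : e '' e.source ∈ 𝓝 w := hx ▸ hopen.image_mem_nhds (e.open_source.mem_nhds hxe)
    filter_upwards [hV, himg.isOpen_compl.mem_nhds hwn, Metric.isOpen_ball.mem_nhds hws]
      with w' h1 h2 h3
    obtain ⟨x', hx', hxw'⟩ := h1
    refine ⟨⟨x', hxw', fun y hy => ?_⟩, h3⟩
    have hye : y ∈ e.source := by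
      by_contra hne
      refine h2 ⟨y, ⟨?_, hne⟩, hy⟩
      rw [hK, mem_preimage, hy]
      exact Metric.closedBall_subset_closedBall hs.le (Metric.ball_subset_closedBall h3)
    exact e.injOn hye hx' (hy.trans hxw'.symm)
  have hsub : Metric.ball (0 : ℂ) s ⊆ A := by
    refine (Metric.isPreconnected_ball).subset_of_closure_inter_subset hAopen
      ⟨0, Metric.mem_ball_self hs0, h0, Metric.mem_ball_self hs0⟩ ?_
    rintro w ⟨hwc, hws⟩
    refine ⟨?_, hws⟩
    have hex : w ∈ H '' K := by
      refine closure_minimal ?_ (hcompact.image hcont).isClosed hwc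
      rintro w' ⟨⟨x, hx, -⟩, hw's⟩
      refine ⟨x, ?_, hx⟩
      rw [hK, mem_preimage, hx]
      exact Metric.closedBall_subset_closedBall hs.le (Metric.ball_subset_closedBall hw's)
    obtain ⟨x, -, hx⟩ := hex
    refine ⟨x, hx, fun y hy => ?_⟩
    by_contra hne
    -- Two preimages of a limit point would have disjoint neighbourhoods with open images, and a
    -- nearby point of `A` would then have two preimages.
    obtain ⟨U, V, hU, hV, hyU, hxV, hUV⟩ := t2_separation hne
    have hn : H '' U ∩ H '' V ∈ 𝓝 w := inter_mem (hy ▸ hopen.image_mem_nhds (hU.mem_nhds hyU))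
      (hx ▸ hopen.image_mem_nhds (hV.mem_nhds hxV))
    obtain ⟨w', ⟨⟨y', hy', hyw⟩, x', hx', hxw⟩, ⟨z, -, hz⟩, -⟩ := mem_closure_iff_nhds.1 hwc _ hn
    have : y' = x' := (hz y' hyw).trans (hz x' hxw).symm
    exact disjoint_left.1 hUV hy' (this ▸ hx')
  exact (hsub hw).1

variable {X : Type*} [TopologicalSpace X] [ChartedSpace ℂ X]

namespace HolomorphicForm

variable {S : HolomorphicForm X} {o : X}

/-- In a chart the derivative of `x̂` is the coefficient of the form, which does not vanish; the
inverse function theorem applies. -/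
theorem isLocalHomeomorph_hat [IsManifold 𝓘(ℂ) ω X] [ConnectedSpace X] (hS : S.IsAdmissible o) :
    IsLocalHomeomorph (S.hat o) := by
  have : IsManifold 𝓘(ℝ, ℂ) ∞ X := isManifold_real
  refine IsLocalHomeomorph.mk _ fun x => ?_
  set e := chartAt ℂ x
  have he := chart_mem_atlas ℂ x
  have hx := mem_chart_source ℂ x
  have hd : ∀ w ∈ e.target, HasDerivAt (fun z => S.hat o (e.symm z)) (S.coeff e w) w :=
    fun w hw => S.hasDerivAt_hat hS.zeroPeriods o he hw
  have hdiff : DifferentiableOn ℂ (fun z => S.hat o (e.symm z)) e.target := fun w hw =>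
    (hd w hw).differentiableAt.differentiableWithinAt
  have hstrict : HasStrictDerivAt (fun z => S.hat o (e.symm z)) (S.coeff e (e x)) (e x) := by
    have := (hdiff.analyticAt (e.open_target.mem_nhds (e.map_source hx))).hasStrictDerivAt
    rwa [(hd _ (e.map_source hx)).deriv] at this
  have hne := hS.nowhereVanishing e he _ (e.map_source hx)
  set ψ := (hstrict.hasStrictFDerivAt_equiv hne).toOpenPartialHomeomorph _ with hψ
  refine ⟨(e.trans ψ), ?_, ?_⟩
  · rw [OpenPartialHomeomorph.trans_source]
    exact ⟨hx, (hstrict.hasStrictFDerivAt_equiv hne).mem_toOpenPartialHomeomorph_source⟩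
  · intro y hy
    rw [OpenPartialHomeomorph.trans_source] at hy
    show S.hat o y = ψ (e y)
    rw [hψ, HasStrictFDerivAt.toOpenPartialHomeomorph_coe, e.left_inv hy.1]

theorem lt_radius_of_circle_nonempty {r r' : ℝ} (h : r < r') (h0 : 0 ≤ r)
    (hne : (S.circle o r').Nonempty) : (r : EReal) < S.radius o :=
  lt_of_lt_of_le (EReal.coe_lt_coe_iff.2 h) (le_sSup ⟨r', h0.trans_lt h, hne, rfl⟩)

/-- The map is open, so near any value it also takes values of larger modulus: the supremum defining
the radius is not attained. -/
theorem hat_lt_radius (hH : IsLocalHomeomorph (S.hat o)) (x : X) :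
    ((‖S.hat o x‖ : ℝ) : EReal) < S.radius o := by
  have hn : range (S.hat o) ∈ 𝓝 (S.hat o x) := hH.isOpenMap.range_mem_nhds x
  obtain ⟨ε, hε, hb⟩ := Metric.mem_nhds_iff.1 hn
  set w := S.hat o x with hw
  obtain ⟨v, hv1, hv2⟩ : ∃ v ∈ Metric.ball w ε, ‖w‖ < ‖v‖ := by
    rcases eq_or_ne w 0 with h0 | h0
    · refine ⟨((ε / 2 : ℝ) : ℂ), ?_, ?_⟩
      · rw [h0, mem_ball_zero_iff, Complex.norm_real, Real.norm_of_nonneg (by positivity)]; linarith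
      · rw [h0, norm_zero, Complex.norm_real, Real.norm_of_nonneg (by positivity)]; positivity
    · have hp := norm_pos_iff.2 h0
      set k := ε / (2 * ‖w‖) with hk
      have hk0 : 0 < k := by positivity
      refine ⟨((1 + k : ℝ) : ℂ) * w, ?_, ?_⟩
      · rw [mem_ball_iff_norm, show ((1 + k : ℝ) : ℂ) * w - w = (k : ℂ) * w by push_cast; ring,
          norm_mul, Complex.norm_real, Real.norm_of_nonneg hk0.le, hk]
        field_simp
        linarith
      · rw [norm_mul, Complex.norm_real, Real.norm_of_nonneg (by positivity)]
        nlinarith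
  obtain ⟨y, hy⟩ := hb hv1
  exact lt_radius_of_circle_nonempty hv2 (norm_nonneg _) ⟨y, by rw [circle, mem_ofPred_eq, hy]⟩

/-- The exhaustion property is tested on the radii `r`, `r + 1`, `r + 2`, …. The alternative that
already the first disc is all of `X` is excluded by a nonempty circle of radius greater than `r`. -/
theorem isCompact_closure_disc (hex : S.IsExhaustion o) {r : ℝ} (hr : 0 < r)
    (hrR : (r : EReal) < S.radius o) : IsCompact (closure (S.disc o r)) := by
  obtain ⟨-, h⟩ := hex (fun n => r + n) (fun m n hmn => by simpa using hmn)
    (fun n => by positivity) (tendsto_atTop_add_const_left _ _ tendsto_natCast_atTop_atTop)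
  rcases h with h | ⟨k, h1, h2⟩
  · simpa using (h 0).1
  · rcases Nat.eq_zero_or_pos k with hk | hk
    · exfalso
      have hu := h2 0 hk.le
      obtain ⟨ρ, ⟨r', -, ⟨y, hy⟩, rfl⟩, hlt⟩ := lt_sSup_iff.1 hrR
      have hy' : y ∈ S.disc o (r + (0 : ℕ)) := hu ▸ mem_univ y
      have h3 : ‖S.hat o y‖ = r' := hy
      have h4 : ‖S.hat o y‖ < r := by simpa [disc] using hy'
      have h5 : r < r' := by exact_mod_cast hlt
      linarith
    · simpa using (h1 0 hk).1

theorem existsUnique_hat_eq [T2Space X] [IsManifold 𝓘(ℂ) ω X] [ConnectedSpace X]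
    (hS : S.IsAdmissible o) (hex : S.IsExhaustion o) {w : ℂ}
    (hw : ((‖w‖ : ℝ) : EReal) < S.radius o) : ∃! x, S.hat o x = w := by
  have hH := isLocalHomeomorph_hat hS
  -- Three nested radii: the point lies in the open disc of radius `s`, properness is needed over
  -- the closed disc of radius `s'`, and it follows from compactness of the closure of the disc of
  -- radius `s''`.
  obtain ⟨s, hs, hsR⟩ := EReal.exists_real_gt hw
  obtain ⟨s', hs', hsR'⟩ := EReal.exists_real_gt hsR
  obtain ⟨s'', hs'', hsR''⟩ := EReal.exists_real_gt hsR'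
  have hs0 : 0 < s := (norm_nonneg w).trans_lt hs
  have hc := isCompact_closure_disc hex (by linarith) hsR''
  refine existsUnique_of_isLocalHomeomorph hH hs'
    (hc.of_isClosed_subset (Metric.isClosed_closedBall.preimage hH.continuous) ?_) hs0
    ⟨o, (hS.hat_eq_zero_iff o).2 rfl, fun x hx => (hS.hat_eq_zero_iff x).1 hx⟩
    (mem_ball_zero_iff.2 hs)
  refine Subset.trans (fun x hx => ?_) subset_closure
  rw [mem_preimage, mem_closedBall_zero_iff] at hx
  exact hx.trans_lt hs''

theorem isOpenEmbedding_hat [T2Space X] [IsManifold 𝓘(ℂ) ω X] [ConnectedSpace X]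
    (hS : S.IsAdmissible o) (hex : S.IsExhaustion o) : Topology.IsOpenEmbedding (S.hat o) := by
  have hH := isLocalHomeomorph_hat hS
  refine hH.isOpenEmbedding_of_injective fun x y hxy => ?_
  exact (existsUnique_hat_eq hS hex (hat_lt_radius hH x)).unique rfl hxy.symm

/-- The set of complex numbers of modulus less than `R`. -/
def _root_.HoloNevanlinna.openDisc (R : EReal) : Set ℂ := {w | ((‖w‖ : ℝ) : EReal) < R}

theorem range_hat [T2Space X] [IsManifold 𝓘(ℂ) ω X] [ConnectedSpace X]
    (hS : S.IsAdmissible o) (hex : S.IsExhaustion o) :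
    range (S.hat o) = openDisc (S.radius o) := by
  ext w
  constructor
  · rintro ⟨x, rfl⟩
    exact hat_lt_radius (isLocalHomeomorph_hat hS) x
  · intro hw
    exact (existsUnique_hat_eq hS hex hw).exists

end HolomorphicForm

theorem isOpen_openDisc (R : EReal) : IsOpen (openDisc R) :=
  isOpen_Iio.preimage (continuous_coe_real_ereal.comp continuous_norm)

theorem ball_subset_openDisc {R : EReal} {s : ℝ} (h : (s : EReal) ≤ R) :
    Metric.ball (0 : ℂ) s ⊆ openDisc R := fun z hz =>
  lt_of_lt_of_le (EReal.coe_lt_coe_iff.2 (mem_ball_zero_iff.1 hz)) h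

theorem isPreconnected_openDisc (R : EReal) : IsPreconnected (openDisc R) := by
  refine isPreconnected_of_forall 0 fun z hz => ⟨Metric.closedBall 0 ‖z‖, fun w hw => ?_,
    Metric.mem_closedBall_self (norm_nonneg _), by simp, Metric.isPreconnected_closedBall⟩
  exact lt_of_le_of_lt (EReal.coe_le_coe_iff.2 (mem_closedBall_zero_iff.1 hw)) hz

end HoloNevanlinna

namespace HoloNevanlinna

/-! ### Holomorphic maps from a disc to the sphere -/

@[simp] theorem affineCoord_infty : affineCoord OnePoint.infty = 0 := rfl

theorem affineCoordInv_eq (x : OnePoint ℂ) : affineCoordInv x = (affineCoord x)⁻¹ := by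
  induction x using OnePoint.rec with
  | infty => exact inv_zero.symm
  | coe w => rfl

theorem coe_affineCoord {x : OnePoint ℂ} (h : x ≠ OnePoint.infty) :
    ((affineCoord x : ℂ) : OnePoint ℂ) = x := by
  induction x using OnePoint.rec with
  | infty => exact absurd rfl h
  | coe w => rfl

/-- A holomorphic map from the disc of radius `R` to the Riemann sphere, which is not constant. -/
structure IsSphereMap (R : EReal) (F : ℂ → OnePoint ℂ) : Prop where
  continuousOn : ContinuousOn F (openDisc R)
  differentiableAt : ∀ w ∈ openDisc R, F w ≠ OnePoint.infty →
    DifferentiableAt ℂ (fun z => affineCoord (F z)) w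
  differentiableAt_inv : ∀ w ∈ openDisc R, F w ≠ ((0 : ℂ) : OnePoint ℂ) →
    DifferentiableAt ℂ (fun z => affineCoordInv (F z)) w
  nonconstant : ¬ ∃ c, ∀ w ∈ openDisc R, F w = c

namespace IsSphereMap

variable {R : EReal} {F : ℂ → OnePoint ℂ}

theorem eventually_ne (h : IsSphereMap R F) {w : ℂ} (hw : w ∈ openDisc R) {b : OnePoint ℂ}
    (hb : F w ≠ b) : ∀ᶠ z in 𝓝 w, z ∈ openDisc R ∧ F z ≠ b :=
  Filter.Eventually.and ((isOpen_openDisc R).mem_nhds hw)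
    ((h.continuousOn.continuousAt ((isOpen_openDisc R).mem_nhds hw)).eventually_ne hb)

theorem analyticAt (h : IsSphereMap R F) {w : ℂ} (hw : w ∈ openDisc R)
    (hb : F w ≠ OnePoint.infty) : AnalyticAt ℂ (fun z => affineCoord (F z)) w :=
  Complex.analyticAt_iff_eventually_differentiableAt.2
    ((h.eventually_ne hw hb).mono fun z hz => h.differentiableAt z hz.1 hz.2)

theorem analyticAt_inv (h : IsSphereMap R F) {w : ℂ} (hw : w ∈ openDisc R)
    (hb : F w = OnePoint.infty) : AnalyticAt ℂ (fun z => affineCoordInv (F z)) w :=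
  Complex.analyticAt_iff_eventually_differentiableAt.2
    ((h.eventually_ne hw (b := ((0 : ℂ) : OnePoint ℂ)) (by simp [hb])).mono
      fun z hz => h.differentiableAt_inv z hz.1 hz.2)

theorem affineCoord_eq_inv : (fun z => affineCoord (F z)) = (fun z => affineCoordInv (F z))⁻¹ := by
  ext z
  simp [affineCoordInv_eq]

theorem meromorphicOn (h : IsSphereMap R F) :
    MeromorphicOn (fun z => affineCoord (F z)) (openDisc R) := fun w hw => by
  by_cases hb : F w = OnePoint.infty
  · rw [affineCoord_eq_inv]
    exact (h.analyticAt_inv hw hb).meromorphicAt.inv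
  · exact (h.analyticAt hw hb).meromorphicAt

/-- The identity theorem spreads the equality over the disc. Since the coordinate of `∞` is `0` by
convention, it leaves `∞` and `c` as possible values of `F`. Continuity and connectedness then
select one of them, against nonconstancy. -/
theorem not_eventually_const (h : IsSphereMap R F) {w : ℂ} (hw : w ∈ openDisc R) (c : ℂ) :
    ¬ ∀ᶠ z in 𝓝[≠] w, affineCoord (F z) = c := by
  intro hc
  have hm : MeromorphicOn (fun z => affineCoord (F z) - c) (openDisc R) :=
    fun z hz => (h.meromorphicOn z hz).sub (MeromorphicAt.const c z)
  have hconn : IsConnected (openDisc R) := ⟨⟨w, hw⟩, isPreconnected_openDisc R⟩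
  have htop : ∀ z ∈ openDisc R, ∀ᶠ y in 𝓝[≠] z, affineCoord (F y) = c := by
    have hw' : meromorphicOrderAt (fun z => affineCoord (F z) - c) w = ⊤ :=
      meromorphicOrderAt_eq_top_iff.2 (hc.mono fun z hz => sub_eq_zero.2 hz)
    intro z hz
    by_contra hcon
    have hz' : meromorphicOrderAt (fun z => affineCoord (F z) - c) z ≠ ⊤ := fun ht =>
      hcon ((meromorphicOrderAt_eq_top_iff.1 ht).mono fun y hy => sub_eq_zero.1 hy)
    exact (hm.exists_meromorphicOrderAt_ne_top_iff_forall hconn).1 ⟨⟨z, hz⟩, hz'⟩ ⟨w, hw⟩ hw'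
  have hval : ∀ z ∈ openDisc R, F z = OnePoint.infty ∨ F z = c := by
    intro z hz
    have hcl : IsClosed ({OnePoint.infty, (c : OnePoint ℂ)} : Set (OnePoint ℂ)) :=
      (Set.toFinite _).isClosed
    have ht : Tendsto F (𝓝[≠] z) (𝓝 (F z)) :=
      (h.continuousOn.continuousAt ((isOpen_openDisc R).mem_nhds hz)).tendsto.mono_left
        nhdsWithin_le_nhds
    refine hcl.mem_of_tendsto ht ((htop z hz).mono fun y hy => ?_)
    by_cases hb : F y = OnePoint.infty
    · exact Or.inl hb
    · exact Or.inr (by rw [← coe_affineCoord hb, hy]; rfl)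
  have hO := isOpen_openDisc R
  have o1 : IsOpen (openDisc R ∩ F ⁻¹' {(OnePoint.infty : OnePoint ℂ)}ᶜ) :=
    h.continuousOn.isOpen_inter_preimage hO isOpen_compl_singleton
  have o2 : IsOpen (openDisc R ∩ F ⁻¹' {(c : OnePoint ℂ)}ᶜ) :=
    h.continuousOn.isOpen_inter_preimage hO isOpen_compl_singleton
  rcases (isPreconnected_iff_subset_of_disjoint.1 hconn.isPreconnected) _ _ o1 o2
    (fun z hz => by
      rcases hval z hz with e | e
      · right; exact ⟨hz, by simp [e]⟩
      · left; exact ⟨hz, by simp [e]⟩)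
    (by
      ext z
      simp only [mem_inter_iff, mem_preimage, mem_compl_iff, mem_singleton_iff, mem_empty_iff_false,
        iff_false]
      rintro ⟨hz, ⟨-, h1⟩, -, h2⟩
      exact (hval z hz).elim h1 h2) with hs | hs
  · exact h.nonconstant ⟨c, fun z hz => (hval z hz).resolve_left (hs hz).2⟩
  · exact h.nonconstant ⟨OnePoint.infty, fun z hz => (hval z hz).resolve_right (hs hz).2⟩

theorem meromorphicOrderAt_ne_top (h : IsSphereMap R F) {w : ℂ} (hw : w ∈ openDisc R) :
    meromorphicOrderAt (fun z => affineCoord (F z)) w ≠ ⊤ := fun ht =>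
  h.not_eventually_const hw 0 (meromorphicOrderAt_eq_top_iff.1 ht)

/-- The affine coordinate has the junk value `0` at a pole, so poles are visible only through the
order. There the inverse coordinate is analytic with a zero. -/
theorem order_neg_iff (h : IsSphereMap R F) {w : ℂ} (hw : w ∈ openDisc R) :
    (meromorphicOrderAt (fun z => affineCoord (F z)) w).untop₀ < 0 ↔ F w = OnePoint.infty := by
  have hne := h.meromorphicOrderAt_ne_top hw
  by_cases hb : F w = OnePoint.infty
  · refine iff_of_true ?_ hb
    rw [affineCoord_eq_inv, meromorphicOrderAt_inv] at hne ⊢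
    have ha := h.analyticAt_inv hw hb
    have h0 : analyticOrderAt (fun z => affineCoordInv (F z)) w ≠ 0 :=
      ha.analyticOrderAt_ne_zero.2 (by simp [hb, affineCoordInv_eq])
    rw [ha.meromorphicOrderAt_eq] at hne ⊢
    cases hn : analyticOrderAt (fun z => affineCoordInv (F z)) w with
    | top => rw [hn] at hne; exact absurd rfl hne
    | coe n =>
      rw [hn] at h0
      have : n ≠ 0 := by exact_mod_cast h0
      have e : (-(ENat.map (fun x : ℕ => (x : ℤ)) (n : ℕ∞)) : WithTop ℤ) = ((-(n : ℤ) : ℤ) : WithTop ℤ) := rfl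
      rw [e, WithTop.untop₀_coe]
      omega
  · refine iff_of_false ?_ hb
    have := (h.analyticAt hw hb).meromorphicOrderAt_nonneg
    lift meromorphicOrderAt (fun z => affineCoord (F z)) w to ℤ using hne with n hn
    rw [WithTop.untop₀_coe]
    have : 0 ≤ n := by exact_mod_cast this
    omega

/-- On each smaller disc, the map is the quotient of two holomorphic functions without common
zeros. -/
theorem exists_pair (h : IsSphereMap R F) {s : ℝ} (hs : (s : EReal) < R) : ∃ p q, IsHoloPair s p q ∧
    ∀ z ∈ Metric.ball (0 : ℂ) s, (F z = OnePoint.infty ↔ p z = 0) ∧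
      (p z ≠ 0 → affineCoord (F z) = q z / p z) := by
  classical
  have hsub : Metric.closedBall (0 : ℂ) s ⊆ openDisc R := fun z hz =>
    lt_of_le_of_lt (EReal.coe_le_coe_iff.2 (mem_closedBall_zero_iff.1 hz)) hs
  set f : ℂ → ℂ := fun z => affineCoord (F z) with hf
  have hm : MeromorphicOn f (Metric.closedBall 0 s) := fun z hz => h.meromorphicOn z (hsub hz)
  set D := MeromorphicOn.divisor f (Metric.closedBall 0 s) with hD
  have hfin : D.support.Finite := D.finiteSupport (isCompact_closedBall 0 s)
  obtain ⟨g, hg, hg0, hfg⟩ := hm.extract_zeros_poles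
    (fun u => h.meromorphicOrderAt_ne_top (hsub u.2)) hfin
  set T := hfin.toFinset with hT
  have hDz : ∀ z ∈ Metric.ball (0 : ℂ) s, (D z < 0 ↔ F z = OnePoint.infty) := fun z hz => by
    have hz' := Metric.ball_subset_closedBall hz
    rw [hD, hm.divisor_apply hz', h.order_neg_iff (hsub hz')]
  -- The divisor is split by sign: `p` collects the poles, `q` the zeros and the zero-free factor.
  -- No point has positive and negative order at once, so there are no common zeros.
  set p : ℂ → ℂ := fun w => ∏ u ∈ T, (w - u) ^ (-D u).toNat with hp
  set q : ℂ → ℂ := fun w => (∏ u ∈ T, (w - u) ^ (D u).toNat) * g w with hq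
  have hpdiff : Differentiable ℂ p := by fun_prop
  have hqdiff : ∀ z ∈ Metric.ball (0 : ℂ) s, DifferentiableAt ℂ q z := fun z hz => by
    have := (hg z (Metric.ball_subset_closedBall hz)).differentiableAt
    fun_prop
  have hp0 : ∀ z ∈ Metric.ball (0 : ℂ) s, p z = 0 ↔ D z < 0 := by
    intro z hz
    simp only [hp, Finset.prod_eq_zero_iff]
    constructor
    · rintro ⟨u, hu, hu0⟩
      by_cases hn : (-D u).toNat = 0
      · simp [hn] at hu0
      · have := sub_eq_zero.1 (eq_zero_of_pow_eq_zero hu0)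
        subst this
        omega
    · intro hlt
      refine ⟨z, by simp [hT, hlt.ne], ?_⟩
      rw [sub_self]
      exact zero_pow (by omega)
  have hq0 : ∀ z ∈ Metric.ball (0 : ℂ) s, q z = 0 → 0 < D z := by
    intro z hz hqz
    rcases mul_eq_zero.1 hqz with h1 | h1
    · obtain ⟨u, hu, hu0⟩ := Finset.prod_eq_zero_iff.1 h1
      by_cases hn : (D u).toNat = 0
      · simp [hn] at hu0
      · have := sub_eq_zero.1 (eq_zero_of_pow_eq_zero hu0)
        subst this
        omega
    · exact absurd h1 (hg0 ⟨z, Metric.ball_subset_closedBall hz⟩)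
  refine ⟨p, q, ⟨hpdiff.differentiableOn, fun z hz => (hqdiff z hz).differentiableWithinAt, ?_⟩, ?_⟩
  · intro z hz
    by_contra! hcon
    have h1 := (hp0 z hz).1 hcon.1
    have h2 := hq0 z hz hcon.2
    omega
  · intro z hz
    refine ⟨by rw [hp0 z hz, hDz z hz], fun hpz => ?_⟩
    have hzF : F z ≠ OnePoint.infty := fun e => hpz ((hp0 z hz).2 ((hDz z hz).2 e))
    have hz' := Metric.ball_subset_closedBall hz
    have c1 : ContinuousAt f z := (h.analyticAt (hsub hz') hzF).continuousAt
    have c2 : ContinuousAt (fun w => q w / p w) z :=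
      (hqdiff z hz).continuousAt.div hpdiff.continuous.continuousAt hpz
    -- The factorisation determines `f` only off a discrete set; continuity of both sides at `z`
    -- supplies the value there.
    have hev : f =ᶠ[𝓝[≠] z] fun w => q w / p w := by
      have h1 := mem_codiscreteWithin_iff_forall_mem_nhdsNE.1 hfg z hz'
      have h2 : ∀ᶠ w in 𝓝[≠] z, w ∈ Metric.ball (0 : ℂ) s :=
        nhdsWithin_le_nhds (Metric.isOpen_ball.mem_nhds hz)
      have h3 : ∀ᶠ w in 𝓝[≠] z, w ∉ T := by
        have hcl : IsClosed ((T : Set ℂ) \ {z}) := (T.finite_toSet.sdiff).isClosed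
        have := hcl.isOpen_compl.mem_nhds (x := z) (by simp)
        filter_upwards [nhdsWithin_le_nhds this, self_mem_nhdsWithin] with w hw1 hw2 hw3
        exact hw1 ⟨hw3, hw2⟩
      filter_upwards [h1, h2, h3] with w hw1 hw2 hw3
      have hw1' : f w = ((∏ᶠ u, (· - u) ^ D u) • g) w :=
        hw1.resolve_right fun hn => hn (Metric.ball_subset_closedBall hw2)
      rw [hw1', Pi.smul_apply', smul_eq_mul, Function.FactorizedRational.finprod_eq_fun hfin]
      have e : (∏ᶠ u, (w - u) ^ D u) = ∏ u ∈ T, (w - u) ^ D u := by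
        refine finprod_eq_prod_of_mulSupport_subset _ fun u hu => ?_
        rw [Function.mem_mulSupport] at hu
        rw [hT, Set.Finite.coe_toFinset, Function.mem_support]
        intro h0
        exact hu (by rw [h0, zpow_zero])
      have e2 : ∏ u ∈ T, (w - u) ^ D u =
          (∏ u ∈ T, (w - u) ^ (D u).toNat) / ∏ u ∈ T, (w - u) ^ (-D u).toNat := by
        rw [← Finset.prod_div_distrib]
        refine Finset.prod_congr rfl fun u hu => ?_
        have hwu : w - u ≠ 0 := sub_ne_zero.2 fun e => hw3 (e ▸ hu)
        rw [← zpow_natCast, ← zpow_natCast, ← zpow_sub₀ hwu, Int.toNat_sub_toNat_neg]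
      beta_reduce
      rw [e, e2]
      simp only [hq, hp]
      ring
    have t1 : Tendsto f (𝓝[≠] z) (𝓝 (f z)) := c1.tendsto.mono_left nhdsWithin_le_nhds
    have t2 := (c2.tendsto.mono_left nhdsWithin_le_nhds).congr' hev.symm
    exact tendsto_nhds_unique t1 t2

end IsSphereMap

end HoloNevanlinna

/-! ### Chordal distances and the Fubini-Study density on the sphere -/

namespace HoloNevanlinna

/-- The unit covector which vanishes at a point of the sphere. -/
def sphereCovector (b : OnePoint ℂ) : ℂ × ℂ :=
  b.elim (1, 0) fun w =>
    (-w / ((√(1 + ‖w‖ ^ 2) : ℝ) : ℂ), 1 / ((√(1 + ‖w‖ ^ 2) : ℝ) : ℂ))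

/-- The squared chordal distance of a point to the zero of a covector. -/
def sphereChord (c : ℂ × ℂ) (x : OnePoint ℂ) : ℝ :=
  x.elim (‖c.2‖ ^ 2) fun w => ‖c.1 + c.2 * w‖ ^ 2 / (1 + ‖w‖ ^ 2)

theorem sphereCovector_infty : sphereCovector OnePoint.infty = (1, 0) := rfl

theorem sphereCovector_coe (w : ℂ) : sphereCovector (w : OnePoint ℂ) =
    (-w / ((√(1 + ‖w‖ ^ 2) : ℝ) : ℂ), 1 / ((√(1 + ‖w‖ ^ 2) : ℝ) : ℂ)) := rfl

theorem sphereChord_infty (c : ℂ × ℂ) : sphereChord c OnePoint.infty = ‖c.2‖ ^ 2 := rfl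

theorem sphereChord_coe (c : ℂ × ℂ) (w : ℂ) :
    sphereChord c (w : OnePoint ℂ) = ‖c.1 + c.2 * w‖ ^ 2 / (1 + ‖w‖ ^ 2) := rfl

theorem sqrt_one_add_ne_zero (w : ℂ) : ((√(1 + ‖w‖ ^ 2) : ℝ) : ℂ) ≠ 0 :=
  Complex.ofReal_ne_zero.2 (Real.sqrt_ne_zero'.2 (by positivity))

theorem norm_sphereCovector (b : OnePoint ℂ) :
    ‖(sphereCovector b).1‖ ^ 2 + ‖(sphereCovector b).2‖ ^ 2 = 1 := by
  induction b using OnePoint.rec with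
  | infty => simp [sphereCovector_infty]
  | coe w =>
    have h : (0 : ℝ) < 1 + ‖w‖ ^ 2 := by positivity
    rw [sphereCovector_coe]
    simp only [norm_div, norm_neg, norm_one, Complex.norm_real, Real.norm_eq_abs, div_pow, sq_abs,
      Real.sq_sqrt h.le]
    field_simp
    ring

theorem sphereCovector_independent {b b' : OnePoint ℂ} (h : b ≠ b') :
    (sphereCovector b).1 * (sphereCovector b').2 -
      (sphereCovector b).2 * (sphereCovector b').1 ≠ 0 := by
  induction b using OnePoint.rec with
  | infty =>
    induction b' using OnePoint.rec with
    | infty => exact absurd rfl h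
    | coe w => simpa [sphereCovector_infty, sphereCovector_coe] using sqrt_one_add_ne_zero w
  | coe w =>
    induction b' using OnePoint.rec with
    | infty => simpa [sphereCovector_infty, sphereCovector_coe] using sqrt_one_add_ne_zero w
    | coe w' =>
      have hw : w' - w ≠ 0 := sub_ne_zero.2 fun e => h (by rw [e])
      have h1 := sqrt_one_add_ne_zero w
      have h2 := sqrt_one_add_ne_zero w'
      rw [sphereCovector_coe, sphereCovector_coe]
      have e : -w / ((√(1 + ‖w‖ ^ 2) : ℝ) : ℂ) * (1 / ((√(1 + ‖w'‖ ^ 2) : ℝ) : ℂ)) -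
          1 / ((√(1 + ‖w‖ ^ 2) : ℝ) : ℂ) * (-w' / ((√(1 + ‖w'‖ ^ 2) : ℝ) : ℂ)) =
          (w' - w) / (((√(1 + ‖w‖ ^ 2) : ℝ) : ℂ) * ((√(1 + ‖w'‖ ^ 2) : ℝ) : ℂ)) := by
        field_simp
        ring
      simp only
      rw [e]
      exact div_ne_zero hw (mul_ne_zero h1 h2)

theorem sphereChord_eq_zero_iff {b x : OnePoint ℂ} : sphereChord (sphereCovector b) x = 0 ↔ x = b := by
  induction x using OnePoint.rec with
  | infty =>
    induction b using OnePoint.rec with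
    | infty => simp [sphereChord_infty, sphereCovector_infty]
    | coe w =>
      have := sqrt_one_add_ne_zero w
      simpa [sphereChord_infty, sphereCovector_coe] using this
  | coe z =>
    have hz : (1 : ℝ) + ‖z‖ ^ 2 ≠ 0 := by positivity
    induction b using OnePoint.rec with
    | infty => simpa [sphereChord_coe, sphereCovector_infty] using hz
    | coe w =>
      have h1 := sqrt_one_add_ne_zero w
      have e : -w / ((√(1 + ‖w‖ ^ 2) : ℝ) : ℂ) + 1 / ((√(1 + ‖w‖ ^ 2) : ℝ) : ℂ) * z =
          (z - w) / ((√(1 + ‖w‖ ^ 2) : ℝ) : ℂ) := by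
        field_simp
        ring
      rw [sphereChord_coe, sphereCovector_coe]
      simp only
      rw [e, div_eq_zero_iff, or_iff_left hz, pow_eq_zero_iff two_ne_zero, norm_eq_zero,
        div_eq_zero_iff, or_iff_left h1, sub_eq_zero, OnePoint.coe_eq_coe]

open Classical in
/-- The density of the pull-back of the Fubini-Study form by a map from the plane. -/
def fsDensity (F : ℂ → OnePoint ℂ) (z : ℂ) : ℝ :=
  if F z = OnePoint.infty then
    ‖deriv (fun w => affineCoordInv (F w)) z‖ ^ 2 /
      (Real.pi * (1 + ‖affineCoordInv (F z)‖ ^ 2) ^ 2)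
  else
    ‖deriv (fun w => affineCoord (F w)) z‖ ^ 2 /
      (Real.pi * (1 + ‖affineCoord (F z)‖ ^ 2) ^ 2)

theorem norm_deriv_div_sq {u v : ℂ → ℂ} {z : ℂ} (hu : DifferentiableAt ℂ u z)
    (hv : DifferentiableAt ℂ v z) (hz : v z ≠ 0) :
    ‖deriv (fun w => u w / v w) z‖ ^ 2 / (Real.pi * (1 + ‖u z / v z‖ ^ 2) ^ 2) =
      sphDensity u v z / Real.pi := by
  have hn : ‖v z‖ ≠ 0 := norm_ne_zero_iff.2 hz
  have h2 : ‖u z‖ ^ 2 + ‖v z‖ ^ 2 ≠ 0 := by positivity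
  have h3 : ‖v z‖ ^ 2 + ‖u z‖ ^ 2 ≠ 0 := by positivity
  have hpi := Real.pi_ne_zero
  rw [deriv_fun_div hu hv hz, sphDensity, wronskian, normSum, norm_div, norm_div, norm_pow]
  field_simp
  ring

theorem sphDensity_swap (u v : ℂ → ℂ) (z : ℂ) : sphDensity u v z = sphDensity v u z := by
  rw [sphDensity, sphDensity, normSum, normSum, wronskian, wronskian, ← norm_neg]
  congr 2
  · congr 1; ring_nf
  · ring

theorem IsHoloPair.sphereChord_eq {s : ℝ} {p q : ℂ → ℂ} (h : IsHoloPair s p q) {z : ℂ}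
    (hz : z ∈ Metric.ball (0 : ℂ) s) {x : OnePoint ℂ} (hx : x = OnePoint.infty ↔ p z = 0)
    (hx' : p z ≠ 0 → affineCoord x = q z / p z) {c : ℂ × ℂ} (hc : ‖c.1‖ ^ 2 + ‖c.2‖ ^ 2 = 1) :
    sphereChord c x = chordSq (linForm c p q) (coForm c p q) z := by
  rw [chordSq, normSum_linForm hc, linForm, normSum]
  induction x using OnePoint.rec with
  | infty =>
    have hp := hx.1 rfl
    have hq : q z ≠ 0 := (h.ne_zero z hz).resolve_left (not_not_intro hp)
    have := norm_ne_zero_iff.2 hq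
    rw [sphereChord_infty, hp]
    simp only [mul_zero, zero_add, norm_zero, norm_mul]
    field_simp
    ring
  | coe w =>
    have hp : p z ≠ 0 := fun e => OnePoint.coe_ne_infty w (hx.2 e)
    have hw : w = q z / p z := hx' hp
    have hn := norm_ne_zero_iff.2 hp
    have e : c.1 + c.2 * w = (c.1 * p z + c.2 * q z) / p z := by rw [hw]; field_simp
    have h3 : ‖p z‖ ^ 2 + ‖q z‖ ^ 2 ≠ 0 := by positivity
    rw [sphereChord_coe, e, hw, norm_div, norm_div]
    field_simp

namespace IsSphereMap

variable {R : EReal} {F : ℂ → OnePoint ℂ}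

theorem fsDensity_eq {s : ℝ} {p q : ℂ → ℂ} (hp : IsHoloPair s p q)
    (hpq : ∀ z ∈ Metric.ball (0 : ℂ) s, (F z = OnePoint.infty ↔ p z = 0) ∧
      (p z ≠ 0 → affineCoord (F z) = q z / p z)) {z : ℂ} (hz : z ∈ Metric.ball (0 : ℂ) s) :
    fsDensity F z = sphDensity p q z / Real.pi := by
  have hn := Metric.isOpen_ball.mem_nhds hz
  have dp := hp.left.differentiableAt hn
  have dq := hp.right.differentiableAt hn
  by_cases hF : F z = OnePoint.infty
  · have hp0 := (hpq z hz).1.1 hF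
    have hq : q z ≠ 0 := (hp.ne_zero z hz).resolve_left (not_not_intro hp0)
    have hval : ∀ w ∈ Metric.ball (0 : ℂ) s, affineCoordInv (F w) = p w / q w := by
      intro w hw
      rw [affineCoordInv_eq]
      by_cases hw0 : p w = 0
      · rw [(hpq w hw).1.2 hw0, hw0]; simp
      · rw [(hpq w hw).2 hw0, inv_div]
    have hev : (fun w => affineCoordInv (F w)) =ᶠ[𝓝 z] fun w => p w / q w := by
      filter_upwards [hn] with w hw using hval w hw
    rw [fsDensity, if_pos hF, hev.deriv_eq, hval z hz, norm_deriv_div_sq dp dq hq]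
  · have hp0 : p z ≠ 0 := fun e => hF ((hpq z hz).1.2 e)
    have hev : (fun w => affineCoord (F w)) =ᶠ[𝓝 z] fun w => q w / p w := by
      filter_upwards [hn, dp.continuousAt.eventually_ne hp0] with w hw hw0 using (hpq w hw).2 hw0
    rw [fsDensity, if_neg hF, hev.deriv_eq, (hpq z hz).2 hp0, norm_deriv_div_sq dq dp hp0,
      sphDensity_swap]

/-- A density vanishing everywhere would make the affine coordinate constant near a finite value,
which `not_eventually_const` forbids. -/
theorem exists_fsDensity_ne_zero (h : IsSphereMap R F) : ∃ z ∈ openDisc R, fsDensity F z ≠ 0 := by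
  by_contra! hcon
  obtain ⟨z, hz, hzF⟩ : ∃ z ∈ openDisc R, F z ≠ OnePoint.infty := by
    by_contra! hinf
    exact h.nonconstant ⟨_, hinf⟩
  obtain ⟨ε, hε, hb⟩ := Metric.mem_nhds_iff.1 (h.eventually_ne hz hzF)
  have hd : DifferentiableOn ℂ (fun w => affineCoord (F w)) (Metric.ball z ε) := fun w hw =>
    (h.differentiableAt w (hb hw).1 (hb hw).2).differentiableWithinAt
  obtain ⟨c, hc⟩ := Metric.isOpen_ball.exists_is_const_of_fderiv_eq_zero
    Metric.isPreconnected_ball hd fun w hw => by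
      have h0 := hcon w (hb hw).1
      rw [fsDensity, if_neg (hb hw).2, div_eq_zero_iff] at h0
      have h1 : Real.pi * (1 + ‖affineCoord (F w)‖ ^ 2) ^ 2 ≠ 0 := by positivity
      have h2 := norm_eq_zero.1 (pow_eq_zero_iff two_ne_zero |>.1 (h0.resolve_right h1))
      ext1
      simpa using h2
  exact h.not_eventually_const hz c (nhdsWithin_le_nhds
    (Filter.mem_of_superset (Metric.ball_mem_nhds z hε) hc))

theorem continuousOn_of_eqOn_ball {f : ℂ → ℝ} (h : ∀ s : ℝ, (s : EReal) < R →
    ∃ g, ContinuousOn g (Metric.ball (0 : ℂ) s) ∧ EqOn f g (Metric.ball 0 s)) :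
    ContinuousOn f (openDisc R) := by
  intro w hw
  obtain ⟨s, hs, hsR⟩ := EReal.exists_real_gt hw
  obtain ⟨g, hg, hfg⟩ := h s hsR
  have hn := Metric.isOpen_ball.mem_nhds (show w ∈ Metric.ball (0 : ℂ) s by simpa using hs)
  exact ((hg.congr hfg).continuousAt hn).continuousWithinAt

theorem measurable_indicator {f : ℂ → ℝ} (h : ContinuousOn f (openDisc R)) :
    Measurable ((openDisc R).indicator f) := by
  classical
  rw [← Set.piecewise_eq_indicator]
  exact h.measurable_piecewise continuousOn_const (isOpen_openDisc R).measurableSet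

/-- The indicators are there because `F` is arbitrary outside the disc, while the growth lemma needs
functions measurable on the whole plane. The factor `π` undoes the normalisation of the Fubini-Study
form. -/
theorem isCurveData (h : IsSphereMap R F) {m : ℕ} {b : Fin m → OnePoint ℂ}
    (hb : Function.Injective b) :
    IsCurveData R (fun j => sphereCovector (b j))
      ((openDisc R).indicator fun z => Real.pi * fsDensity F z)
      (fun j => (openDisc R).indicator fun z => sphereChord (sphereCovector (b j)) (F z)) where
  unit j := norm_sphereCovector (b j)
  independent i j hij := sphereCovector_independent (hb.ne hij)
  measurable_density := measurable_indicator <| continuousOn_of_eqOn_ball fun s hs => by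
    obtain ⟨p, q, hp, hpq⟩ := h.exists_pair hs
    refine ⟨_, hp.continuousOn_sphDensity, fun z hz => ?_⟩
    simp only [fsDensity_eq hp hpq hz]
    field_simp
  measurable_chord j := measurable_indicator <| continuousOn_of_eqOn_ball fun s hs => by
    obtain ⟨p, q, hp, hpq⟩ := h.exists_pair hs
    refine ⟨_, (hp.linForm_pair (norm_sphereCovector (b j))).continuousOn_chordSq, fun z hz => ?_⟩
    exact hp.sphereChord_eq hz (hpq z hz).1 (hpq z hz).2 (norm_sphereCovector (b j))
  exists_pair s hs := by
    obtain ⟨p, q, hp, hpq⟩ := h.exists_pair hs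
    refine ⟨p, q, hp, fun z hz => ?_⟩
    have hz' := ball_subset_openDisc hs.le hz
    simp only [indicator_of_mem hz']
    refine ⟨?_, fun j => hp.sphereChord_eq hz (hpq z hz).1 (hpq z hz).2 (norm_sphereCovector (b j))⟩
    rw [fsDensity_eq hp hpq hz]
    field_simp
  nonconstant := by
    obtain ⟨z, hz, hz0⟩ := h.exists_fsDensity_ne_zero
    refine ⟨z, hz, ?_⟩
    rw [indicator_of_mem hz]
    exact mul_ne_zero Real.pi_ne_zero hz0

end IsSphereMap

end HoloNevanlinna

namespace HoloNevanlinna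

/-! ### Transfer to the surface -/

/-- The value of the measure defined by a density on a chart domain. -/
theorem map_withDensity_apply {X : Type*} [TopologicalSpace X] [MeasurableSpace X] [BorelSpace X] (e : OpenPartialHomeomorph X ℂ)
    (u : ℂ → ℝ≥0∞) {A : Set X} (hA : MeasurableSet A) :
    Measure.map e.symm ((volume.restrict e.target).withDensity u) A =
      ∫⁻ z in e.target ∩ e.symm ⁻¹' A, u z := by
  have hm : AEMeasurable e.symm ((volume.restrict e.target).withDensity u) :=
    (e.continuousOn_symm.aemeasurable e.open_target.measurableSet).mono_ac
      (withDensity_absolutelyContinuous _ _)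
  rw [Measure.map_apply_of_aemeasurable hm hA, withDensity_apply',
    Measure.restrict_restrict' e.open_target.measurableSet, inter_comm]

variable {X : Type*} [TopologicalSpace X] [ChartedSpace ℂ X]

/-- A biholomorphic map of the surface onto the disc of radius `R`. -/
structure IsGlobalChart (Φ : OpenPartialHomeomorph X ℂ) (R : EReal) : Prop where
  source_eq : Φ.source = univ
  target_eq : Φ.target = openDisc R
  differentiableAt : ∀ e ∈ atlas ℂ X, ∀ w ∈ e.target, DifferentiableAt ℂ (fun z => Φ (e.symm z)) w
  deriv_ne_zero : ∀ e ∈ atlas ℂ X, ∀ w ∈ e.target, deriv (fun z => Φ (e.symm z)) w ≠ 0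

theorem det_smul_one (c : ℂ) : (c • (1 : ℂ →L[ℝ] ℂ)).det = ‖c‖ ^ 2 := by
  have h := Algebra.norm_complex_apply c
  rw [Algebra.norm_apply, Complex.normSq_eq_norm_sq] at h
  rw [← h]
  rfl

/-- A measure is the supremum of its restrictions to the domains of the charts. -/
theorem iSup_restrict_source [SecondCountableTopology X] [MeasurableSpace X] [BorelSpace X]
    (ν : Measure X) (μ : OpenPartialHomeomorph X ℂ → Measure X)
    (h : ∀ e ∈ atlas ℂ X, μ e = ν.restrict e.source) : ⨆ e ∈ atlas ℂ X, μ e = ν := by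
  have hle : ⨆ e ∈ atlas ℂ X, μ e ≤ ν := iSup₂_le fun e he => (h e he).trans_le Measure.restrict_le_self
  -- Countably many chart domains cover the surface, and a measure is determined by its restrictions
  -- to them.
  obtain ⟨s, hs, hcover⟩ := TopologicalSpace.countable_cover_nhds
    (fun x : X => chart_source_mem_nhds ℂ x)
  refine (Measure.ext_iff_of_biUnion_eq_univ hs hcover).2 fun x _ => ?_
  have he := chart_mem_atlas ℂ x
  refine le_antisymm (Measure.restrict_mono Subset.rfl hle) ?_
  calc ν.restrict (chartAt ℂ x).source = (μ (chartAt ℂ x)).restrict (chartAt ℂ x).source := by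
        rw [h _ he, Measure.restrict_restrict (chartAt ℂ x).open_source.measurableSet, inter_self]
    _ ≤ _ := Measure.restrict_mono Subset.rfl (le_iSup₂ (f := fun e _ => μ e) _ he)

namespace IsGlobalChart

variable {Φ : OpenPartialHomeomorph X ℂ} {R : EReal} {f : X → OnePoint ℂ}

theorem left_inv (h : IsGlobalChart Φ R) (x : X) : Φ.symm (Φ x) = x :=
  Φ.left_inv (h.source_eq ▸ mem_univ x)

theorem differentiableAt_chart_symm (h : IsGlobalChart Φ R) {w : ℂ} (hw : w ∈ openDisc R)
    {e : OpenPartialHomeomorph X ℂ} (he : e ∈ atlas ℂ X) (hs : Φ.symm w ∈ e.source) :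
    DifferentiableAt ℂ (fun z => e (Φ.symm z)) w := by
  have hwt : w ∈ Φ.target := h.target_eq ▸ hw
  have ht := e.map_source hs
  have hT : w ∈ (e.symm.trans Φ).target := by
    rw [OpenPartialHomeomorph.trans_target]
    exact ⟨hwt, hs⟩
  have hd : HasDerivAt (e.symm.trans Φ) (deriv (fun z => Φ (e.symm z)) (e (Φ.symm w)))
      ((e.symm.trans Φ).symm w) := (h.differentiableAt e he _ ht).hasDerivAt
  exact ((e.symm.trans Φ).hasDerivAt_symm hT (h.deriv_ne_zero e he _ ht) hd).differentiableAt

theorem isSphereMap (h : IsGlobalChart Φ R) (hf : IsMeromorphic f) (hfc : ¬ ∃ c, ∀ x, f x = c) :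
    IsSphereMap R fun z => f (Φ.symm z) := by
  have hcont : ∀ w ∈ openDisc R, ContinuousAt Φ.symm w := fun w hw =>
    Φ.symm.continuousAt (by rw [Φ.symm_source, h.target_eq]; exact hw)
  have key : ∀ (g : OnePoint ℂ → ℂ) (b : OnePoint ℂ), (∀ e ∈ atlas ℂ X,
      DifferentiableOn ℂ (fun z => g (f (e.symm z))) (e.target ∩ {z | f (e.symm z) ≠ b})) →
      ∀ w ∈ openDisc R, f (Φ.symm w) ≠ b → DifferentiableAt ℂ (fun z => g (f (Φ.symm z))) w := by
    intro g b hg w hw hb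
    set e := chartAt ℂ (Φ.symm w)
    have he := chart_mem_atlas ℂ (Φ.symm w)
    have hs := mem_chart_source ℂ (Φ.symm w)
    have hO : IsOpen (e.target ∩ {z | f (e.symm z) ≠ b}) :=
      (hf.1.comp_continuousOn e.continuousOn_symm).isOpen_inter_preimage e.open_target
        (isOpen_compl_singleton (x := b))
    have hd : DifferentiableAt ℂ (fun z => g (f (e.symm z))) (e (Φ.symm w)) :=
      (hg e he).differentiableAt (hO.mem_nhds ⟨e.map_source hs, by
        show f (e.symm (e (Φ.symm w))) ≠ b
        rwa [e.left_inv hs]⟩)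
    refine (hd.comp w (h.differentiableAt_chart_symm hw he hs)).congr_of_eventuallyEq ?_
    filter_upwards [(hcont w hw).preimage_mem_nhds (e.open_source.mem_nhds hs)] with z hz
    have : e.symm (e (Φ.symm z)) = Φ.symm z := e.left_inv hz
    show _ = g (f (e.symm (e (Φ.symm z))))
    rw [this]
  refine ⟨?_, key _ _ fun e he => (hf.2 e he).1, key _ _ fun e he => (hf.2 e he).2, ?_⟩
  · exact fun w hw => (hf.1.continuousAt.comp (hcont w hw)).continuousWithinAt
  · rintro ⟨c, hc⟩
    refine hfc ⟨c, fun x => ?_⟩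
    have hx : Φ x ∈ openDisc R := by
      rw [← h.target_eq]
      exact Φ.map_source (h.source_eq ▸ mem_univ x)
    rw [← hc _ hx, h.left_inv]

theorem pullbackFS_eq (h : IsGlobalChart Φ R) (hF : IsSphereMap R fun z => f (Φ.symm z))
    {e : OpenPartialHomeomorph X ℂ} (he : e ∈ atlas ℂ X) {z : ℂ} (hz : z ∈ e.target) :
    pullbackFS f e z = ‖deriv (fun w => Φ (e.symm w)) z‖ ^ 2 *
      fsDensity (fun w => f (Φ.symm w)) (Φ (e.symm z)) := by
  have hm : Φ (e.symm z) ∈ openDisc R := by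
    rw [← h.target_eq]
    exact Φ.map_source (h.source_eq ▸ mem_univ _)
  have hd := h.differentiableAt e he z hz
  have hcomp : ∀ g : OnePoint ℂ → ℂ, (fun w => g (f (e.symm w))) =
      (fun w => g (f (Φ.symm w))) ∘ fun w => Φ (e.symm w) := fun g => by
    ext w
    simp only [Function.comp, h.left_inv]
  have hderiv : ∀ g : OnePoint ℂ → ℂ,
      DifferentiableAt ℂ (fun w => g (f (Φ.symm w))) (Φ (e.symm z)) →
      deriv (fun w => g (f (e.symm w))) z =
        deriv (fun w => g (f (Φ.symm w))) (Φ (e.symm z)) * deriv (fun w => Φ (e.symm w)) z :=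
    fun g hg => by
      rw [hcomp g]
      exact (hg.hasDerivAt.comp z hd.hasDerivAt).deriv
  by_cases hb : f (e.symm z) = OnePoint.infty
  · have hb' : f (Φ.symm (Φ (e.symm z))) = OnePoint.infty := by rwa [h.left_inv]
    rw [pullbackFS, if_pos hb, fsDensity, if_pos hb', hderiv _ (hF.analyticAt_inv hm hb').differentiableAt,
      h.left_inv, norm_mul]
    ring
  · have hb' : f (Φ.symm (Φ (e.symm z))) ≠ OnePoint.infty := by rwa [h.left_inv]
    rw [pullbackFS, if_neg hb, fsDensity, if_neg hb', hderiv _ (hF.analyticAt hm hb').differentiableAt,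
      h.left_inv, norm_mul]
    ring

theorem ncard_preimage_ball (h : IsGlobalChart Φ R) {t : ℝ} (ht : (t : EReal) ≤ R)
    (b : OnePoint ℂ) : {x | x ∈ Φ ⁻¹' Metric.ball 0 t ∧ f x = b}.ncard =
      {z | z ∈ Metric.ball (0 : ℂ) t ∧ f (Φ.symm z) = b}.ncard := by
  have hemb : Topology.IsOpenEmbedding Φ := Φ.isOpenEmbedding h.source_eq
  rw [← ncard_image_of_injective _ hemb.injective]
  congr 1
  ext w
  constructor
  · rintro ⟨x, ⟨hx, hfx⟩, rfl⟩
    exact ⟨hx, by rwa [h.left_inv]⟩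
  · rintro ⟨hw, hfw⟩
    have hwt : w ∈ Φ.target := h.target_eq ▸ ball_subset_openDisc ht hw
    exact ⟨Φ.symm w, ⟨by rwa [mem_preimage, Φ.right_inv hwt], hfw⟩, Φ.right_inv hwt⟩

variable [MeasurableSpace X] [BorelSpace X]

/-- Change of variables along `Φ ∘ e.symm`: its real Jacobian `|Φ'|²` is exactly the factor by which
the densities in the two charts differ. All local measures are thus restrictions of one measure.
Second countability of `X` is inherited from the plane. -/
theorem measureOfDensity_eq (h : IsGlobalChart Φ R) (hF : IsSphereMap R fun z => f (Φ.symm z)) :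
    measureOfDensity (pullbackFS f) = Measure.map Φ.symm ((volume.restrict Φ.target).withDensity
      fun z => ENNReal.ofReal (fsDensity (fun w => f (Φ.symm w)) z)) := by
  have hemb : Topology.IsOpenEmbedding Φ := Φ.isOpenEmbedding h.source_eq
  have : SecondCountableTopology X := hemb.isEmbedding.secondCountableTopology
  refine iSup_restrict_source _ _ fun e he => Measure.ext fun A hA => ?_
  rw [Measure.restrict_apply hA, map_withDensity_apply e _ hA,
    map_withDensity_apply Φ _ (hA.inter e.open_source.measurableSet)]
  have hD : MeasurableSet (e.target ∩ e.symm ⁻¹' A) := by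
    have hc : Measurable (e.target.domRestrict e.symm) :=
      (continuousOn_iff_continuous_domRestrict.1 e.continuousOn_symm).measurable
    have := e.open_target.measurableSet.subtype_image (hc hA)
    convert this using 1
    ext z
    refine ⟨fun h => ⟨⟨z, h.1⟩, h.2, rfl⟩, ?_⟩
    rintro ⟨⟨z, hz⟩, h, rfl⟩
    exact ⟨hz, h⟩
  have himg : Φ.target ∩ Φ.symm ⁻¹' (A ∩ e.source) =
      (fun z => Φ (e.symm z)) '' (e.target ∩ e.symm ⁻¹' A) := by
    ext w
    constructor
    · rintro ⟨hw, hwA, hws⟩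
      refine ⟨e (Φ.symm w), ⟨e.map_source hws, ?_⟩, ?_⟩
      · rw [mem_preimage, e.left_inv hws]; exact hwA
      · simp only [e.left_inv hws, Φ.right_inv hw]
    · rintro ⟨z, ⟨hz, hzA⟩, rfl⟩
      refine ⟨Φ.map_source (h.source_eq ▸ mem_univ _), ?_⟩
      simp only [mem_preimage, h.left_inv]
      exact ⟨hzA, e.map_target hz⟩
  have hinj : InjOn (fun z => Φ (e.symm z)) (e.target ∩ e.symm ⁻¹' A) := fun z hz z' hz' hzz =>
    e.symm.injOn hz.1 hz'.1 (hemb.injective hzz)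
  rw [himg, lintegral_image_eq_lintegral_abs_det_fderiv_mul volume hD
    (f' := fun z => deriv (fun w => Φ (e.symm w)) z • (1 : ℂ →L[ℝ] ℂ))
    (fun z hz => (h.differentiableAt e he z hz.1).hasDerivAt.complexToReal_fderiv.hasFDerivWithinAt)
    hinj]
  refine setLIntegral_congr_fun hD fun z hz => ?_
  rw [h.pullbackFS_eq hF he hz.1, det_smul_one, abs_of_nonneg (by positivity),
    ENNReal.ofReal_mul (by positivity)]

theorem measureOfDensity_preimage_ball (h : IsGlobalChart Φ R)
    (hF : IsSphereMap R fun z => f (Φ.symm z)) {t : ℝ} (ht : (t : EReal) ≤ R) :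
    measureOfDensity (pullbackFS f) (Φ ⁻¹' Metric.ball 0 t) =
      ∫⁻ z in Metric.ball 0 t, ENNReal.ofReal (fsDensity (fun w => f (Φ.symm w)) z) := by
  have hemb : Topology.IsOpenEmbedding Φ := Φ.isOpenEmbedding h.source_eq
  rw [h.measureOfDensity_eq hF, map_withDensity_apply Φ _
    (Metric.isOpen_ball.preimage hemb.continuous).measurableSet]
  congr 2
  ext w
  simp only [mem_inter_iff, mem_preimage]
  constructor
  · rintro ⟨hw, hw'⟩
    rwa [Φ.right_inv hw] at hw'
  · intro hw
    have hwt : w ∈ Φ.target := h.target_eq ▸ ball_subset_openDisc ht hw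
    exact ⟨hwt, by rwa [Φ.right_inv hwt]⟩

end IsGlobalChart

namespace HolomorphicForm

variable {S : HolomorphicForm X} {o : X}

theorem exists_isGlobalChart [T2Space X] [IsManifold 𝓘(ℂ) ω X] [ConnectedSpace X]
    (hS : S.IsAdmissible o) (hex : S.IsExhaustion o) :
    ∃ Φ : OpenPartialHomeomorph X ℂ, IsGlobalChart Φ (S.radius o) ∧ ∀ x, Φ x = S.hat o x := by
  have : IsManifold 𝓘(ℝ, ℂ) ∞ X := isManifold_real
  have : Nonempty X := ⟨o⟩
  have hemb := isOpenEmbedding_hat hS hex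
  have hd : ∀ e ∈ atlas ℂ X, ∀ w ∈ e.target,
      HasDerivAt (fun z => S.hat o (e.symm z)) (S.coeff e w) w :=
    fun e he w hw => S.hasDerivAt_hat hS.zeroPeriods o he hw
  refine ⟨hemb.toOpenPartialHomeomorph _, ⟨rfl, ?_, fun e he w hw => (hd e he w hw).differentiableAt,
    fun e he w hw => ?_⟩, fun x => rfl⟩
  · rw [hemb.toOpenPartialHomeomorph_target, range_hat hS hex]
  · have := hS.nowhereVanishing e he w hw
    rwa [← (hd e he w hw).deriv] at this

end HolomorphicForm

end HoloNevanlinna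

namespace HoloNevanlinna

/-! ### Exceptional sets and the error term -/

/-- The real numbers between `0` and `R`. -/
def radii (R : EReal) : Set ℝ := {r : ℝ | 0 < r ∧ (r : EReal) < R}

/-- A measurable set of radii of finite `γ`-measure. -/
structure IsSmallSet (R : EReal) (γ : ℝ → ℝ) (E : Set ℝ) : Prop where
  measurableSet : MeasurableSet E
  subset : E ⊆ radii R
  lintegral_lt_top : ∫⁻ r in E, ENNReal.ofReal (γ r) < ⊤

theorem measurableSet_radii (R : EReal) : MeasurableSet (radii R) :=
  (isOpen_Ioi.inter (isOpen_Iio.preimage continuous_coe_real_ereal)).measurableSet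

variable {R : EReal} {γ : ℝ → ℝ}

theorem IsSmallSet.union {E E' : Set ℝ} (h : IsSmallSet R γ E) (h' : IsSmallSet R γ E') :
    IsSmallSet R γ (E ∪ E') :=
  ⟨h.1.union h'.1, union_subset h.2 h'.2,
    (lintegral_union_le _ _ _).trans_lt (ENNReal.add_lt_top.2 ⟨h.3, h'.3⟩)⟩

theorem IsSmallSet.of_null {Z : Set ℝ} (hZ : MeasurableSet Z) (h0 : volume Z = 0) :
    IsSmallSet R γ (Z ∩ radii R) := by
  refine ⟨hZ.inter (measurableSet_radii R), inter_subset_right, ?_⟩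
  rw [setLIntegral_measure_zero _ _ (measure_mono_null inter_subset_left h0)]
  exact ENNReal.zero_lt_top

theorem isSmallSet_Ioc (hγ : ∀ s : ℝ, 0 < s → (s : EReal) < R → IntegrableOn γ (Ioo 0 s)) {s : ℝ}
    (hs : 0 < s) (hsR : (s : EReal) < R) : IsSmallSet R γ (Ioc 0 s) := by
  refine ⟨measurableSet_Ioc, fun r hr => ⟨hr.1, lt_of_le_of_lt (EReal.coe_le_coe_iff.2 hr.2) hsR⟩, ?_⟩
  obtain ⟨s', hs', hsR'⟩ := EReal.exists_real_gt hsR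
  exact ((hγ s' (hs.trans hs') hsR').mono_set fun r hr =>
    ⟨hr.1, hr.2.trans_lt hs'⟩).lintegral_lt_top

/-- The growth lemma requires a measurable weight, but `γ` is only locally integrable. Countably
many intervals `(0, x)` with `x` rational make it almost everywhere measurable, and the null set is
thrown into the exceptional set. -/
theorem exists_measurable_version
    (hγ : ∀ s : ℝ, 0 < s → (s : EReal) < R → IntegrableOn γ (Ioo 0 s)) :
    ∃ g : ℝ → ℝ, Measurable g ∧ ∃ Z, MeasurableSet Z ∧ volume Z = 0 ∧
      ∀ r ∈ radii R, r ∉ Z → γ r = g r := by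
  have hI : radii R = ⋃ x : {x : ℚ // (0 : ℝ) < x ∧ ((x : ℝ) : EReal) < R}, Ioo (0 : ℝ) (x.1 : ℝ) := by
    ext r
    simp only [mem_iUnion]
    constructor
    · rintro ⟨h0, hR⟩
      obtain ⟨s, hs, hsR⟩ := EReal.exists_real_gt hR
      obtain ⟨x, hx1, hx2⟩ := exists_rat_btwn hs
      exact ⟨⟨x, h0.trans hx1, lt_trans (EReal.coe_lt_coe_iff.2 hx2) hsR⟩, h0, hx1⟩
    · rintro ⟨x, h0, hx⟩
      exact ⟨h0, lt_trans (EReal.coe_lt_coe_iff.2 hx) x.2.2⟩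
  have hm : AEMeasurable γ (volume.restrict (radii R)) := by
    rw [hI]
    exact aemeasurable_iUnion_iff.2 fun x => (hγ _ x.2.1 x.2.2).aestronglyMeasurable.aemeasurable
  have hae := (ae_restrict_iff' (measurableSet_radii R)).1 hm.ae_eq_mk
  refine ⟨hm.mk γ, hm.measurable_mk, toMeasurable volume {r | ¬ (r ∈ radii R → γ r = hm.mk γ r)},
    measurableSet_toMeasurable _ _, by rw [measure_toMeasurable]; exact hae, fun r hr hrZ => ?_⟩
  by_contra hne
  exact hrZ (subset_toMeasurable _ _ fun h => hne (h hr))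

theorem lintegral_version {g : ℝ → ℝ} {Z : Set ℝ} (h0 : volume Z = 0)
    (hg : ∀ r ∈ radii R, r ∉ Z → γ r = g r) {E : Set ℝ} (hE : MeasurableSet E) (hER : E ⊆ radii R) :
    ∫⁻ r in E, ENNReal.ofReal (γ r) = ∫⁻ r in E, ENNReal.ofReal (g r) := by
  refine setLIntegral_congr_fun_ae hE ?_
  filter_upwards [measure_eq_zero_iff_ae_notMem.1 h0] with r hr hrE
  rw [hg r (hER hrE) hr]

/-- On a bounded interval of radii, `γ` is large outside a small set. -/
theorem exists_isSmallSet_sublevel {ρ : ℝ}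
    (hγ : ∀ s : ℝ, 0 < s → (s : EReal) < (ρ : EReal) → IntegrableOn γ (Ioo 0 s)) (M : ℝ) :
    ∃ E, IsSmallSet ρ γ E ∧ ∀ r ∈ radii ρ, r ∉ E → M < γ r := by
  obtain ⟨g, hg, Z, hZ, hZ0, hgZ⟩ := exists_measurable_version hγ
  have hm : MeasurableSet ({r | g r ≤ M} ∩ radii ρ) :=
    (measurableSet_le hg measurable_const).inter (measurableSet_radii _)
  refine ⟨({r | g r ≤ M} ∩ radii ρ) ∪ (Z ∩ radii ρ),
    IsSmallSet.union ⟨hm, inter_subset_right, ?_⟩ (IsSmallSet.of_null hZ hZ0), fun r hr hrE => ?_⟩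
  · rw [lintegral_version hZ0 hgZ hm inter_subset_right]
    calc ∫⁻ r in {r | g r ≤ M} ∩ radii ρ, ENNReal.ofReal (g r)
        ≤ ∫⁻ r in {r | g r ≤ M} ∩ radii ρ, ENNReal.ofReal M :=
          setLIntegral_mono' hm fun r hr => ENNReal.ofReal_le_ofReal hr.1
      _ = ENNReal.ofReal M * volume ({r | g r ≤ M} ∩ radii ρ) := by rw [setLIntegral_const]
      _ < ⊤ := by
          refine ENNReal.mul_lt_top ENNReal.ofReal_lt_top ?_
          refine lt_of_le_of_lt (measure_mono (t := Ioo 0 ρ) fun r hr =>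
            ⟨hr.2.1, EReal.coe_lt_coe_iff.1 hr.2.2⟩) ?_
          rw [Real.volume_Ioo]
          exact ENNReal.ofReal_lt_top
  · simp only [mem_union, mem_inter_iff, hr, and_true, not_or] at hrE
    rw [hgZ r hr hrE.2]
    exact not_le.1 hrE.1

/-- The constants in the error term are absorbed by the growth of `T` if the radius is infinite. -/
theorem exists_error_bound_top {r₀ : ℝ} (hr₀ : 0 < r₀)
    (hγ : ∀ s : ℝ, 0 < s → (s : EReal) < ⊤ → IntegrableOn γ (Ioo 0 s)) {T D H : ℝ → ℝ} {κ : ℝ}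
    (hκ : 0 < κ) (hT : ∀ r, r₀ ≤ r → κ * Real.log (r / r₀) ≤ T r) {L : ℝ} (hL : 0 ≤ L)
    (hH : ∀ r, 0 < r → -L ≤ H r) {c : ℝ} (hc : 0 ≤ c)
    (hmain : ∀ δ, 0 < δ → δ ≤ 1 → ∃ E, IsSmallSet ⊤ γ E ∧ ∀ r ∈ radii ⊤, r ∉ E →
      D r ≤ c * (1 + Real.posLog (T r) + Real.posLog (γ r) + δ * Real.posLog r)) :
    ∃ A : ℝ, 0 < A ∧ ∀ δ, 0 < δ → ∃ E, IsSmallSet ⊤ γ E ∧ ∀ r ∈ radii ⊤, r ∉ E →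
      D r ≤ A * (Real.log (T r) + H r + Real.posLog (γ r) + δ * Real.log r) := by
  -- Once `log T ≥ K`, one spare copy of `log T` pays for the constant `c` and for the possibly
  -- negative `H`. The threshold `s` ensures this through the logarithmic growth of `T`, and `s ≥ 1`
  -- makes `log r` nonnegative.
  set K := c + (2 * c + 1) * L with hK
  have hK0 : 0 ≤ K := by positivity
  set s := max 1 (r₀ * Real.exp (Real.exp K / κ)) with hs
  have hs1 : 1 ≤ s := le_max_left _ _
  refine ⟨2 * c + 1, by linarith, fun δ hδ => ?_⟩
  -- A larger `δ` only weakens the claim for `r ≥ 1`, so it may be cut at `1`.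
  obtain ⟨E, hE, h⟩ := hmain (min δ 1) (lt_min hδ one_pos) (min_le_right _ _)
  refine ⟨E ∪ Ioc 0 s, hE.union (isSmallSet_Ioc hγ (by linarith) (EReal.coe_lt_top s)),
    fun r hr hrE => ?_⟩
  simp only [mem_union, not_or, mem_Ioc, not_and, not_le] at hrE
  have hsr := hrE.2 hr.1
  have h1 := h r hr hrE.1
  have hr1 : 1 ≤ r := hs1.trans hsr.le
  have hrr : r₀ * Real.exp (Real.exp K / κ) ≤ r := (le_max_right _ _).trans hsr.le
  have hr₀r : r₀ ≤ r := by
    refine le_trans ?_ hrr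
    exact le_mul_of_one_le_right hr₀.le (Real.one_le_exp (by positivity))
  have hlog : Real.exp K ≤ T r := by
    refine le_trans ?_ (hT r hr₀r)
    have : Real.exp K / κ ≤ Real.log (r / r₀) := by
      rw [Real.le_log_iff_exp_le (by positivity), le_div_iff₀ hr₀]
      linarith
    rw [div_le_iff₀ hκ] at this
    linarith
  have hlogT : K ≤ Real.log (T r) := by
    rwa [Real.le_log_iff_exp_le ((Real.exp_pos K).trans_le hlog)]
  have e1 : Real.posLog (T r) = Real.log (T r) := by
    rw [Real.posLog, max_eq_right (hK0.trans hlogT)]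
  have hlr := Real.log_nonneg hr1
  have e2 : Real.posLog r = Real.log r := by rw [Real.posLog, max_eq_right hlr]
  rw [e1, e2] at h1
  have hpg : 0 ≤ Real.posLog (γ r) := Real.posLog_nonneg
  have h2 := hH r hr.1
  have h3 : min δ 1 * Real.log r ≤ δ * Real.log r := by
    gcongr; exact min_le_left _ _
  have h4 : 0 ≤ δ * Real.log r := by positivity
  have h5 : c * (min δ 1 * Real.log r) ≤ c * (δ * Real.log r) := by gcongr
  have h6 : (2 * c + 1) * (-L) ≤ (2 * c + 1) * H r := by gcongr
  have h7 : c * K ≤ c * Real.log (T r) := by gcongr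
  have h8 : 0 ≤ c * K := by positivity
  have h9 : 0 ≤ c * Real.posLog (γ r) := by positivity
  have h10 : 0 ≤ c * (δ * Real.log r) := by positivity
  linarith

/-- The constants in the error term are absorbed by `γ` if the radius is finite. -/
theorem exists_error_bound_coe {r₀ ρ : ℝ} (hr₀ : 0 < r₀) (hρ : r₀ < ρ)
    (hγ : ∀ s : ℝ, 0 < s → (s : EReal) < (ρ : EReal) → IntegrableOn γ (Ioo 0 s)) {T D H : ℝ → ℝ}
    {κ : ℝ} (hκ : 0 < κ) (hT : ∀ r, r₀ ≤ r → r < ρ → κ * Real.log (r / r₀) ≤ T r) {L : ℝ}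
    (hH : ∀ r, 0 < r → -L ≤ H r) {c : ℝ} (hc : 0 ≤ c)
    (hmain : ∀ δ, 0 < δ → δ ≤ 1 → ∃ E, IsSmallSet ρ γ E ∧ ∀ r ∈ radii ρ, r ∉ E →
      D r ≤ c * (1 + Real.posLog (T r) + Real.posLog (γ r) + δ * Real.posLog r)) :
    ∃ A : ℝ, 0 < A ∧ ∀ δ, 0 < δ → ∃ E, IsSmallSet ρ γ E ∧ ∀ r ∈ radii ρ, r ∉ E →
      D r ≤ A * (Real.log (T r) + H r + Real.posLog (γ r) + δ * Real.log r) := by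
  obtain ⟨r₂, hr₂, hr₂ρ⟩ := exists_between hρ
  have hr₂0 : 0 < r₂ := hr₀.trans hr₂
  set τ := κ * Real.log (r₂ / r₀) with hτ
  have hτ0 : 0 < τ := mul_pos hκ (Real.log_pos ((one_lt_div hr₀).2 hr₂))
  refine ⟨c + 1, by linarith, fun δ hδ => ?_⟩
  obtain ⟨E, hE, h⟩ := hmain (min δ 1) (lt_min hδ one_pos) (min_le_right _ _)
  -- Everything bounded is collected here and paid by one spare copy of `log⁺ γ`. The number `M`
  -- depends on `δ`, but it affects only the exceptional set and not `A = c + 1`.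
  set M := (c + 1) * |Real.log τ| + (c + 1) * L + c + c * Real.posLog ρ +
    (c + 1) * (δ * |Real.log r₂|) with hM
  obtain ⟨E', hE', h'⟩ := exists_isSmallSet_sublevel hγ (Real.exp M)
  refine ⟨E ∪ E' ∪ Ioc 0 r₂, (hE.union hE').union
    (isSmallSet_Ioc hγ hr₂0 (EReal.coe_lt_coe_iff.2 hr₂ρ)), fun r hr hrE => ?_⟩
  simp only [mem_union, not_or, mem_Ioc, not_and, not_le] at hrE
  obtain ⟨⟨hrE1, hrE2⟩, hrE3⟩ := hrE
  have hr₂r := hrE3 hr.1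
  have hrρ : r < ρ := EReal.coe_lt_coe_iff.1 hr.2
  have h1 := h r hr hrE1
  have hTr : τ ≤ T r := by
    refine le_trans ?_ (hT r (hr₂.trans hr₂r).le hrρ)
    rw [hτ]
    gcongr
  have hlT : -|Real.log τ| ≤ Real.log (T r) :=
    (neg_abs_le _).trans (Real.log_le_log hτ0 hTr)
  have hlT' : Real.posLog (T r) ≤ Real.log (T r) + |Real.log τ| := by
    rw [Real.posLog]
    exact max_le (by linarith) (by linarith [abs_nonneg (Real.log τ)])
  have hlr : -|Real.log r₂| ≤ Real.log r := (neg_abs_le _).trans (Real.log_le_log hr₂0 hr₂r.le)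
  have hlr' : min δ 1 * Real.posLog r ≤ Real.posLog ρ :=
    (mul_le_of_le_one_left Real.posLog_nonneg (min_le_right _ _)).trans
      (Real.posLog_le_posLog hr.1.le hrρ.le)
  have hg : M ≤ Real.posLog (γ r) := by
    have h3 := h' r hr hrE2
    refine le_trans ?_ (le_max_right _ _)
    rw [Real.le_log_iff_exp_le ((Real.exp_pos M).trans h3)]
    exact h3.le
  have h2 := hH r hr.1
  have k1 : c * Real.posLog (T r) ≤ c * (Real.log (T r) + |Real.log τ|) := by gcongr
  have k2 : c * (min δ 1 * Real.posLog r) ≤ c * Real.posLog ρ := by gcongr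
  have k3 : (c + 1) * (δ * -|Real.log r₂|) ≤ (c + 1) * (δ * Real.log r) := by gcongr
  have k4 : (c + 1) * (-L) ≤ (c + 1) * H r := by gcongr
  linarith

theorem exists_error_bound {r₀ : ℝ} (hr₀ : 0 < r₀) (hr₀R : (r₀ : EReal) < R)
    (hγ : ∀ s : ℝ, 0 < s → (s : EReal) < R → IntegrableOn γ (Ioo 0 s)) {T D H : ℝ → ℝ} {κ : ℝ}
    (hκ : 0 < κ) (hT : ∀ r : ℝ, r₀ ≤ r → (r : EReal) < R → κ * Real.log (r / r₀) ≤ T r) {L : ℝ}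
    (hL : 0 ≤ L) (hH : ∀ r, 0 < r → -L ≤ H r) {c : ℝ} (hc : 0 ≤ c)
    (hmain : ∀ δ, 0 < δ → δ ≤ 1 → ∃ E, IsSmallSet R γ E ∧ ∀ r ∈ radii R, r ∉ E →
      D r ≤ c * (1 + Real.posLog (T r) + Real.posLog (γ r) + δ * Real.posLog r)) :
    ∃ A : ℝ, 0 < A ∧ ∀ δ, 0 < δ → ∃ E, IsSmallSet R γ E ∧ ∀ r ∈ radii R, r ∉ E →
      D r ≤ A * (Real.log (T r) + H r + Real.posLog (γ r) + δ * Real.log r) := by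
  induction R using EReal.rec with
  | bot => exact absurd hr₀R not_lt_bot
  | coe ρ =>
    exact exists_error_bound_coe hr₀ (EReal.coe_lt_coe_iff.1 hr₀R) hγ hκ
      (fun r h1 h2 => hT r h1 (EReal.coe_lt_coe_iff.2 h2)) hH hc hmain
  | top =>
    exact exists_error_bound_top hr₀ hγ hκ (fun r h1 => hT r h1 (EReal.coe_lt_top r)) hL hH hc hmain

/-! ### The second main theorem -/

namespace IsCurveData

variable {m : ℕ} {a : Fin m → ℂ × ℂ} {σ : ℂ → ℝ} {v : Fin m → ℂ → ℝ}

/-- The area is increasing in the radius, so it is at least its value at `r₀` throughout the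
integral. -/
theorem sphArea_mul_log_le (h : IsCurveData R a σ v) {r₀ r : ℝ} (hr₀ : 0 < r₀) (hr : r₀ ≤ r)
    (hR : (r : EReal) < R) : sphArea σ r₀ * Real.log (r / r₀) ≤ ∫ t in r₀..r, sphArea σ t / t := by
  rw [← integral_inv_of_pos hr₀ (hr₀.trans_le hr), ← intervalIntegral.integral_const_mul]
  refine intervalIntegral.integral_mono_on hr ?_ (h.intervalIntegrable_sphArea_div hr₀ hr hR)
    fun t ht => ?_
  · refine ContinuousOn.intervalIntegrable (continuousOn_const.mul (continuousOn_id.inv₀ ?_))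
    intro t ht
    rw [uIcc_of_le hr] at ht
    exact (hr₀.trans_le ht.1).ne'
  · rw [div_eq_mul_inv]
    have ht0 : 0 < t := hr₀.trans_le ht.1
    gcongr
    exact h.sphArea_mono ht.1 (lt_of_le_of_lt (EReal.coe_le_coe_iff.2 ht.2) hR)

/-- The second main theorem on a disc, with the exceptional set measured by an integrable weight. -/
theorem exists_isSmallSet (h : IsCurveData R a σ v) {r₀ : ℝ} (hr₀ : 0 < r₀)
    (hr₀R : (r₀ : EReal) < R)
    (hγ : ∀ s : ℝ, 0 < s → (s : EReal) < R → IntegrableOn γ (Ioo 0 s)) :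
    ∃ c : ℝ, 0 ≤ c ∧ ∀ δ, 0 < δ → δ ≤ 1 → ∃ E, IsSmallSet R γ E ∧ ∀ r ∈ radii R, r ∉ E →
      r₀ ≤ r ∧ ((m : ℝ) - 2) * (∫ t in r₀..r, sphArea σ t / t) -
        ∑ j, (∫ t in r₀..r, (({z | z ∈ Metric.ball (0 : ℂ) t ∧ v j z = 0}.ncard : ℝ) / t)) ≤
        c * (1 + Real.posLog (∫ t in r₀..r, sphArea σ t / t) + Real.posLog (γ r) +
          δ * Real.posLog r) := by
  -- Without target points the left side is `-2 T ≤ 0`; the general argument needs at least one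
  -- form.
  rcases Nat.eq_zero_or_pos m with hm | hm
  · subst hm
    refine ⟨0, le_rfl, fun δ _ _ => ⟨_, isSmallSet_Ioc hγ hr₀ hr₀R, fun r hr hrE => ?_⟩⟩
    have hr₀r : r₀ ≤ r := (not_le.1 fun hle => hrE ⟨hr.1, hle⟩).le
    refine ⟨hr₀r, ?_⟩
    have : 0 ≤ ∫ t in r₀..r, sphArea σ t / t := intervalIntegral.integral_nonneg hr₀r fun t ht =>
      div_nonneg (sphArea_nonneg t) (hr₀.le.trans ht.1)
    simp only [Nat.cast_zero, Finset.univ_eq_empty, Finset.sum_empty, zero_mul]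
    linarith
  · obtain ⟨g, hg, Z, hZ, hZ0, hgZ⟩ := exists_measurable_version hγ
    obtain ⟨c, r₁, hc, hr₁, hr₁R, hmain⟩ := h.second_main_theorem hm hr₀ hr₀R hg
    refine ⟨c, hc, fun δ hδ0 hδ1 => ?_⟩
    obtain ⟨E, mE, iE, hE⟩ := hmain δ hδ0 hδ1
    have hER : MeasurableSet (E ∩ radii R) := mE.inter (measurableSet_radii R)
    have hsmall : IsSmallSet R γ (E ∩ radii R) := ⟨hER, inter_subset_right, by
      rw [lintegral_version hZ0 hgZ hER inter_subset_right]
      exact (lintegral_mono_set inter_subset_left).trans_lt iE⟩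
    refine ⟨E ∩ radii R ∪ Z ∩ radii R ∪ Ioc 0 r₁, (hsmall.union (IsSmallSet.of_null hZ hZ0)).union
      (isSmallSet_Ioc hγ (hr₀.trans hr₁) hr₁R), fun r hr hrE => ?_⟩
    simp only [mem_union, mem_inter_iff, hr, and_true, not_or, mem_Ioc, not_and, not_le] at hrE
    obtain ⟨⟨h1, h2⟩, h3⟩ := hrE
    have h4 := hE r (h3 hr.1) hr.2 h1
    rw [hgZ r hr h2]
    exact ⟨(hr₁.trans (h3 hr.1)).le, by linarith⟩

end IsCurveData

namespace HolomorphicForm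

variable {X : Type*} [TopologicalSpace X] [ChartedSpace ℂ X] {S : HolomorphicForm X} {o : X}

theorem pointNorm_nonneg (h : HermitianMetric X) (x : X) : 0 ≤ S.pointNorm h x :=
  div_nonneg (norm_nonneg _) (Real.sqrt_nonneg _)

theorem pointNorm_pos (hS : S.NowhereVanishing) (h : HermitianMetric X) (x : X) :
    0 < S.pointNorm h x :=
  div_pos (norm_pos_iff.2 (hS _ (chart_mem_atlas ℂ x) _ (mem_chart_target ℂ x)))
    (Real.sqrt_pos.2 (h.pos _ (chart_mem_atlas ℂ x) _ (mem_chart_target ℂ x)))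

theorem normInf_nonneg (h : HermitianMetric X) (r : ℝ) : 0 ≤ S.normInf h o r :=
  Real.sInf_nonneg (by rintro _ ⟨x, -, rfl⟩; exact pointNorm_nonneg h x)

/-- The point `o` lies in every disc, so the supremum is at least the norm there. If the norm is
unbounded on the disc, `sSup` is `0` and its logarithm is `0`, so the bound survives. -/
theorem log_normSup_ge (hS : S.IsAdmissible o) (h : HermitianMetric X) {r : ℝ} (hr : 0 < r) :
    -|Real.log (S.pointNorm h o)| ≤ Real.log (S.normSup h o r) := by
  have ho : o ∈ S.disc o r := by
    show ‖S.hat o o‖ < r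
    rwa [(hS.hat_eq_zero_iff o).2 rfl, norm_zero]
  by_cases hb : BddAbove (S.pointNorm h '' S.disc o r)
  · exact (neg_abs_le _).trans (Real.log_le_log (pointNorm_pos hS.nowhereVanishing h o)
      (le_csSup hb ⟨o, ho, rfl⟩))
  · rw [normSup, Real.sSup_of_not_bddAbove hb, Real.log_zero]
    exact neg_nonpos.2 (abs_nonneg _)

variable {Φ : OpenPartialHomeomorph X ℂ} {f : X → OnePoint ℂ}

theorem disc_eq (hΦ : ∀ x, Φ x = S.hat o x) (t : ℝ) : S.disc o t = Φ ⁻¹' Metric.ball 0 t := by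
  ext x
  rw [mem_preimage, mem_ball_zero_iff, hΦ]
  rfl

theorem characteristic_eq [MeasurableSpace X] [BorelSpace X] (hg : IsGlobalChart Φ (S.radius o))
    (hΦ : ∀ x, Φ x = S.hat o x) (hF : IsSphereMap (S.radius o) fun z => f (Φ.symm z)) {r₀ r : ℝ}
    (hr : r₀ ≤ r) (hR : (r : EReal) < S.radius o) :
    S.characteristic o r₀ f r = ∫ t in r₀..r, sphArea ((openDisc (S.radius o)).indicator
      fun z => Real.pi * fsDensity (fun w => f (Φ.symm w)) z) t / t := by
  refine intervalIntegral.integral_congr fun t ht => ?_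
  rw [uIcc_of_le hr] at ht
  have htR : (t : EReal) ≤ S.radius o := (lt_of_le_of_lt (EReal.coe_le_coe_iff.2 ht.2) hR).le
  rw [disc_eq hΦ, hg.measureOfDensity_preimage_ball hF htR, sphArea]
  congr 2
  refine setLIntegral_congr_fun Metric.isOpen_ball.measurableSet fun z hz => ?_
  simp only [indicator_of_mem (ball_subset_openDisc htR hz)]
  rw [mul_div_cancel_left₀ _ Real.pi_ne_zero]

theorem simpleCounting_eq (hg : IsGlobalChart Φ (S.radius o)) (hΦ : ∀ x, Φ x = S.hat o x)
    {r₀ r : ℝ} (hr : r₀ ≤ r) (hR : (r : EReal) < S.radius o) (b : OnePoint ℂ) :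
    S.simpleCounting o r₀ f b r = ∫ t in r₀..r, (({z | z ∈ Metric.ball (0 : ℂ) t ∧
      (openDisc (S.radius o)).indicator (fun z => sphereChord (sphereCovector b) (f (Φ.symm z))) z
        = 0}.ncard : ℝ) / t) := by
  refine intervalIntegral.integral_congr fun t ht => ?_
  rw [uIcc_of_le hr] at ht
  have htR : (t : EReal) ≤ S.radius o := (lt_of_le_of_lt (EReal.coe_le_coe_iff.2 ht.2) hR).le
  rw [disc_eq hΦ, hg.ncard_preimage_ball htR]
  congr 3
  ext z
  refine and_congr_right fun hz => ?_
  rw [indicator_of_mem (ball_subset_openDisc htR hz), sphereChord_eq_zero_iff]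

end HolomorphicForm

end HoloNevanlinna

end

theorem mainTheorem7 {X : Type*} [TopologicalSpace X] [T2Space X] [ConnectedSpace X]
    [NoncompactSpace X] [ChartedSpace ℂ X] [IsManifold 𝓘(ℂ) ω X]
    [MeasurableSpace X] [BorelSpace X]
    (h : HoloNevanlinna.HermitianMetric X) (S : HoloNevanlinna.HolomorphicForm X) (o : X)
    (hS : S.IsAdmissible o) (hex : S.IsExhaustion o)
    (r₀ : ℝ) (hr₀ : 0 < r₀) (hr₀R : (r₀ : EReal) < S.radius o)
    (γ : ℝ → ℝ) (hγ_nonneg : ∀ r : ℝ, 0 < r → (r : EReal) < S.radius o → 0 ≤ γ r)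
    (hγ_int : ∀ s : ℝ, 0 < s → (s : EReal) < S.radius o → IntegrableOn γ (Ioo 0 s))
    (hγ_top : ∫⁻ r in {r : ℝ | 0 < r ∧ (r : EReal) < S.radius o}, ENNReal.ofReal (γ r) = ⊤)
    (f : X → OnePoint ℂ) (hf : HoloNevanlinna.IsMeromorphic f) (hfc : ¬ ∃ c, ∀ x, f x = c)
    (q : ℕ) (a : Fin q → OnePoint ℂ) (ha : Function.Injective a)
    (C : ℝ) (hC : 0 ≤ C)
    (hK : ∀ x, -C ≤ h.gaussCurvature x ∧ h.gaussCurvature x ≤ 0) :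
    ∃ A : ℝ, 0 < A ∧ ∀ δ : ℝ, 0 < δ →
      ∃ E : Set ℝ, MeasurableSet E ∧ E ⊆ {r : ℝ | 0 < r ∧ (r : EReal) < S.radius o} ∧
        ∫⁻ r in E, ENNReal.ofReal (γ r) < ⊤ ∧
        ∀ r : ℝ, 0 < r → (r : EReal) < S.radius o → r ∉ E →
          ((q : ℝ) - 2) * S.characteristic o r₀ f r ≤
            ∑ j, S.simpleCounting o r₀ f (a j) r +
              A * (Real.log (S.characteristic o r₀ f r) + C * r ^ 2 * (S.normInf h o r)⁻¹ +
                Real.log (S.normSup h o r) + Real.posLog (γ r) + δ * Real.log r) := by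
  obtain ⟨Φ, hg, hΦ⟩ := HoloNevanlinna.HolomorphicForm.exists_isGlobalChart hS hex
  have hF := hg.isSphereMap hf hfc
  have hD := hF.isCurveData ha
  obtain ⟨c, hc, hmain⟩ := hD.exists_isSmallSet hr₀ hr₀R hγ_int
  have hN := fun r h1 h2 j =>
    HoloNevanlinna.HolomorphicForm.simpleCounting_eq (f := f) (r₀ := r₀) (r := r) hg hΦ h1 h2 (a j)
  have hT := fun r h1 h2 =>
    HoloNevanlinna.HolomorphicForm.characteristic_eq (r₀ := r₀) (r := r) hg hΦ hF h1 h2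
  obtain ⟨A, hA, h⟩ := HoloNevanlinna.exists_error_bound
    (T := S.characteristic o r₀ f)
    (D := fun r => ((q : ℝ) - 2) * S.characteristic o r₀ f r -
      ∑ j, S.simpleCounting o r₀ f (a j) r)
    -- The two metric terms together. The first is nonnegative and the second is bounded below by
    -- the norm at `o`; this lower bound is all that the absorption of constants requires.
    (H := fun r => C * r ^ 2 * (S.normInf h o r)⁻¹ + Real.log (S.normSup h o r))
    hr₀ hr₀R hγ_int (hD.sphArea_pos hr₀ hr₀R)
    (fun r h1 h2 => (hT r h1 h2).symm ▸ hD.sphArea_mul_log_le hr₀ h1 h2)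
    (abs_nonneg (Real.log (S.pointNorm h o)))
    (fun r hr => by
      have h1 := HoloNevanlinna.HolomorphicForm.log_normSup_ge hS h hr
      have h2 : 0 ≤ C * r ^ 2 * (S.normInf h o r)⁻¹ :=
        mul_nonneg (by positivity)
          (inv_nonneg.2 (HoloNevanlinna.HolomorphicForm.normInf_nonneg h r))
      linarith)
    hc
    (fun δ hδ0 hδ1 => by
      obtain ⟨E, hE, h⟩ := hmain δ hδ0 hδ1
      refine ⟨E, hE, fun r hr hrE => ?_⟩
      obtain ⟨h1, h2⟩ := h r hr hrE
      rw [hT r h1 hr.2, Finset.sum_congr rfl fun j _ => hN r h1 hr.2 j]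
      exact h2)
  refine ⟨A, hA, fun δ hδ => ?_⟩
  obtain ⟨E, hE, hE'⟩ := h δ hδ
  refine ⟨E, hE.measurableSet, hE.subset, hE.lintegral_lt_top, fun r hr hR hrE => ?_⟩
  have := hE' r ⟨hr, hR⟩ hrE
  linarith
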